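/- Let $\sigma_0=I,\sigma_1,\sigma_2,\sigma_3$ be the Pauli operators, let $X=(X_0,X_1)$, $Y=(Y_0,Y_1)$, $Z=(Z_0,Z_1)$, $W=(W_0,W_1)$ be the single-qubit projective measurements $\big(\tfrac{I+A}{2},\tfrac{I-A}{2}\big)$ for $A=\sigma_1,\ \sigma_2,\ \sigma_3,\ (\sigma_1+\sigma_2)/\sqrt2$ respectively, and for such a measurement $M=(M_0,M_1)$ put $\overline{M}=(M_1,M_0)$. For single-qubit measurements $M^{(1)},\dots,M^{(k)}$ let $\oplus[M^{(1)},\dots,M^{(k)}]$ be the $k$-qubit measurement $(P_0,P_1)$ with $P_i=\sum_{j_1\oplus\cdots\oplus j_k=i}M^{(1)}_{j_1}\otimes\cdots\otimes M^{(k)}_{j_k}$. Let $S$ be the set consisting of $$\oplus[X,X],\ \oplus[Z,Z],\ \oplus[X,\overline X],\ \oplus[Z,\overline Z],\ \oplus[X,Z],\ \oplus[Z,X],\ \oplus[X,W],\ \oplus[X,Y],\ \oplus[X,\overline Y],\ \oplus[X,X,X],\ \oplus[Z,Z,Z].$$ Let $H$ be the Hadamard gate, $T=e^{-i\pi\sigma_3/8}$,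 and C-NOT $|a,b\rangle\mapsto|a,a\oplus b\rangle$. For a unitary $U$ on $n$ qubits and $j\in\{0,1,2,3\}^n$ write $\sigma_j=\sigma_{j_1}\otimes\cdots\otimes\sigma_{j_n}$ and let $|U_j\rangle=(I\otimes U\sigma_j)|\mathrm{EPR}\rangle^{\otimes n}$ be the state of $2n$ qubits in which qubit $i$ is paired with qubit $n+i$ and $U\sigma_j$ acts on the last $n$ qubits; Nielsen's scheme simulates $U$ by trials that use the measurement in the basis $\{|U_j\rangle\}$ and Bell measurements, and if a trial leaves $U\sigma_e|\psi\rangle$ (up to phase) then the next trial simulates $U\sigma_eU^\dagger$. For errors $e_1,\dots,e_r\in\{0,1,2,3\}^n$ let $U^{(0)}=U$, $U^{(s)}=U^{(s-1)}\sigma_{e_s}(U^{(s-1)})^\dagger$; thus $U^{(r)}$ is the gate to be simulated in trial $r+1$. A *measurement protocol over $S$* acts on a register of qubits (initially the $n$ input qubits), performs a bounded number of operations, each of which prepares a new qubit in the state $|0\rangle$ or makes a measurement of $S$ on some qubits of the register, where each operation may depend on the earlier outcomes, and ends by naming $n$ output qubits or by reporting failure. It *simulates* a unitary $V$ on $n$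 qubits with failure probability at most $\delta$ if for every input state $|\psi\rangle$ it reports failure with probability at most $\delta$, and whenever it does not report failure the output qubits are in the state $V|\psi\rangle$ up to phase, in a product with the other qubits. Then: 1. $S$ is finite; each measurement in $S$ is a binary projective measurement (two orthogonal projections of equal rank) and is $\oplus$-separate, with single-qubit measurements from $\{X,Y,Z,W\}$ up to exchange of the two outcomes; all measurements in $S$ act on two qubits except exactly two, which act on three qubits. 2. The measurement in the Bell basis $\{|I_j\rangle\}$ of two qubits is equivalent to the two commuting measurements $\oplus[X,X]$, $\oplus[Z,Z]$ in sequence. For each $U\in\{H,T,\text{C-NOT}\}$ (with $n=1,1,2$ qubits) and all errors $e_1,\dots,e_r$, $r\ge0$, the measurement in the basis $\{|U^{(r)}_j\rangle\}$ is equivalent to a sequence of $2n$ pairwise commuting measurements of $S$ on some of the $2n$ qubits. If $r\ge1$ for $U=H$ or C-NOT, or $r\ge2$ for $U=T$, then $U^{(r)}$ is a tensor product of Pauli operators up to phase, and the sequence can be chosen to consist only of Bell measurements $\oplus[X,X]$, $\oplus[Z,Z]$ on pairs of qubits $i$, $n+i$. 3. For every circuit on $n$ qubits with gates $g_1,\dots,g_m$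 from $\{H,T,\text{C-NOT}\}$, where $g_k$ acts on $a_k\in\{1,2\}$ qubits, and every $t\ge0$, there is a measurement protocol over $S$ with at most $\sum_k 6a_kt$ operations that simulates the unitary operator of the circuit with failure probability at most $\sum_k(1-4^{-a_k})^t$. 4. $S$ is universal for quantum computation: for every $n$, every unitary $U$ on $n$ qubits and every $\varepsilon>0$ there are a unitary $V$ with $\|V-U\|\le\varepsilon$ in operator norm and a measurement protocol over $S$ that simulates $V$ with failure probability at most $\varepsilon$. In particular, measurements on at most three qubits, together with quantum memory and preparation of $|0\rangle$, suffice for universal quantum computation. -/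

import Mathlib

noncomputable section

namespace MeasQC

open Matrix

/-! ### Qubit registers -/

/-- Labels of the computational basis of `n` qubits. -/
abbrev Bits (n : ℕ) : Type := Fin n → Fin 2

/-- Operators on `n` qubits, as matrices in the computational basis. -/
abbrev QOp (n : ℕ) : Type := Matrix (Bits n) (Bits n) ℂ

/-- State vectors of `n` qubits (not necessarily normalized). -/
abbrev QState (n : ℕ) : Type := Bits n → ℂ

/-- The squared norm of a state vector. -/
def normSq {n : ℕ} (ψ : QState n) : ℝ := ∑ x, ‖ψ x‖ ^ 2

/-- The tensor product `A 0 ⊗ A 1 ⊗ ⋯ ⊗ A (n-1)` of single-qubit operators. -/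
def tensor {n : ℕ} (A : Fin n → Matrix (Fin 2) (Fin 2) ℂ) : QOp n :=
  Matrix.of fun x y => ∏ k, A k (x k) (y k)

/-- The operator on `N` qubits that acts as `A` on the qubits `e 0, …, e (n-1)` (in this order)
and as the identity on all the other qubits. -/
def embed {n N : ℕ} (e : Fin n ↪ Fin N) (A : QOp n) : QOp N :=
  Matrix.of fun x y =>
    open Classical in
    if ∀ k, k ∉ Set.range e → x k = y k then A (fun i => x (e i)) (fun i => y (e i)) else 0

/-- The state `φ ⊗ |0⟩` on `N + 1` qubits. -/
def adjoinZero {N : ℕ} (φ : QState N) : QState (N + 1) :=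
  fun x => if x (Fin.last N) = 0 then φ (fun i => x i.castSucc) else 0

/-! ### Projective measurements -/

/-- A projective measurement with outcomes in `κ`: mutually annihilating orthogonal projections
that add up to the identity. -/
def IsProjMeas {κ ι : Type} [Fintype κ] [DecidableEq κ] [Fintype ι] [DecidableEq ι]
    (P : κ → Matrix ι ι ℂ) : Prop :=
  (∀ i, (P i).IsHermitian) ∧ (∀ i j, P i * P j = if i = j then P i else 0) ∧ ∑ i, P i = 1

/-- A binary projective measurement: two outcomes with the same degeneracy, i.e. each of the two
projections has half of the full dimension as its trace. -/
def IsBinary {ι : Type} [Fintype ι] [DecidableEq ι] (P : Fin 2 → Matrix ι ι ℂ) : Prop :=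
  IsProjMeas P ∧ ∀ i, 2 * (P i).trace = (Fintype.card ι : ℂ)

/-- Exchange the names of the two outcomes. -/
def swapOutcomes {ι : Type} (P : Fin 2 → Matrix ι ι ℂ) : Fin 2 → Matrix ι ι ℂ := ![P 1, P 0]

/-- A Boolean function is balanced if it takes both values on half of its domain. -/
def IsBalanced {n : ℕ} (f : Bits n → Fin 2) : Prop :=
  ∀ i, 2 * (Finset.univ.filter fun j => f j = i).card = 2 ^ n

/-- `f[m 0, …, m (n-1)]`: the two-valued measurement whose outcome is the Boolean function `f` of
the outcomes of the single-qubit measurements `m k`. -/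
def combine {n : ℕ} (f : Bits n → Fin 2) (m : Fin n → Fin 2 → Matrix (Fin 2) (Fin 2) ℂ) :
    Fin 2 → QOp n :=
  fun i => ∑ j ∈ Finset.univ.filter (fun j : Bits n => f j = i), tensor fun k => m k (j k)

/-- `P` is an `f`-separate binary measurement, and the single-qubit binary measurements in its
`f`-separate form can be taken from `𝒜`. -/
def IsSeparateOver (𝒜 : Set (Fin 2 → Matrix (Fin 2) (Fin 2) ℂ)) {n : ℕ} (f : Bits n → Fin 2)
    (P : Fin 2 → QOp n) : Prop :=
  IsBalanced f ∧ IsBinary P ∧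
    ∃ m : Fin n → Fin 2 → Matrix (Fin 2) (Fin 2) ℂ,
      (∀ k, IsBinary (m k) ∧ m k ∈ 𝒜) ∧ P = combine f m

/-- The parity function (exclusive OR); the addition of `Fin 2` is modulo two. -/
def parity {n : ℕ} (j : Bits n) : Fin 2 := ∑ k, j k

/-- A two-valued measurement together with the number of qubits that it acts on. -/
abbrev QMeas : Type := Σ n : ℕ, (Fin 2 → QOp n)

/-! ### Pauli operators and the measurements of the universal set -/

/-- The Pauli operators `σ₀ = I`, `σ₁`, `σ₂`, `σ₃`. -/
def pauli : Fin 4 → Matrix (Fin 2) (Fin 2) ℂ :=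
  ![1, !![0, 1; 1, 0], !![0, -Complex.I; Complex.I, 0], !![1, 0; 0, -1]]

/-- The tensor product of the Pauli operators `σ_{j 0}, …, σ_{j (n-1)}`. -/
def pauliString {n : ℕ} (j : Fin n → Fin 4) : QOp n := tensor fun k => pauli (j k)

/-- The measurement `((I + A)/2, (I - A)/2)`. -/
def spectralMeas (A : Matrix (Fin 2) (Fin 2) ℂ) : Fin 2 → Matrix (Fin 2) (Fin 2) ℂ :=
  ![(1 / 2 : ℂ) • (1 + A), (1 / 2 : ℂ) • (1 - A)]

/-- The single-qubit measurement `(X₀, X₁)`. -/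
def measX : Fin 2 → Matrix (Fin 2) (Fin 2) ℂ := spectralMeas (pauli 1)

/-- The single-qubit measurement `(Y₀, Y₁)`. -/
def measY : Fin 2 → Matrix (Fin 2) (Fin 2) ℂ := spectralMeas (pauli 2)

/-- The single-qubit measurement `(Z₀, Z₁)`. -/
def measZ : Fin 2 → Matrix (Fin 2) (Fin 2) ℂ := spectralMeas (pauli 3)

/-- The single-qubit measurement `(W₀, W₁)`, with `W₀ = (I + (σ₁ + σ₂)/√2)/2`. -/
def measW : Fin 2 → Matrix (Fin 2) (Fin 2) ℂ :=
  spectralMeas (((1 / √2 : ℝ) : ℂ) • (pauli 1 + pauli 2))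

/-- The four single-qubit measurements `X, Y, Z, W`, each with its outcomes named in either of the
two possible ways. -/
def singleQubitMeas : Set (Fin 2 → Matrix (Fin 2) (Fin 2) ℂ) :=
  {A | A ∈ ({measX, measY, measZ, measW} : Set _) ∨
    swapOutcomes A ∈ ({measX, measY, measZ, measW} : Set _)}

/-- `⊕[A, B]`. -/
abbrev xor2 (A B : Fin 2 → Matrix (Fin 2) (Fin 2) ℂ) : QMeas := ⟨2, combine parity ![A, B]⟩

/-- `⊕[A, B, C]`. -/
abbrev xor3 (A B C : Fin 2 → Matrix (Fin 2) (Fin 2) ℂ) : QMeas :=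
  ⟨3, combine parity ![A, B, C]⟩

/-- The universal set of measurements. -/
def universalSet : Set QMeas :=
  { xor2 measX measX, xor2 measZ measZ,
    xor2 measX (swapOutcomes measX), xor2 measZ (swapOutcomes measZ),
    xor2 measX measZ, xor2 measZ measX,
    xor2 measX measW,
    xor2 measX measY, xor2 measX (swapOutcomes measY),
    xor3 measX measX measX, xor3 measZ measZ measZ }

/-! ### Gates and circuits -/

/-- The names of the three gates: Hadamard, `π/8`, and controlled NOT. -/
inductive Gate : Type
  | H
  | T
  | CNOT

/-- The number of qubits that a gate acts on. -/
def Gate.arity : Gate → ℕ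
  | .H => 1
  | .T => 1
  | .CNOT => 2

/-- The unitary operators of the gates: `H`, `T = exp(-iπσ₃/8)`, and
`|a, b⟩ ↦ |a, a ⊕ b⟩`. -/
def Gate.op : (g : Gate) → QOp g.arity
  | .H => tensor fun _ : Fin 1 => ((1 / √2 : ℝ) : ℂ) • !![1, 1; 1, -1]
  | .T => tensor fun _ : Fin 1 =>
      !![Complex.exp (-(Complex.I * Real.pi / 8)), 0; 0, Complex.exp (Complex.I * Real.pi / 8)]
  | .CNOT => Matrix.of fun x y : Bits 2 => if x 0 = y 0 ∧ x 1 = y 0 + y 1 then 1 else 0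

/-- A gate with the qubits of an `n`-qubit register that it is applied to. -/
abbrev PlacedGate (n : ℕ) : Type := Σ g : Gate, (Fin g.arity ↪ Fin n)

/-- The unitary operator of a circuit; the head of the list is applied first. -/
def circuitOp {n : ℕ} : List (PlacedGate n) → QOp n
  | [] => 1
  | g :: c => circuitOp c * embed g.2 g.1.op

/-! ### The measurements called for by Nielsen's scheme -/

/-- `n` EPR pairs: the `i`-th of the first `n` qubits is paired with the `i`-th of the last `n`. -/
def eprState (n : ℕ) : QState (n + n) := fun x =>
  if (fun i => x (Fin.castAdd n i)) = (fun i => x (Fin.natAdd n i)) then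
    ((1 / √(2 ^ n) : ℝ) : ℂ) else 0

/-- `|U_j⟩ = (I ⊗ U σ_j)|EPR⟩^{⊗ n}`, with `U σ_j` acting on the last `n` qubits. For `U = I` these
are (products of) Bell states. -/
def basisState {n : ℕ} (U : QOp n) (j : Fin n → Fin 4) : QState (n + n) :=
  embed (Fin.natAddEmb n) (U * pauliString j) *ᵥ eprState n

/-- A measurement with the qubits of an `N`-qubit register that it is applied to. -/
abbrev PlacedMeas (N : ℕ) : Type := Σ M : QMeas, (Fin M.1 ↪ Fin N)

/-- The projection of a placed measurement that belongs to the outcome `b`. -/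
def PlacedMeas.proj {N : ℕ} (p : PlacedMeas N) (b : Fin 2) : QOp N := embed p.2 (p.1.2 b)

/-- The nondegenerate measurement in the basis `{|U_j⟩}` is equivalent to a sequence of `2n`
pairwise commuting two-valued measurements taken from `𝒯`: each `|U_j⟩⟨U_j|` is the product of the
projections of one string of outcomes, and distinct `j` correspond to distinct strings. -/
def BasisMeasuredBy {n : ℕ} (𝒯 : Set (PlacedMeas (n + n))) (U : QOp n) : Prop :=
  ∃ L : Fin (n + n) → PlacedMeas (n + n),
    (∀ k, L k ∈ 𝒯) ∧
    (∀ k l a b, Commute ((L k).proj a) ((L l).proj b)) ∧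
    ∃ r : Bits (n + n) ≃ (Fin n → Fin 4), ∀ b : Bits (n + n),
      (List.ofFn fun k => (L k).proj (b k)).prod =
        Matrix.vecMulVec (basisState U (r b)) (star (basisState U (r b)))

/-- The placement on the `i`-th of the first `n` qubits and the `i`-th of the last `n`. -/
def pairPlacement (n : ℕ) (i : Fin n) : Fin 2 ↪ Fin (n + n) where
  toFun := ![Fin.castAdd n i, Fin.natAdd n i]
  inj' := by
    intro a b h
    have hn := i.pos
    fin_cases a <;> fin_cases b <;> simp [Fin.ext_iff] at h ⊢ <;> omega

/-- The Bell measurements `⊕[X, X]` and `⊕[Z, Z]` on corresponding qubits of the two halves. -/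
def bellMeas (n : ℕ) : Set (PlacedMeas (n + n)) :=
  {p | ∃ i : Fin n, p = ⟨xor2 measX measX, pairPlacement n i⟩ ∨
    p = ⟨xor2 measZ measZ, pairPlacement n i⟩}

/-- The gate to be simulated after failed trials with Pauli errors `e₁, e₂, …`: a trial for `V` that
leaves `V σ_e |ψ⟩` (up to a phase) instead of `V|ψ⟩` is followed by a trial for `V σ_e V†`. -/
def trialGate {n : ℕ} (U : QOp n) (errors : List (Fin n → Fin 4)) : QOp n :=
  errors.foldl (fun V e => V * pauliString e * Vᴴ) U

/-- The number of failed trials after which only Bell measurements are needed. -/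
def Gate.nonBellTrials : Gate → ℕ
  | .H => 1
  | .T => 2
  | .CNOT => 1

/-! ### Computing with measurements only -/

/-- Adaptive protocols on a register that holds `N` qubits now and yields `n` output qubits. The
only quantum operations are the preparation of a new qubit in the state `|0⟩` and the measurements
of `S` on any qubits of the register; which operation comes next may depend on all earlier
outcomes. A run ends by naming the output qubits or by reporting failure. -/
inductive Protocol (S : Set QMeas) (n : ℕ) : ℕ → Type
  | output {N : ℕ} (out : Fin n ↪ Fin N) : Protocol S n N
  | failure {N : ℕ} : Protocol S n N
  | prepare {N : ℕ} (next : Protocol S n (N + 1)) : Protocol S n N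
  | measure {N : ℕ} (M : QMeas) (hM : M ∈ S) (e : Fin M.1 ↪ Fin N)
      (next : Fin 2 → Protocol S n N) : Protocol S n N

variable {S : Set QMeas} {n : ℕ}

/-- The largest possible number of operations (preparations and measurements) in a run. -/
def Protocol.steps : {N : ℕ} → Protocol S n N → ℕ
  | _, .output _ => 0
  | _, .failure => 0
  | _, .prepare next => next.steps + 1
  | _, .measure _ _ _ next => max (next 0).steps (next 1).steps + 1

/-- The probability that the protocol reports failure when it is started in the state `φ`. The state
is projected and not renormalized at a measurement, so the squared norm of the current vector is
the probability of the present branch. -/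
def Protocol.failureProb : {N : ℕ} → Protocol S n N → QState N → ℝ
  | _, .output _, _ => 0
  | _, .failure, φ => normSq φ
  | _, .prepare next, φ => next.failureProb (adjoinZero φ)
  | _, .measure M _ e next, φ => ∑ b, (next b).failureProb (embed e (M.2 b) *ᵥ φ)

/-- Whenever the protocol, started in `φ`, ends with output, the output qubits are in the pure
state `θ` (up to a scalar factor), in a product with some state `χ` of the other qubits. -/
def Protocol.Outputs (θ : QState n) : {N : ℕ} → Protocol S n N → QState N → Prop
  | N, .output out, φ =>
      ∃ χ : ({k : Fin N // k ∉ Set.range out} → Fin 2) → ℂ,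
        ∀ x, φ x = θ (fun i => x (out i)) * χ (fun k => x k)
  | _, .failure, _ => True
  | _, .prepare next, φ => next.Outputs θ (adjoinZero φ)
  | _, .measure M _ e next, φ => ∀ b, (next b).Outputs θ (embed e (M.2 b) *ᵥ φ)

/-- The protocol simulates the `n`-qubit operator `V` with failure probability at most `δ`: on every
input state `ψ` it reports failure with probability at most `δ`, and otherwise it outputs `V ψ`. -/
def Protocol.Simulates (p : Protocol S n n) (V : QOp n) (δ : ℝ) : Prop :=
  ∀ ψ : QState n, normSq ψ = 1 → p.Outputs (V *ᵥ ψ) ψ ∧ p.failureProb ψ ≤ δ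

/-- `S` is universal for quantum computation by measurements: every unitary operator on any number
of qubits is approximated to any accuracy by a unitary operator that some protocol with
measurements from `S` simulates with arbitrarily small failure probability. -/
def IsUniversal (S : Set QMeas) : Prop :=
  ∀ (n : ℕ), ∀ U ∈ Matrix.unitaryGroup (Bits n) ℂ, ∀ ε : ℝ, 0 < ε →
    ∃ V ∈ Matrix.unitaryGroup (Bits n) ℂ,
      ‖Matrix.toEuclideanCLM (𝕜 := ℂ) (V - U)‖ ≤ ε ∧
        ∃ p : Protocol S n n, p.Simulates V ε

end MeasQC

end

noncomputable section

namespace MeasQC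

open Matrix

/-! ### Tensor products of single-qubit operators -/

/-! Two mechanisms carry the theorem: a stabilizer description of the bases `|U_j⟩`, and density of
the circuits in the unitary group.

Up to normalization, `(I ⊗ M)|EPR⟩` is the list of the entries of `M`, so an operator on the first
half moves to the second half as its transpose. Hence `|U_j⟩` is a common eigenvector of the
reflections `σ ⊗ UσU†`, where `σ` runs through the `2n` generators `X_i`, `Z_i`, and the signs of
the eigenvalues (the commutation signs of `σ` with `σ_j`) determine `j`. Measuring the basis
therefore means measuring these reflections (`basisMeasuredBy_of_generators`). A measurement `⊕[…]`
has the projections `(1 ± B)/2` with `B` a tensor product of single-qubit reflections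
(`combine_spectralMeas`), so it remains to compute `UσU†`. `H` and C-NOT send Pauli strings to Pauli
strings, whereas `T` sends `σ₁` to `(σ₁ + σ₂)/√2`, which is itself Clifford. After one failed trial,
or two for `T`, the gate is thus a Pauli operator, whose basis is the Bell basis.

A trial projects fresh qubits onto `|U_j⟩` and teleports through this state with Bell outcome `k`,
which applies `Uσ_jσ_kᵀ` (`branch_apply`). It succeeds when `j = k`, with probability exactly
`4^(-a)` for every input, and otherwise leaves a Pauli error that the next trial repairs
(`Realizes.gate`).

For universality, consider the Hermitian `A` such that every `exp(itA)` is a limit of circuits up to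
phase. By the Lie product formula they form a real vector space, and circuits act on it by
conjugation. It contains the axis of the rotation `THTH`, whose angle is an irrational multiple of
`2π`; averaging over conjugation by `σ₃` leaves `σ₃`; conjugation by Clifford circuits then gives
all Pauli strings. These span the Hermitian operators, and every unitary is `exp(iA)` for a
Hermitian `A`. -/

theorem sum_prod_bits {n : ℕ} {κ : Type*} [Fintype κ] (f : Fin n → κ → ℂ) :
    ∑ j : Fin n → κ, ∏ k, f k (j k) = ∏ k, ∑ c, f k c := by
  rw [Finset.prod_univ_sum, Fintype.piFinset_univ]

theorem tensor_apply {n : ℕ} (A : Fin n → Matrix (Fin 2) (Fin 2) ℂ) (x y : Bits n) :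
    tensor A x y = ∏ k, A k (x k) (y k) := rfl

theorem tensor_mul {n : ℕ} (A B : Fin n → Matrix (Fin 2) (Fin 2) ℂ) :
    tensor A * tensor B = tensor fun k => A k * B k := by
  ext x y
  simp only [Matrix.mul_apply, tensor_apply, ← Finset.prod_mul_distrib]
  exact sum_prod_bits fun k c => A k (x k) c * B k c (y k)

theorem tensor_one {n : ℕ} : tensor (fun _ : Fin n => 1) = 1 := by
  ext x y
  simp only [tensor_apply, Matrix.one_apply, Fintype.prod_ite_zero, Finset.prod_const_one,
    funext_iff]

theorem tensor_sum {n : ℕ} {κ : Type*} [Fintype κ]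
    (f : Fin n → κ → Matrix (Fin 2) (Fin 2) ℂ) :
    ∑ j : Fin n → κ, tensor (fun k => f k (j k)) = tensor fun k => ∑ c, f k c := by
  ext x y
  simp only [Matrix.sum_apply, tensor_apply]
  exact sum_prod_bits fun k c => f k c (x k) (y k)

theorem tensor_smul {n : ℕ} (c : Fin n → ℂ) (A : Fin n → Matrix (Fin 2) (Fin 2) ℂ) :
    tensor (fun k => c k • A k) = (∏ k, c k) • tensor A := by
  ext x y
  simp [tensor_apply, Finset.prod_mul_distrib]

theorem tensor_conjTranspose {n : ℕ} (A : Fin n → Matrix (Fin 2) (Fin 2) ℂ) :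
    (tensor A)ᴴ = tensor fun k => (A k)ᴴ := by
  ext x y
  simp [tensor_apply, Matrix.conjTranspose_apply]

theorem tensor_transpose {n : ℕ} (A : Fin n → Matrix (Fin 2) (Fin 2) ℂ) :
    (tensor A)ᵀ = tensor fun k => (A k)ᵀ := rfl

theorem trace_tensor {n : ℕ} (A : Fin n → Matrix (Fin 2) (Fin 2) ℂ) :
    (tensor A).trace = ∏ k, (A k).trace := by
  simp only [Matrix.trace, Matrix.diag_apply, tensor_apply]
  exact sum_prod_bits fun k c => A k c c

/-! ### Operators acting on some of the qubits -/

/-- Only the basis states that agree with `x` off the range of `e` contribute, and these are the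
`Function.extend e s x`. Most of the algebra of `embed` reduces to this sum. -/
theorem embed_mulVec {n N : ℕ} (e : Fin n ↪ Fin N) (A : QOp n) (φ : QState N) (x : Bits N) :
    (embed e A *ᵥ φ) x = ∑ s, A (fun i => x (e i)) s * φ (Function.extend e s x) := by
  classical
  simp only [Matrix.mulVec, dotProduct, embed, Matrix.of_apply, ite_mul, zero_mul]
  rw [← Finset.sum_filter]
  symm
  refine Finset.sum_bij (fun s _ => Function.extend e s x) ?_ ?_ ?_ ?_
  · intro s _
    simp only [Finset.mem_filter, Finset.mem_univ, true_and]
    intro k hk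
    rw [Function.extend_apply' _ _ _ (by simpa using hk)]
  · intro s _ t _ h
    exact Function.extend_injective e.injective x h
  · intro y hy
    simp only [Finset.mem_filter, Finset.mem_univ, true_and] at hy
    refine ⟨fun i => y (e i), Finset.mem_univ _, ?_⟩
    funext k
    by_cases hk : k ∈ Set.range e
    · obtain ⟨i, rfl⟩ := hk
      rw [e.injective.extend_apply]
    · rw [Function.extend_apply' _ _ _ (by simpa using hk), hy k hk]
  · intro s _
    simp only [e.injective.extend_apply]

theorem ext_mulVec {ι : Type*} [Fintype ι] {A B : Matrix ι ι ℂ}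
    (h : ∀ v x, (A *ᵥ v) x = (B *ᵥ v) x) : A = B := by
  classical
  exact Matrix.toLin'.injective (LinearMap.ext fun v => funext fun x => by
    simpa [Matrix.toLin'_apply] using h v x)

theorem extend_extend {n N : ℕ} (e : Fin n ↪ Fin N) (s t : Bits n) (x : Bits N) :
    Function.extend e s (Function.extend e t x) = Function.extend e s x := by
  funext k
  by_cases hk : ∃ i, e i = k
  · obtain ⟨i, rfl⟩ := hk
    simp only [e.injective.extend_apply]
  · simp only [Function.extend_apply' _ _ _ hk]

theorem embed_mul {n N : ℕ} (e : Fin n ↪ Fin N) (A B : QOp n) :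
    embed e (A * B) = embed e A * embed e B := by
  refine ext_mulVec fun φ x => ?_
  rw [← Matrix.mulVec_mulVec]
  simp only [embed_mulVec, e.injective.extend_apply, extend_extend, Matrix.mul_apply,
    Finset.sum_mul, Finset.mul_sum]
  rw [Finset.sum_comm]
  simp only [mul_assoc]

theorem embed_one {n N : ℕ} (e : Fin n ↪ Fin N) : embed e (1 : QOp n) = 1 := by
  refine ext_mulVec fun φ x => ?_
  rw [embed_mulVec, Matrix.one_mulVec, Finset.sum_eq_single (fun i => x (e i))]
  · rw [Matrix.one_apply_eq, one_mul]
    congr 1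
    funext k
    by_cases hk : ∃ i, e i = k
    · obtain ⟨i, rfl⟩ := hk
      rw [e.injective.extend_apply]
    · rw [Function.extend_apply' _ _ _ hk]
  · intro s _ hs
    rw [Matrix.one_apply_ne (Ne.symm hs), zero_mul]
  · simp

theorem embed_add {n N : ℕ} (e : Fin n ↪ Fin N) (A B : QOp n) :
    embed e (A + B) = embed e A + embed e B := by
  refine ext_mulVec fun φ x => ?_
  rw [Matrix.add_mulVec, Pi.add_apply]
  simp only [embed_mulVec, Matrix.add_apply, add_mul, Finset.sum_add_distrib]

theorem embed_smul {n N : ℕ} (e : Fin n ↪ Fin N) (c : ℂ) (A : QOp n) :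
    embed e (c • A) = c • embed e A := by
  refine ext_mulVec fun φ x => ?_
  rw [Matrix.smul_mulVec, Pi.smul_apply]
  simp only [embed_mulVec, Matrix.smul_apply, smul_eq_mul, mul_assoc, Finset.mul_sum]

theorem embed_conjTranspose {n N : ℕ} (e : Fin n ↪ Fin N) (A : QOp n) :
    embed e Aᴴ = (embed e A)ᴴ := by
  classical
  ext x y
  simp only [embed, Matrix.of_apply, Matrix.conjTranspose_apply]
  by_cases h : ∀ k, k ∉ Set.range e → x k = y k
  · rw [if_pos h, if_pos fun k hk => (h k hk).symm]
  · rw [if_neg h, if_neg fun h' => h fun k hk => (h' k hk).symm, star_zero]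

theorem embed_list_prod {n N : ℕ} (e : Fin n ↪ Fin N) (l : List (QOp n)) :
    embed e l.prod = (l.map (embed e)).prod := by
  induction l with
  | nil => simp [embed_one]
  | cons A l ih => simp [embed_mul, ih]

theorem extend_trans {m n N : ℕ} (f : Fin m ↪ Fin n) (e : Fin n ↪ Fin N) (s : Bits m)
    (x : Bits N) :
    Function.extend e (Function.extend f s fun i => x (e i)) x =
      Function.extend (f.trans e) s x := by
  funext k
  by_cases hk : ∃ i, e i = k
  · obtain ⟨i, rfl⟩ := hk
    rw [e.injective.extend_apply]
    by_cases hi : ∃ l, f l = i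
    · obtain ⟨l, rfl⟩ := hi
      rw [f.injective.extend_apply]
      exact ((f.trans e).injective.extend_apply s x l).symm
    · rw [Function.extend_apply' _ _ _ hi, Function.extend_apply']
      rintro ⟨l, hl⟩
      exact hi ⟨l, e.injective hl⟩
  · rw [Function.extend_apply' _ _ _ hk, Function.extend_apply']
    rintro ⟨l, hl⟩
    exact hk ⟨f l, hl⟩

theorem embed_trans {m n N : ℕ} (f : Fin m ↪ Fin n) (e : Fin n ↪ Fin N) (A : QOp m) :
    embed (f.trans e) A = embed e (embed f A) := by
  refine ext_mulVec fun φ x => ?_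
  -- With the qubits outside the range of `e` frozen at `x`, `φ` becomes a state of `n` qubits on
  -- which `embed f A` acts.
  have h : (embed e (embed f A) *ᵥ φ) x =
      (embed f A *ᵥ fun s => φ (Function.extend e s x)) fun i => x (e i) := by
    rw [embed_mulVec]
    rfl
  rw [h, embed_mulVec, embed_mulVec]
  simp only [extend_trans]
  rfl

/-- The identity factors off the range of `e` are Kronecker deltas, whose product is the agreement
condition in `embed`. -/
theorem embed_tensor {n N : ℕ} (e : Fin n ↪ Fin N) (A : Fin n → Matrix (Fin 2) (Fin 2) ℂ) :
    embed e (tensor A) = tensor (Function.extend e A fun _ => 1) := by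
  classical
  ext x y
  simp only [embed, tensor_apply, Matrix.of_apply]
  rw [← Finset.prod_mul_prod_compl (Finset.univ.map e), Finset.prod_map]
  simp only [e.injective.extend_apply]
  have h : ∏ k ∈ (Finset.univ.map e)ᶜ,
      (Function.extend e A (fun _ => 1) k : Matrix (Fin 2) (Fin 2) ℂ) (x k) (y k) =
      ∏ k ∈ (Finset.univ.map e)ᶜ, if x k = y k then 1 else 0 := by
    refine Finset.prod_congr rfl fun k hk => ?_
    rw [Function.extend_apply' _ _ _ (by simpa using hk), Matrix.one_apply]
  rw [h, Finset.prod_ite_zero, Finset.prod_const_one]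
  simp

theorem extend_eq {n N : ℕ} {κ : Type*} (e : Fin n ↪ Fin N) {A : Fin n → κ} {c : κ}
    {g : Fin N → κ} (h₁ : ∀ i, g (e i) = A i) (h₂ : ∀ k, (∀ i, e i ≠ k) → g k = c) :
    Function.extend e A (fun _ => c) = g := by
  funext k
  by_cases hk : ∃ i, e i = k
  · obtain ⟨i, rfl⟩ := hk
    rw [e.injective.extend_apply, h₁]
  · rw [Function.extend_apply' _ _ _ hk, h₂ k (by simpa using hk)]

/-! ### Norms -/

theorem normSq_eq_dotProduct {n : ℕ} (ψ : QState n) : (normSq ψ : ℂ) = star ψ ⬝ᵥ ψ := by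
  simp only [normSq, dotProduct, Pi.star_apply, RCLike.star_def, Complex.conj_mul']
  push_cast
  rfl

theorem normSq_mulVec {n : ℕ} {U : QOp n} (hU : Uᴴ * U = 1) (ψ : QState n) :
    normSq (U *ᵥ ψ) = normSq ψ := by
  have h : (normSq (U *ᵥ ψ) : ℂ) = normSq ψ := by
    rw [normSq_eq_dotProduct, normSq_eq_dotProduct, Matrix.star_mulVec,
      Matrix.dotProduct_mulVec, Matrix.vecMul_vecMul, hU, Matrix.vecMul_one]
  exact_mod_cast h

theorem normSq_nonneg {n : ℕ} (ψ : QState n) : 0 ≤ normSq ψ :=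
  Finset.sum_nonneg fun _ _ => by positivity

/-! ### Parities of single-qubit measurements -/

/-- The eigenvalue that belongs to an outcome. -/
def sgn : Fin 2 → ℂ := ![1, -1]

@[simp] theorem sgn_zero : sgn 0 = 1 := rfl
@[simp] theorem sgn_one : sgn 1 = -1 := rfl

theorem sgn_add (a b : Fin 2) : sgn (a + b) = sgn a * sgn b := by
  fin_cases a <;> fin_cases b <;> simp [sgn]

theorem star_sgn (a : Fin 2) : star (sgn a) = sgn a := by
  fin_cases a <;> simp

theorem half_one_add_sgn (a b : Fin 2) :
    (1 / 2 : ℂ) * (1 + sgn a * sgn b) = if b = a then 1 else 0 := by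
  fin_cases a <;> fin_cases b <;> norm_num [sgn]

theorem sgn_parity {n : ℕ} (j : Bits n) : sgn (parity j) = ∏ k, sgn (j k) := by
  have h : ∀ s : Finset (Fin n), sgn (∑ k ∈ s, j k) = ∏ k ∈ s, sgn (j k) := by
    intro s
    induction s using Finset.induction_on with
    | empty => simp
    | insert a s ha ih => rw [Finset.sum_insert ha, Finset.prod_insert ha, sgn_add, ih]
  exact h _

/-- The projections `(1 ± B)/2`. -/
def halfProj {ι : Type} [DecidableEq ι] (B : Matrix ι ι ℂ) : Fin 2 → Matrix ι ι ℂ :=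
  fun i => (1 / 2 : ℂ) • (1 + sgn i • B)

theorem spectralMeas_eq (A : Matrix (Fin 2) (Fin 2) ℂ) : spectralMeas A = halfProj A := by
  funext i
  fin_cases i <;> simp [spectralMeas, halfProj, sub_eq_add_neg]

theorem swapOutcomes_spectralMeas (A : Matrix (Fin 2) (Fin 2) ℂ) :
    swapOutcomes (spectralMeas A) = spectralMeas (-A) := by
  funext i
  fin_cases i <;> simp [spectralMeas, swapOutcomes, sub_eq_add_neg]

/-- The sign of a parity is the product of the signs of the bits. The sum of all tensors of
projections is the identity, and the sum weighted by the signs factors into the tensor product of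
the differences `M₀ - M₁ = A`. Half the sum or difference of the two selects one parity. -/
theorem combine_spectralMeas {n : ℕ} (A : Fin n → Matrix (Fin 2) (Fin 2) ℂ) :
    combine parity (fun k => spectralMeas (A k)) = halfProj (tensor A) := by
  funext i
  have h₁ : ∑ j : Bits n, tensor (fun k => spectralMeas (A k) (j k)) = 1 := by
    rw [tensor_sum fun k c => spectralMeas (A k) c, ← tensor_one]
    congr 1
    funext k
    rw [Fin.sum_univ_two]
    simp only [spectralMeas, Matrix.cons_val_zero, Matrix.cons_val_one, ← smul_add]
    rw [add_add_sub_cancel, ← two_smul ℂ (1 : Matrix (Fin 2) (Fin 2) ℂ), smul_smul]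
    norm_num
  have h₂ : ∑ j : Bits n, sgn (parity j) • tensor (fun k => spectralMeas (A k) (j k)) =
      tensor A := by
    simp only [sgn_parity, ← tensor_smul]
    rw [tensor_sum fun k c => sgn c • spectralMeas (A k) c]
    congr 1
    funext k
    rw [Fin.sum_univ_two]
    simp only [spectralMeas, Matrix.cons_val_zero, Matrix.cons_val_one, sgn_zero, sgn_one,
      one_smul, neg_smul]
    rw [← sub_eq_add_neg, ← smul_sub, add_sub_sub_cancel, ← two_smul ℂ (A k), smul_smul]
    norm_num
  simp only [combine, halfProj]
  rw [← h₂, ← h₁, Finset.smul_sum, ← Finset.sum_add_distrib, Finset.smul_sum,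
    Finset.sum_filter]
  refine Finset.sum_congr rfl fun j _ => ?_
  rw [smul_smul]
  nth_rw 2 [← one_smul ℂ (tensor fun k => spectralMeas (A k) (j k))]
  rw [← add_smul, smul_smul, half_one_add_sgn]
  split_ifs <;> simp

/-- The conditions under which `(1 ± B)/2` are projections of equal rank. -/
structure IsReflection {ι : Type} [Fintype ι] [DecidableEq ι] (B : Matrix ι ι ℂ) : Prop where
  herm : B.IsHermitian
  sq : B * B = 1
  trace : B.trace = 0

theorem IsReflection.isBinary {ι : Type} [Fintype ι] [DecidableEq ι] {B : Matrix ι ι ℂ}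
    (h : IsReflection B) : IsBinary (halfProj B) := by
  refine ⟨⟨fun i => ?_, fun i j => ?_, ?_⟩, fun i => ?_⟩
  · simp only [halfProj, Matrix.IsHermitian, Matrix.conjTranspose_smul,
      Matrix.conjTranspose_add, Matrix.conjTranspose_one, star_sgn, h.herm.eq]
    norm_num
  · have h' : halfProj B i * halfProj B j =
        (1 / 4 : ℂ) • ((1 + sgn i * sgn j) • 1 + (sgn i + sgn j) • B) := by
      simp only [halfProj, Matrix.smul_mul, Matrix.mul_smul, mul_add, add_mul, one_mul, mul_one,
        h.sq]
      module
    rw [h']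
    fin_cases i <;> fin_cases j <;> simp [halfProj] <;> norm_num <;> module
  · simp only [halfProj, Fin.sum_univ_two, sgn_zero, sgn_one]
    module
  · simp only [halfProj, Matrix.trace_smul, Matrix.trace_add, Matrix.trace_one, h.trace,
      smul_eq_mul]
    ring

theorem IsReflection.tensor {n : ℕ} [NeZero n] {A : Fin n → Matrix (Fin 2) (Fin 2) ℂ}
    (h : ∀ k, IsReflection (A k)) : IsReflection (tensor A) where
  herm := by
    rw [Matrix.IsHermitian, tensor_conjTranspose]
    congr 1
    funext k
    exact (h k).herm
  sq := by
    rw [tensor_mul, ← tensor_one]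
    congr 1
    funext k
    exact (h k).sq
  trace := by
    rw [trace_tensor]
    exact Finset.prod_eq_zero (Finset.mem_univ 0) (h 0).trace

theorem IsReflection.neg {ι : Type} [Fintype ι] [DecidableEq ι] {B : Matrix ι ι ℂ}
    (h : IsReflection B) : IsReflection (-B) :=
  ⟨h.herm.neg, by rw [neg_mul_neg, h.sq], by rw [Matrix.trace_neg, h.trace, neg_zero]⟩

/-- The operator `(σ₁ + σ₂)/√2`. -/
def opW : Matrix (Fin 2) (Fin 2) ℂ := ((1 / √2 : ℝ) : ℂ) • (pauli 1 + pauli 2)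

theorem inv_sqrt_two_mul_self : ((1 / √2 : ℝ) : ℂ) * ((1 / √2 : ℝ) : ℂ) = 1 / 2 := by
  rw [← Complex.ofReal_mul, div_mul_div_comm, Real.mul_self_sqrt (by norm_num)]
  norm_num

theorem isReflection_pauli {j : Fin 4} (hj : j ≠ 0) : IsReflection (pauli j) := by
  fin_cases j
  · simp at hj
  all_goals
    constructor
    · ext a b
      fin_cases a <;> fin_cases b <;> simp [pauli]
    · ext a b
      fin_cases a <;> fin_cases b <;> simp [pauli]
    · simp [pauli, Matrix.trace]

theorem isReflection_opW : IsReflection opW where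
  herm := by
    have h₁ := (isReflection_pauli (j := 1) (by decide)).herm
    have h₂ := (isReflection_pauli (j := 2) (by decide)).herm
    rw [opW, Matrix.IsHermitian, Matrix.conjTranspose_smul, Matrix.conjTranspose_add, h₁.eq,
      h₂.eq]
    simp
  sq := by
    rw [opW, Matrix.smul_mul, Matrix.mul_smul, smul_smul, inv_sqrt_two_mul_self]
    ext a b
    fin_cases a <;> fin_cases b <;> simp [pauli] <;> ring_nf <;> norm_num
  trace := by simp [opW, pauli, Matrix.trace]

theorem combine_two (A B : Matrix (Fin 2) (Fin 2) ℂ) :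
    combine parity ![spectralMeas A, spectralMeas B] = halfProj (tensor ![A, B]) := by
  rw [← combine_spectralMeas]
  congr 1
  funext k
  fin_cases k <;> rfl

theorem combine_three (A B C : Matrix (Fin 2) (Fin 2) ℂ) :
    combine parity ![spectralMeas A, spectralMeas B, spectralMeas C] =
      halfProj (tensor ![A, B, C]) := by
  rw [← combine_spectralMeas]
  congr 1
  funext k
  fin_cases k <;> rfl

theorem isBalanced_parity_two : IsBalanced (parity : Bits 2 → Fin 2) := by
  unfold IsBalanced parity
  decide

theorem isBalanced_parity_three : IsBalanced (parity : Bits 3 → Fin 2) := by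
  unfold IsBalanced parity
  decide

/-- Exchanging the outcomes amounts to replacing the reflection by its negative. -/
theorem singleQubitMeas_spec {m : Fin 2 → Matrix (Fin 2) (Fin 2) ℂ} (hm : m ∈ singleQubitMeas) :
    ∃ A, m = spectralMeas A ∧ IsReflection A := by
  have key : ∀ m' ∈ ({measX, measY, measZ, measW} : Set (Fin 2 → Matrix (Fin 2) (Fin 2) ℂ)),
      ∃ A, m' = spectralMeas A ∧ IsReflection A := by
    rintro m' (rfl | rfl | rfl | rfl)
    · exact ⟨_, rfl, isReflection_pauli (by decide)⟩
    · exact ⟨_, rfl, isReflection_pauli (by decide)⟩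
    · exact ⟨_, rfl, isReflection_pauli (by decide)⟩
    · exact ⟨_, rfl, isReflection_opW⟩
  rcases hm with hm | hm
  · exact key m hm
  · obtain ⟨A, hA, hr⟩ := key _ hm
    refine ⟨-A, ?_, hr.neg⟩
    rw [← swapOutcomes_spectralMeas, ← hA]
    funext i
    fin_cases i <;> rfl

theorem isSeparateOver_combine {n : ℕ} [NeZero n] (hb : IsBalanced (parity : Bits n → Fin 2))
    {m : Fin n → Fin 2 → Matrix (Fin 2) (Fin 2) ℂ} (hm : ∀ k, m k ∈ singleQubitMeas) :
    IsSeparateOver singleQubitMeas parity (combine parity m) := by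
  choose A hA hr using fun k => singleQubitMeas_spec (hm k)
  refine ⟨hb, ?_, m, fun k => ⟨?_, hm k⟩, rfl⟩
  · obtain rfl : m = fun k => spectralMeas (A k) := funext hA
    rw [combine_spectralMeas]
    exact (IsReflection.tensor hr).isBinary
  · rw [hA, spectralMeas_eq]
    exact (hr k).isBinary

theorem isSeparateOver_xor2 {A B : Fin 2 → Matrix (Fin 2) (Fin 2) ℂ} (hA : A ∈ singleQubitMeas)
    (hB : B ∈ singleQubitMeas) : IsSeparateOver singleQubitMeas parity (xor2 A B).2 :=
  isSeparateOver_combine isBalanced_parity_two fun k => by fin_cases k <;> assumption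

theorem isSeparateOver_xor3 {A B C : Fin 2 → Matrix (Fin 2) (Fin 2) ℂ}
    (hA : A ∈ singleQubitMeas) (hB : B ∈ singleQubitMeas) (hC : C ∈ singleQubitMeas) :
    IsSeparateOver singleQubitMeas parity (xor3 A B C).2 :=
  isSeparateOver_combine isBalanced_parity_three fun k => by fin_cases k <;> assumption

theorem measX_mem : measX ∈ singleQubitMeas := by simp [singleQubitMeas]
theorem measY_mem : measY ∈ singleQubitMeas := by simp [singleQubitMeas]
theorem measZ_mem : measZ ∈ singleQubitMeas := by simp [singleQubitMeas]
theorem measW_mem : measW ∈ singleQubitMeas := by simp [singleQubitMeas]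

theorem swapOutcomes_mem {m : Fin 2 → Matrix (Fin 2) (Fin 2) ℂ}
    (hm : m ∈ ({measX, measY, measZ, measW} : Set (Fin 2 → Matrix (Fin 2) (Fin 2) ℂ))) :
    swapOutcomes m ∈ singleQubitMeas := by
  have h : swapOutcomes (swapOutcomes m) = m := by
    funext i
    fin_cases i <;> rfl
  exact Or.inr (by rwa [h])

theorem isSeparateOver_of_mem_universalSet {M : QMeas} (hM : M ∈ universalSet) :
    IsSeparateOver singleQubitMeas parity M.2 := by
  have hX := measX_mem
  have hY := measY_mem
  have hZ := measZ_mem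
  have hW := measW_mem
  have hX' : swapOutcomes measX ∈ singleQubitMeas := swapOutcomes_mem (by simp)
  have hY' : swapOutcomes measY ∈ singleQubitMeas := swapOutcomes_mem (by simp)
  have hZ' : swapOutcomes measZ ∈ singleQubitMeas := swapOutcomes_mem (by simp)
  rcases hM with rfl | rfl | rfl | rfl | rfl | rfl | rfl | rfl | rfl | rfl | rfl
  all_goals first
    | exact isSeparateOver_xor2 (by assumption) (by assumption)
    | exact isSeparateOver_xor3 (by assumption) (by assumption) (by assumption)

theorem universalSet_finite : universalSet.Finite := by
  unfold universalSet
  exact Set.toFinite _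

theorem qubits_of_mem_universalSet {M : QMeas} (hM : M ∈ universalSet) : M.1 = 2 ∨ M.1 = 3 := by
  rcases hM with rfl | rfl | rfl | rfl | rfl | rfl | rfl | rfl | rfl | rfl | rfl <;> simp

theorem xor3_X_ne_xor3_Z : xor3 measX measX measX ≠ xor3 measZ measZ measZ := by
  rw [measX, measZ, xor3, xor3, combine_three, combine_three]
  intro h
  -- At the diagonal entry of `|000⟩`, the projection for outcome 0 is 1/2 for `X` and 1 for `Z`.
  have h' := congrFun (congrFun (congrFun (eq_of_heq (Sigma.mk.inj h).2) 0) 0) 0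
  have h₁ : tensor ![pauli 1, pauli 1, pauli 1] 0 0 = 0 := by
    rw [tensor_apply]
    exact Finset.prod_eq_zero (Finset.mem_univ 0) (show pauli 1 0 0 = 0 by simp [pauli])
  have h₃ : tensor ![pauli 3, pauli 3, pauli 3] 0 0 = 1 := by
    rw [tensor_apply]
    refine Finset.prod_eq_one fun k _ => ?_
    fin_cases k <;> exact show pauli 3 0 0 = 1 by simp [pauli]
  simp only [halfProj, Matrix.smul_apply, Matrix.add_apply, h₁, h₃] at h'
  norm_num at h'

theorem ncard_universalSet_three : {M ∈ universalSet | M.1 = 3}.ncard = 2 := by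
  have h : {M ∈ universalSet | M.1 = 3} =
      {xor3 measX measX measX, xor3 measZ measZ measZ} := by
    ext M
    constructor
    · rintro ⟨hM, h3⟩
      rcases hM with rfl | rfl | rfl | rfl | rfl | rfl | rfl | rfl | rfl | rfl | rfl
      all_goals first
        | exact absurd h3 (by decide)
        | simp
    · rintro (rfl | rfl) <;> simp [universalSet]
  rw [h, Set.ncard_pair xor3_X_ne_xor3_Z]

/-! ### The basis `|U_j⟩` -/

/-- `(I ⊗ M)|EPR⟩`. -/
def vecOf {n : ℕ} (M : QOp n) : QState (n + n) := embed (Fin.natAddEmb n) M *ᵥ eprState n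

theorem extend_natAdd {m n : ℕ} (s : Bits n) (x : Bits (m + n)) :
    Function.extend (Fin.natAddEmb m) s x = Fin.append (fun i => x (Fin.castAdd n i)) s := by
  funext k
  refine Fin.addCases (fun i => ?_) (fun i => ?_) k
  · rw [Function.extend_apply', Fin.append_left]
    rintro ⟨l, hl⟩
    simp [Fin.ext_iff] at hl
    omega
  · rw [Fin.append_right]
    exact (Fin.natAddEmb m).injective.extend_apply s x i

theorem extend_castAdd {m n : ℕ} (s : Bits m) (x : Bits (m + n)) :
    Function.extend (Fin.castAddEmb n) s x = Fin.append s (fun i => x (Fin.natAdd m i)) := by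
  funext k
  refine Fin.addCases (fun i => ?_) (fun i => ?_) k
  · rw [Fin.append_left]
    exact (Fin.castAddEmb n).injective.extend_apply s x i
  · rw [Function.extend_apply', Fin.append_right]
    rintro ⟨l, hl⟩
    simp [Fin.ext_iff] at hl
    omega

/-- The second half of the register holds the row index and the first half the column index.
Identities between these states thereby become identities between matrices. -/
theorem vecOf_apply {n : ℕ} (M : QOp n) (x : Bits (n + n)) :
    vecOf M x = M (fun i => x (Fin.natAdd n i)) (fun i => x (Fin.castAdd n i)) *
      ((1 / √(2 ^ n) : ℝ) : ℂ) := by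
  rw [vecOf, embed_mulVec, Finset.sum_eq_single fun i => x (Fin.castAdd n i)]
  · simp only [extend_natAdd, eprState, Fin.append_left, Fin.append_right, if_true]
    rfl
  · intro s _ hs
    simp only [extend_natAdd, eprState, Fin.append_left, Fin.append_right]
    rw [if_neg (Ne.symm hs), mul_zero]
  · simp

theorem basisState_eq {n : ℕ} (U : QOp n) (j : Fin n → Fin 4) :
    basisState U j = vecOf (U * pauliString j) := rfl

theorem vecOf_smul {n : ℕ} (c : ℂ) (M : QOp n) : vecOf (c • M) = c • vecOf M := by
  rw [vecOf, embed_smul, Matrix.smul_mulVec]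
  rfl

theorem embed_natAdd_vecOf {n : ℕ} (B M : QOp n) :
    embed (Fin.natAddEmb n) B *ᵥ vecOf M = vecOf (B * M) := by
  rw [vecOf, Matrix.mulVec_mulVec, ← embed_mul]
  rfl

/-- The transpose trick: the first half carries the column index, so acting there is multiplication
on the right. -/
theorem embed_castAdd_vecOf {n : ℕ} (P M : QOp n) :
    embed (Fin.castAddEmb n) P *ᵥ vecOf M = vecOf (M * Pᵀ) := by
  funext x
  rw [embed_mulVec, vecOf_apply, Matrix.mul_apply, Finset.sum_mul]
  refine Finset.sum_congr rfl fun s _ => ?_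
  simp only [vecOf_apply, extend_castAdd, Fin.append_left, Fin.append_right,
    Matrix.transpose_apply, Fin.castAddEmb_apply]
  ring

theorem inv_sqrt_two_pow_sq (n : ℕ) :
    ((1 / √(2 ^ n) : ℝ) : ℂ) * ((1 / √(2 ^ n) : ℝ) : ℂ) = (1 / 2) ^ n := by
  rw [← Complex.ofReal_mul, div_mul_div_comm, Real.mul_self_sqrt (by positivity)]
  push_cast
  rw [one_mul, _root_.one_div_pow]

theorem sum_pauli_mul_star (a b c d : Fin 2) :
    ∑ v, pauli v a b * star (pauli v c d) = if a = c ∧ b = d then 2 else 0 := by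
  rw [Fin.sum_univ_four]
  fin_cases a <;> fin_cases b <;> fin_cases c <;> fin_cases d <;>
    simp [pauli] <;> norm_num

/-- Completeness of the Pauli basis, which factors into the single-qubit case. It yields both the
completeness of the basis `|U_j⟩` and the expansion of operators in Pauli strings. -/
theorem sum_pauliString_mul_star {n : ℕ} (a b c d : Bits n) :
    ∑ j : Fin n → Fin 4, pauliString j a b * star (pauliString j c d) =
      if a = c ∧ b = d then 2 ^ n else 0 := by
  simp only [pauliString, tensor_apply, star_prod, ← Finset.prod_mul_distrib]
  rw [sum_prod_bits fun k v => pauli v (a k) (b k) * star (pauli v (c k) (d k))]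
  simp only [sum_pauli_mul_star, Fintype.prod_ite_zero, Finset.prod_const, Finset.card_univ,
    Fintype.card_fin, forall_and, funext_iff]

/-- For `U = 1` this is completeness of the Pauli strings read as vectors; the general case is its
conjugate by `I ⊗ U`. -/
theorem sum_vecMulVec_basisState {n : ℕ} {U : QOp n} (hU : U * Uᴴ = 1) :
    ∑ j, Matrix.vecMulVec (basisState U j) (star (basisState U j)) = 1 := by
  have h : ∑ j : Fin n → Fin 4,
      Matrix.vecMulVec (vecOf (pauliString j)) (star (vecOf (pauliString j))) = 1 := by
    ext x y
    simp only [Matrix.sum_apply, Matrix.vecMulVec_apply, vecOf_apply, Pi.star_apply, star_mul',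
      mul_mul_mul_comm _ ((1 / √(2 ^ n) : ℝ) : ℂ)]
    rw [← Finset.sum_mul, sum_pauliString_mul_star, RCLike.star_def, Complex.conj_ofReal,
      inv_sqrt_two_pow_sq, Matrix.one_apply]
    have : x = y ↔ (fun i => x (Fin.natAdd n i)) = (fun i => y (Fin.natAdd n i)) ∧
        (fun i => x (Fin.castAdd n i)) = fun i => y (Fin.castAdd n i) := by
      constructor
      · rintro rfl
        exact ⟨rfl, rfl⟩
      · rintro ⟨h₁, h₂⟩
        funext k
        exact Fin.addCases (congrFun h₂) (congrFun h₁) k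
    simp only [← this]
    split_ifs
    · rw [← mul_pow]
      norm_num
    · simp
  have h' : ∀ j, Matrix.vecMulVec (basisState U j) (star (basisState U j)) =
      embed (Fin.natAddEmb n) U *
        Matrix.vecMulVec (vecOf (pauliString j)) (star (vecOf (pauliString j))) *
        (embed (Fin.natAddEmb n) U)ᴴ := by
    intro j
    rw [basisState_eq, ← embed_natAdd_vecOf, Matrix.star_mulVec, Matrix.mul_vecMulVec,
      Matrix.vecMulVec_mul]
  simp only [h']
  rw [← Finset.sum_mul, ← Finset.mul_sum, h, mul_one, ← embed_conjTranspose, ← embed_mul, hU,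
    embed_one]

/-! ### Sequences of commuting measurements -/

theorem ofFn_prod_mulVec {ι : Type*} [Fintype ι] [DecidableEq ι] {m : ℕ}
    (A : Fin m → Matrix ι ι ℂ) (c : Fin m → ℂ) (v : ι → ℂ) (h : ∀ k, A k *ᵥ v = c k • v) :
    (List.ofFn A).prod *ᵥ v = (∏ k, c k) • v := by
  induction m with
  | zero => simp
  | succ m ih =>
    rw [List.ofFn_succ, List.prod_cons, ← Matrix.mulVec_mulVec, ih _ _ fun k => h k.succ,
      Matrix.mulVec_smul, h, smul_smul, Fin.prod_univ_succ, mul_comm]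

/-- Inserting the resolution of the identity into the `|U_j⟩⟨U_j|` reduces everything to eigenvalues
0 and 1. Commutation is then immediate, and in a product of projections only the `j` whose pattern
is the outcome string survives. -/
theorem basisMeasuredBy_of_eigenstates {n : ℕ} {𝒯 : Set (PlacedMeas (n + n))} {U : QOp n}
    (hU : U * Uᴴ = 1) (L : Fin (n + n) → PlacedMeas (n + n)) (hL : ∀ k, L k ∈ 𝒯)
    (pat : (Fin n → Fin 4) ≃ Bits (n + n))
    (h : ∀ k b j, (L k).proj b *ᵥ basisState U j =
      (if b = pat j k then 1 else 0 : ℂ) • basisState U j) :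
    BasisMeasuredBy 𝒯 U := by
  refine ⟨L, hL, fun k l a b => ?_, pat.symm, fun b => ?_⟩
  · rw [Commute, SemiconjBy, ← mul_one (_ * _), ← mul_one ((L l).proj b * _),
      ← sum_vecMulVec_basisState hU, Finset.mul_sum, Finset.mul_sum]
    refine Finset.sum_congr rfl fun j _ => ?_
    simp only [Matrix.mul_vecMulVec, ← Matrix.mulVec_mulVec, h, Matrix.mulVec_smul, smul_smul,
      mul_comm]
  · rw [← mul_one (List.prod _), ← sum_vecMulVec_basisState hU, Finset.mul_sum,
      Finset.sum_eq_single (pat.symm b)]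
    · rw [Matrix.mul_vecMulVec, ofFn_prod_mulVec _ _ _ fun k => h k (b k) _]
      simp
    · intro j _ hj
      rw [Matrix.mul_vecMulVec, ofFn_prod_mulVec _ _ _ fun k => h k (b k) _]
      have : ∃ k, b k ≠ pat j k := by
        by_contra! hb
        exact hj (by rw [funext hb, Equiv.symm_apply_apply])
      obtain ⟨k, hk⟩ := this
      rw [Finset.prod_eq_zero (Finset.mem_univ k) (if_neg hk)]
      ext x y
      simp [Matrix.vecMulVec_apply]
    · simp

/-- The parity with which `σ₁` commutes with a Pauli operator. -/
def commX : Fin 4 → Fin 2 := ![0, 0, 1, 1]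

/-- The parity with which `σ₃` commutes with a Pauli operator. -/
def commZ : Fin 4 → Fin 2 := ![0, 1, 1, 0]

/-- The generators `X_i` and `Z_i` of the Pauli strings. -/
def gen {n : ℕ} (k : Fin (n + n)) : Fin n → Fin 4 :=
  Fin.append (fun i => Pi.single i 1) (fun i => Pi.single i 3) k

/-- The parity with which a generator commutes with a Pauli string. -/
def genComm {n : ℕ} (j : Fin n → Fin 4) : Bits (n + n) :=
  Fin.append (fun i => commX (j i)) (fun i => commZ (j i))

/-- On each qubit, the commutation signs with `σ₁` and `σ₃` separate the four Pauli operators. -/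
theorem genComm_injective {n : ℕ} : Function.Injective (genComm (n := n)) := by
  intro j l h
  funext i
  have h₁ : commX (j i) = commX (l i) := by
    simpa only [genComm, Fin.append_left] using congrFun h (Fin.castAdd n i)
  have h₂ : commZ (j i) = commZ (l i) := by
    simpa only [genComm, Fin.append_right] using congrFun h (Fin.natAdd n i)
  have key : ∀ a b, commX a = commX b → commZ a = commZ b → a = b := by decide
  exact key _ _ h₁ h₂

theorem pauli_one_mul (a : Fin 4) : pauli 1 * pauli a = sgn (commX a) • (pauli a * pauli 1) := by
  ext r s
  fin_cases a <;> fin_cases r <;> fin_cases s <;> simp [pauli, commX, sgn, Matrix.mul_apply]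

theorem pauli_three_mul (a : Fin 4) :
    pauli 3 * pauli a = sgn (commZ a) • (pauli a * pauli 3) := by
  ext r s
  fin_cases a <;> fin_cases r <;> fin_cases s <;> simp [pauli, commZ, sgn, Matrix.mul_apply]

theorem pauli_zero : pauli 0 = 1 := rfl

theorem pauliString_single_mul {n : ℕ} (i : Fin n) (v : Fin 4) (j : Fin n → Fin 4) (c : ℂ)
    (h : pauli v * pauli (j i) = c • (pauli (j i) * pauli v)) :
    pauliString (Pi.single i v) * pauliString j =
      c • (pauliString j * pauliString (Pi.single i v)) := by
  have hc : c = ∏ k, if k = i then c else 1 := by simp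
  rw [pauliString, pauliString, tensor_mul, tensor_mul, hc, ← tensor_smul]
  congr 1
  funext k
  by_cases hk : k = i
  · subst hk
    simp [h]
  · simp [hk, pauli_zero]

theorem gen_mul {n : ℕ} (k : Fin (n + n)) (j : Fin n → Fin 4) :
    pauliString (gen k) * pauliString j =
      sgn (genComm j k) • (pauliString j * pauliString (gen k)) := by
  refine Fin.addCases (fun i => ?_) (fun i => ?_) k
  · simp only [gen, genComm, Fin.append_left]
    exact pauliString_single_mul _ _ _ _ (pauli_one_mul _)
  · simp only [gen, genComm, Fin.append_right]
    exact pauliString_single_mul _ _ _ _ (pauli_three_mul _)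

theorem pauliString_mul_self {n : ℕ} (j : Fin n → Fin 4) : pauliString j * pauliString j = 1 := by
  rw [pauliString, tensor_mul, ← tensor_one]
  congr 1
  funext k
  by_cases hk : j k = 0
  · rw [hk, pauli_zero, one_mul]
  · exact (isReflection_pauli hk).sq

theorem pauliString_conjTranspose {n : ℕ} (j : Fin n → Fin 4) :
    (pauliString j)ᴴ = pauliString j := by
  rw [pauliString, tensor_conjTranspose]
  congr 1
  funext k
  by_cases hk : j k = 0
  · rw [hk, pauli_zero, Matrix.conjTranspose_one]
  · exact (isReflection_pauli hk).herm

/-- Only `σ₂` is antisymmetric, and it is not used as a generator; the transpose trick thus costs no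
sign here. -/
theorem gen_transpose {n : ℕ} (k : Fin (n + n)) :
    (pauliString (gen k))ᵀ = pauliString (gen (n := n) k) := by
  have h : ∀ v : Fin 4, v ≠ 2 → (pauli v)ᵀ = pauli v := by
    intro v hv
    ext r s
    fin_cases v <;> fin_cases r <;> fin_cases s <;> simp [pauli] at hv ⊢
  rw [pauliString, tensor_transpose]
  congr 1
  funext l
  apply h
  refine Fin.addCases (fun i => ?_) (fun i => ?_) k
  all_goals
    simp only [gen, Fin.append_left, Fin.append_right]
    by_cases hl : l = i
    · subst hl
      simp
    · simp [hl]

theorem halfProj_mulVec {ι : Type} [Fintype ι] [DecidableEq ι] {B : Matrix ι ι ℂ} {v : ι → ℂ}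
    {s : Fin 2} (h : B *ᵥ v = sgn s • v) (b : Fin 2) :
    halfProj B b *ᵥ v = (if b = s then 1 else 0 : ℂ) • v := by
  rw [halfProj, Matrix.smul_mulVec, Matrix.add_mulVec, Matrix.one_mulVec, Matrix.smul_mulVec, h,
    smul_smul]
  nth_rw 1 [← one_smul ℂ v]
  rw [← add_smul, smul_smul, mul_comm (sgn b), half_one_add_sgn]

/-- The measurement in the basis `|U_j⟩` consists of measurements of `σ ⊗ UσU†`, up to sign, for
the generators `σ` of the Pauli strings. -/
theorem basisMeasuredBy_of_generators {n : ℕ} {𝒯 : Set (PlacedMeas (n + n))} {U : QOp n}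
    (hU : U * Uᴴ = 1) (L : Fin (n + n) → PlacedMeas (n + n)) (hL : ∀ k, L k ∈ 𝒯)
    (B : Fin (n + n) → QOp n) (o : Bits (n + n))
    (hB : ∀ k, B k * U = sgn (o k) • (U * pauliString (gen k)))
    (hproj : ∀ k, (L k).proj = halfProj
      (embed (Fin.castAddEmb n) (pauliString (gen k)) * embed (Fin.natAddEmb n) (B k))) :
    BasisMeasuredBy 𝒯 U := by
  -- The outcome pattern of `|U_j⟩` is the commutation pattern of `j`, shifted by the signs `o`. It
  -- is injective, and `2^(n+n) = 4^n` makes it bijective.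
  have hbij : Function.Bijective fun j : Fin n → Fin 4 => o + genComm j := by
    rw [Fintype.bijective_iff_injective_and_card]
    refine ⟨fun j l h => genComm_injective (add_left_cancel h), ?_⟩
    simp only [Fintype.card_fun, Fintype.card_fin]
    rw [pow_add, ← mul_pow]
    norm_num
  refine basisMeasuredBy_of_eigenstates hU L hL (Equiv.ofBijective _ hbij) fun k b j => ?_
  rw [hproj]
  refine halfProj_mulVec ?_ b
  -- With `σ` the generator: `(σ ⊗ B)` takes the vector of `Uσ_j` to that of `BUσ_jσ = ±Uσσ_jσ =
  -- ±Uσ_j`. One sign comes from `o` and the other from commuting `σ` past `σ_j`.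
  rw [← Matrix.mulVec_mulVec, basisState_eq, embed_natAdd_vecOf, embed_castAdd_vecOf,
    gen_transpose, ← mul_assoc, hB, ← vecOf_smul]
  congr 1
  rw [Matrix.smul_mul, Matrix.smul_mul, mul_assoc U, gen_mul, Matrix.mul_smul, Matrix.smul_mul,
    ← mul_assoc, mul_assoc (U * _), pauliString_mul_self, mul_one, smul_smul,
    Equiv.ofBijective_apply, Pi.add_apply, sgn_add]

/-! ### Placed parity measurements as reflections of the whole register. -/

theorem proj_halfProj {k N : ℕ} (A : Fin k → Matrix (Fin 2) (Fin 2) ℂ) (e : Fin k ↪ Fin N) :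
    PlacedMeas.proj ⟨⟨k, halfProj (tensor A)⟩, e⟩ =
      halfProj (tensor (Function.extend e A fun _ => 1)) := by
  funext b
  simp only [PlacedMeas.proj, halfProj, embed_smul, embed_add, embed_one, embed_tensor]

theorem embed_castAdd_mul_embed_natAdd {m n : ℕ} (P : Fin m → Matrix (Fin 2) (Fin 2) ℂ)
    (Q : Fin n → Matrix (Fin 2) (Fin 2) ℂ) :
    embed (Fin.castAddEmb n) (tensor P) * embed (Fin.natAddEmb m) (tensor Q) =
      tensor (Fin.append P Q) := by
  rw [embed_tensor, embed_tensor, tensor_mul,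
    extend_eq (g := Fin.append P fun _ => 1), extend_eq (g := Fin.append (fun _ => 1) Q)]
  · congr 1
    funext k
    refine Fin.addCases (fun i => ?_) (fun i => ?_) k <;> simp
  · intro i
    exact Fin.append_right _ _ i
  · intro k
    refine Fin.addCases (fun i _ => ?_) (fun i hi => ?_) k
    · simp
    · exact absurd rfl (hi i)
  · intro i
    exact Fin.append_left _ _ i
  · intro k
    refine Fin.addCases (fun i hi => ?_) (fun i _ => ?_) k
    · exact absurd rfl (hi i)
    · simp

theorem extend_pairPlacement {n : ℕ} (i : Fin n) (P Q : Matrix (Fin 2) (Fin 2) ℂ) :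
    Function.extend (pairPlacement n i) ![P, Q] (fun _ => 1) =
      Fin.append (Function.update (fun _ => 1) i P) (Function.update (fun _ => 1) i Q) := by
  refine extend_eq _ (fun l => ?_) fun k => ?_
  · fin_cases l
    · exact (Fin.append_left _ _ i).trans (by simp)
    · exact (Fin.append_right _ _ i).trans (by simp)
  · refine Fin.addCases (fun l hl => ?_) (fun l hl => ?_) k
    · have : l ≠ i := by
        rintro rfl
        exact hl 0 rfl
      simp [this]
    · have : l ≠ i := by
        rintro rfl
        exact hl 1 rfl
      rw [Fin.append_right, Function.update_of_ne this]

theorem pauliString_single {n : ℕ} (i : Fin n) (v : Fin 4) :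
    pauliString (Pi.single i v) = tensor (Function.update (fun _ => 1) i (pauli v)) := by
  rw [pauliString]
  congr 1
  funext k
  by_cases hk : k = i
  · subst hk
    simp
  · simp [hk, pauli_zero]

theorem proj_xor2 {N : ℕ} (A B : Matrix (Fin 2) (Fin 2) ℂ) (e : Fin 2 ↪ Fin N) :
    PlacedMeas.proj ⟨xor2 (spectralMeas A) (spectralMeas B), e⟩ =
      halfProj (tensor (Function.extend e ![A, B] fun _ => 1)) := by
  rw [← proj_halfProj, ← combine_two]

theorem proj_xor3 {N : ℕ} (A B C : Matrix (Fin 2) (Fin 2) ℂ) (e : Fin 3 ↪ Fin N) :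
    PlacedMeas.proj ⟨xor3 (spectralMeas A) (spectralMeas B) (spectralMeas C), e⟩ =
      halfProj (tensor (Function.extend e ![A, B, C] fun _ => 1)) := by
  rw [← proj_halfProj, ← combine_three]

theorem proj_pairPlacement {n : ℕ} (i : Fin n) (v : Fin 4) (A : Matrix (Fin 2) (Fin 2) ℂ) :
    PlacedMeas.proj ⟨xor2 (spectralMeas (pauli v)) (spectralMeas A), pairPlacement n i⟩ =
      halfProj (embed (Fin.castAddEmb n) (pauliString (Pi.single i v)) *
        embed (Fin.natAddEmb n) (tensor (Function.update (fun _ => 1) i A))) := by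
  rw [proj_xor2, extend_pairPlacement, pauliString_single, embed_castAdd_mul_embed_natAdd]

/-- Tensor products of Pauli operators, up to a phase. -/
def IsPauli {n : ℕ} (V : QOp n) : Prop :=
  ∃ (j : Fin n → Fin 4) (c : ℂ), ‖c‖ = 1 ∧ V = c • pauliString j

theorem IsPauli.mul_conjTranspose {n : ℕ} {V : QOp n} (hV : IsPauli V) : V * Vᴴ = 1 := by
  obtain ⟨j, c, hc, rfl⟩ := hV
  rw [Matrix.conjTranspose_smul, pauliString_conjTranspose, Matrix.smul_mul, Matrix.mul_smul,
    pauliString_mul_self, smul_smul, RCLike.star_def, Complex.mul_conj', hc]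
  simp

/-- For a Pauli `V`, `VσV† = ±σ`, so `B` can be the generator itself. The sign is its commutation
sign with `V` and only relabels the outcomes of the Bell measurements. -/
theorem IsPauli.basisMeasuredBy {n : ℕ} {V : QOp n} (hV : IsPauli V) :
    BasisMeasuredBy (bellMeas n) V := by
  have hU := hV.mul_conjTranspose
  obtain ⟨m, c, hc, rfl⟩ := hV
  refine basisMeasuredBy_of_generators hU
    (Fin.append (fun i => ⟨xor2 measX measX, pairPlacement n i⟩)
      (fun i => ⟨xor2 measZ measZ, pairPlacement n i⟩)) (fun k => ?_)
    (fun k => pauliString (gen k)) (genComm m) (fun k => ?_) fun k => ?_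
  · refine Fin.addCases (fun i => ?_) (fun i => ?_) k
    · rw [Fin.append_left]
      exact ⟨i, Or.inl rfl⟩
    · rw [Fin.append_right]
      exact ⟨i, Or.inr rfl⟩
  · rw [Matrix.mul_smul, gen_mul, Matrix.smul_mul, smul_comm]
  · refine Fin.addCases (fun i => ?_) (fun i => ?_) k
    · rw [Fin.append_left, measX, proj_pairPlacement, gen, Fin.append_left,
        pauliString_single]
    · rw [Fin.append_right, measZ, proj_pairPlacement, gen, Fin.append_right,
        pauliString_single]

/-! ### Pauli and Clifford operators -/

theorem pauli_mul_pauli (a b : Fin 4) :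
    ∃ (v : Fin 4) (z : ℂ), ‖z‖ = 1 ∧ pauli a * pauli b = z • pauli v := by
  -- The first table is the multiplication table of the Klein four-group, the second one the phases.
  refine ⟨![![0, 1, 2, 3], ![1, 0, 3, 2], ![2, 3, 0, 1], ![3, 2, 1, 0]] a b,
    ![![1, 1, 1, 1], ![1, 1, Complex.I, -Complex.I], ![1, -Complex.I, 1, Complex.I],
      ![1, Complex.I, -Complex.I, 1]] a b, ?_, ?_⟩
  · fin_cases a <;> fin_cases b <;> simp
  · ext r s
    fin_cases a <;> fin_cases b <;> fin_cases r <;> fin_cases s <;>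
      simp [pauli, Matrix.mul_apply]

theorem isPauli_pauliString {n : ℕ} (j : Fin n → Fin 4) : IsPauli (pauliString j) :=
  ⟨j, 1, by simp, by simp⟩

theorem isPauli_one {n : ℕ} : IsPauli (1 : QOp n) := by
  rw [← tensor_one]
  exact isPauli_pauliString fun _ => 0

theorem IsPauli.smul {n : ℕ} {V : QOp n} (hV : IsPauli V) {z : ℂ} (hz : ‖z‖ = 1) :
    IsPauli (z • V) := by
  obtain ⟨j, c, hc, rfl⟩ := hV
  exact ⟨j, z * c, by rw [norm_mul, hz, hc, one_mul], by rw [smul_smul]⟩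

theorem IsPauli.neg {n : ℕ} {V : QOp n} (hV : IsPauli V) : IsPauli (-V) := by
  rw [← neg_one_smul ℂ]
  exact hV.smul (by simp)

theorem IsPauli.mul {n : ℕ} {V W : QOp n} (hV : IsPauli V) (hW : IsPauli W) :
    IsPauli (V * W) := by
  obtain ⟨j, c, hc, rfl⟩ := hV
  obtain ⟨l, d, hd, rfl⟩ := hW
  choose v z hz h using fun k => pauli_mul_pauli (j k) (l k)
  have : pauliString j * pauliString l = (∏ k, z k) • pauliString v := by
    rw [pauliString, pauliString, tensor_mul, pauliString, ← tensor_smul]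
    congr 1
    funext k
    exact h k
  rw [Matrix.smul_mul, Matrix.mul_smul, this]
  refine ((isPauli_pauliString v).smul ?_).smul hd |>.smul hc
  rw [norm_prod]
  exact Finset.prod_eq_one fun k _ => hz k

theorem IsPauli.conjTranspose {n : ℕ} {V : QOp n} (hV : IsPauli V) : IsPauli Vᴴ := by
  obtain ⟨j, c, hc, rfl⟩ := hV
  rw [Matrix.conjTranspose_smul, pauliString_conjTranspose]
  exact (isPauli_pauliString j).smul (by rw [norm_star, hc])

/-- Unitary operators that conjugate Pauli operators to Pauli operators. -/
def IsClifford {n : ℕ} (V : QOp n) : Prop :=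
  V * Vᴴ = 1 ∧ ∀ e, IsPauli (V * pauliString e * Vᴴ)

theorem IsPauli.isClifford {n : ℕ} {V : QOp n} (hV : IsPauli V) : IsClifford V :=
  ⟨hV.mul_conjTranspose, fun e => (hV.mul (isPauli_pauliString e)).mul hV.conjTranspose⟩

theorem IsClifford.mul_isPauli {n : ℕ} {V P : QOp n} (hV : IsClifford V) (hP : IsPauli P) :
    IsClifford (V * P) := by
  refine ⟨?_, fun e => ?_⟩
  · rw [Matrix.conjTranspose_mul, mul_assoc, ← mul_assoc P, hP.mul_conjTranspose, one_mul, hV.1]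
  · obtain ⟨j, c, hc, h⟩ := hP.isClifford.2 e
    have : V * P * pauliString e * (V * P)ᴴ = c • (V * pauliString j * Vᴴ) := by
      rw [Matrix.conjTranspose_mul, ← Matrix.smul_mul, ← Matrix.mul_smul, ← h]
      simp only [mul_assoc]
    rw [this]
    exact (hV.2 j).smul hc

theorem isPauli_trialGate_of_isPauli {n : ℕ} {V : QOp n} (hV : IsPauli V)
    (errors : List (Fin n → Fin 4)) : IsPauli (trialGate V errors) := by
  induction errors generalizing V with
  | nil => exact hV
  | cons e l ih => exact ih (hV.isClifford.2 e)

/-- The first error turns a Clifford gate into a Pauli operator, and all later errors keep it one.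
-/
theorem IsClifford.isPauli_trialGate {n : ℕ} {V : QOp n} (hV : IsClifford V)
    (e : Fin n → Fin 4) (l : List (Fin n → Fin 4)) : IsPauli (trialGate V (e :: l)) :=
  isPauli_trialGate_of_isPauli (hV.2 e) l

theorem conj_eq_of_mul_eq {ι : Type*} [Fintype ι] [DecidableEq ι] {V s P : Matrix ι ι ℂ}
    (hV : V * Vᴴ = 1) (h : V * s = P * V) : V * s * Vᴴ = P := by
  rw [h, mul_assoc, hV, mul_one]

/-! ### Single-qubit gates -/

/-- A single-qubit operator as an operator on a register of one qubit. -/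
def op1 (u : Matrix (Fin 2) (Fin 2) ℂ) : QOp 1 := tensor fun _ => u

theorem op1_mul (u v : Matrix (Fin 2) (Fin 2) ℂ) : op1 u * op1 v = op1 (u * v) :=
  tensor_mul _ _

theorem op1_conjTranspose (u : Matrix (Fin 2) (Fin 2) ℂ) : (op1 u)ᴴ = op1 uᴴ :=
  tensor_conjTranspose _

theorem op1_one : op1 1 = 1 := tensor_one

theorem op1_smul (c : ℂ) (u : Matrix (Fin 2) (Fin 2) ℂ) : op1 (c • u) = c • op1 u := by
  rw [op1, tensor_smul (fun _ => c) fun _ => u]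
  simp [op1]

theorem op1_neg (u : Matrix (Fin 2) (Fin 2) ℂ) : op1 (-u) = -op1 u := by
  rw [← neg_one_smul ℂ, op1_smul, neg_one_smul]

theorem pauliString_one_qubit (e : Fin 1 → Fin 4) : pauliString e = op1 (pauli (e 0)) := by
  rw [pauliString, op1]
  congr 1
  funext k
  rw [Subsingleton.elim k 0]

theorem isPauli_op1 (v : Fin 4) : IsPauli (op1 (pauli v)) := by
  rw [← pauliString_one_qubit fun _ => v]
  exact isPauli_pauliString _

theorem bellMeas_subset (n : ℕ) : bellMeas n ⊆ {p | p.1 ∈ universalSet} := by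
  rintro p ⟨i, rfl | rfl⟩ <;> simp [universalSet]

theorem BasisMeasuredBy.mono {n : ℕ} {𝒯 𝒯' : Set (PlacedMeas (n + n))} {U : QOp n}
    (h : BasisMeasuredBy 𝒯 U) (hs : 𝒯 ⊆ 𝒯') : BasisMeasuredBy 𝒯' U := by
  obtain ⟨L, hL, hc⟩ := h
  exact ⟨L, fun k => hs (hL k), hc⟩

/-- The two measurements are `σ₁ ⊗ uσ₁u†` and `σ₃ ⊗ uσ₃u†`. The signs `s`, `t` allow `A` and `B` to
be the images only up to sign, with the outcomes relabelled. -/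
theorem basisMeasuredBy_op1 {u A B : Matrix (Fin 2) (Fin 2) ℂ} {s t : Fin 2}
    (hu : u * uᴴ = 1) (hA : A * u = sgn s • (u * pauli 1)) (hB : B * u = sgn t • (u * pauli 3))
    (hA' : xor2 measX (spectralMeas A) ∈ universalSet)
    (hB' : xor2 measZ (spectralMeas B) ∈ universalSet) :
    BasisMeasuredBy {p | p.1 ∈ universalSet} (op1 u) := by
  have hup : ∀ (i : Fin 1) (M : Matrix (Fin 2) (Fin 2) ℂ),
      tensor (Function.update (fun _ => 1) i M) = op1 M := by
    intro i M
    rw [op1]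
    congr 1
    funext k
    rw [Subsingleton.elim k i, Function.update_self]
  refine basisMeasuredBy_of_generators (by rw [op1_conjTranspose, op1_mul, hu, op1_one])
    (Fin.append (fun i => ⟨xor2 measX (spectralMeas A), pairPlacement 1 i⟩)
      (fun i => ⟨xor2 measZ (spectralMeas B), pairPlacement 1 i⟩)) (fun k => ?_)
    (Fin.append (fun _ => op1 A) (fun _ => op1 B)) (Fin.append (fun _ => s) (fun _ => t))
    (fun k => ?_) (fun k => ?_)
  all_goals refine Fin.addCases (fun i => ?_) (fun i => ?_) k
  all_goals simp only [gen, Fin.append_left, Fin.append_right]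
  · exact hA'
  · exact hB'
  · rw [pauliString_single, hup, op1_mul, op1_mul, hA, op1_smul]
  · rw [pauliString_single, hup, op1_mul, op1_mul, hB, op1_smul]
  · rw [measX, proj_pairPlacement, hup]
  · rw [measZ, proj_pairPlacement, hup]

/-- The Hadamard matrix. -/
def hadamard : Matrix (Fin 2) (Fin 2) ℂ := ((1 / √2 : ℝ) : ℂ) • !![1, 1; 1, -1]

theorem hadamard_conjTranspose : hadamardᴴ = hadamard := by
  rw [hadamard, Matrix.conjTranspose_smul, RCLike.star_def, Complex.conj_ofReal]
  congr 1
  ext a b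
  fin_cases a <;> fin_cases b <;> simp

theorem hadamard_mul_self : hadamard * hadamard = 1 := by
  rw [hadamard, Matrix.smul_mul, Matrix.mul_smul, smul_smul, inv_sqrt_two_mul_self]
  ext a b
  fin_cases a <;> fin_cases b <;> simp <;> norm_num

theorem hadamard_mul_X : hadamard * pauli 1 = pauli 3 * hadamard := by
  rw [hadamard, Matrix.smul_mul, Matrix.mul_smul]
  congr 1
  ext a b
  fin_cases a <;> fin_cases b <;> simp [pauli]

theorem hadamard_mul_Y : hadamard * pauli 2 = -pauli 2 * hadamard := by
  rw [hadamard, Matrix.smul_mul, Matrix.mul_smul]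
  congr 1
  ext a b
  fin_cases a <;> fin_cases b <;> simp [pauli]

theorem hadamard_mul_Z : hadamard * pauli 3 = pauli 1 * hadamard := by
  rw [hadamard, Matrix.smul_mul, Matrix.mul_smul]
  congr 1
  ext a b
  fin_cases a <;> fin_cases b <;> simp [pauli]

theorem isClifford_op1 {u : Matrix (Fin 2) (Fin 2) ℂ} (hu : u * uᴴ = 1)
    (h : ∀ v, ∃ w : Fin 4, u * pauli v = pauli w * u ∨ u * pauli v = -pauli w * u) :
    IsClifford (op1 u) := by
  have hu' : op1 u * (op1 u)ᴴ = 1 := by rw [op1_conjTranspose, op1_mul, hu, op1_one]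
  refine ⟨hu', fun e => ?_⟩
  rw [pauliString_one_qubit]
  obtain ⟨w, hw | hw⟩ := h (e 0)
  · rw [conj_eq_of_mul_eq hu' (P := op1 (pauli w)) (by rw [op1_mul, op1_mul, hw])]
    exact isPauli_op1 w
  · rw [conj_eq_of_mul_eq hu' (P := op1 (-pauli w)) (by rw [op1_mul, op1_mul, hw]), op1_neg]
    exact (isPauli_op1 w).neg

theorem hadamard_unitary : hadamard * hadamardᴴ = 1 := by
  rw [hadamard_conjTranspose, hadamard_mul_self]

theorem isClifford_H : IsClifford Gate.H.op := by
  refine isClifford_op1 hadamard_unitary fun v => ?_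
  fin_cases v
  · exact ⟨0, Or.inl (by simp [pauli_zero])⟩
  · exact ⟨3, Or.inl hadamard_mul_X⟩
  · exact ⟨2, Or.inr hadamard_mul_Y⟩
  · exact ⟨1, Or.inl hadamard_mul_Z⟩

theorem basisMeasuredBy_H : BasisMeasuredBy {p | p.1 ∈ universalSet} Gate.H.op := by
  refine basisMeasuredBy_op1 (u := hadamard) (A := pauli 3) (B := pauli 1) (s := 0) (t := 0)
    hadamard_unitary (by simp [hadamard_mul_X]) (by simp [hadamard_mul_Z]) ?_ ?_
  · exact show xor2 measX measZ ∈ universalSet by simp [universalSet]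
  · exact show xor2 measZ measX ∈ universalSet by simp [universalSet]

/-- The matrix of the `π/8` gate. -/
def matT : Matrix (Fin 2) (Fin 2) ℂ :=
  !![Complex.exp (-(Complex.I * Real.pi / 8)), 0; 0, Complex.exp (Complex.I * Real.pi / 8)]

theorem exp_pi_eighth_mul_self :
    Complex.exp (Complex.I * Real.pi / 8) * Complex.exp (Complex.I * Real.pi / 8) =
      ((1 / √2 : ℝ) : ℂ) * (1 + Complex.I) := by
  have h : Complex.I * Real.pi / 8 + Complex.I * Real.pi / 8 =
      ((Real.pi / 4 : ℝ) : ℂ) * Complex.I := by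
    push_cast
    ring
  have h2 : √2 / 2 = 1 / √2 := by
    rw [div_eq_div_iff (by norm_num) (by positivity), Real.mul_self_sqrt (by norm_num)]
    norm_num
  rw [← Complex.exp_add, h, Complex.exp_mul_I, ← Complex.ofReal_cos, ← Complex.ofReal_sin,
    Real.cos_pi_div_four, Real.sin_pi_div_four, h2]
  ring

/-- With a common phase factored out, the relations of `T` become polynomial identities in `1/√2`
and `i`. -/
theorem matT_eq : matT = !![Complex.exp (-(Complex.I * Real.pi / 8)), 0;
    0, ((1 / √2 : ℝ) : ℂ) * (1 + Complex.I) * Complex.exp (-(Complex.I * Real.pi / 8))] := by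
  rw [matT, ← exp_pi_eighth_mul_self, mul_assoc, ← Complex.exp_add, add_neg_cancel,
    Complex.exp_zero, mul_one]

theorem matT_unitary : matT * matTᴴ = 1 := by
  have h₁ : (starRingEnd ℂ) (Complex.exp (-(Complex.I * Real.pi / 8))) =
      Complex.exp (Complex.I * Real.pi / 8) := by
    rw [← Complex.exp_conj]
    congr 1
    simp only [map_neg, map_div₀, map_mul, Complex.conj_I, Complex.conj_ofReal, map_ofNat]
    ring
  have h₂ : (starRingEnd ℂ) (Complex.exp (Complex.I * Real.pi / 8)) =
      Complex.exp (-(Complex.I * Real.pi / 8)) := by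
    rw [← h₁, Complex.conj_conj]
  ext a b
  fin_cases a <;> fin_cases b <;>
    simp [matT, Matrix.mul_apply, h₁, h₂, ← Complex.exp_add]

/-- `T` rotates by `π/4` about the third axis and so takes `σ₁` halfway to `σ₂`. This is what calls
for the measurement `W`. -/
theorem matT_mul_X : matT * pauli 1 = opW * matT := by
  rw [matT_eq, opW, Matrix.smul_mul]
  have h := inv_sqrt_two_mul_self
  have hI := Complex.I_mul_I
  ext a b
  fin_cases a <;> fin_cases b <;> simp [pauli, Matrix.mul_apply] at h ⊢
  · linear_combination (-2 * Complex.exp (-(Complex.I * Real.pi / 8))) * h +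
      (Complex.exp (-(Complex.I * Real.pi / 8)) * ((√2 : ℂ)⁻¹ * (√2 : ℂ)⁻¹)) * hI
  · ring

theorem matT_mul_Z : matT * pauli 3 = pauli 3 * matT := by
  rw [matT]
  ext a b
  fin_cases a <;> fin_cases b <;> simp [pauli]

theorem pauli_two_eq : pauli 2 = Complex.I • (pauli 1 * pauli 3) := by
  ext a b
  fin_cases a <;> fin_cases b <;> simp [pauli]

theorem opW_mul_X : opW * pauli 1 = pauli 2 * opW := by
  rw [opW, Matrix.smul_mul, Matrix.mul_smul, add_mul, mul_add]
  congr 1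
  rw [(isReflection_pauli (j := 1) (by decide)).sq, (isReflection_pauli (j := 2) (by decide)).sq,
    add_comm]

theorem opW_mul_Y : opW * pauli 2 = pauli 1 * opW := by
  rw [opW, Matrix.smul_mul, Matrix.mul_smul, add_mul, mul_add]
  congr 1
  rw [(isReflection_pauli (j := 1) (by decide)).sq, (isReflection_pauli (j := 2) (by decide)).sq,
    add_comm]

theorem opW_mul_Z : opW * pauli 3 = -pauli 3 * opW := by
  rw [opW, Matrix.smul_mul, Matrix.mul_smul]
  congr 1
  ext a b
  fin_cases a <;> fin_cases b <;> simp [pauli, Matrix.mul_apply]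

theorem opW_unitary : opW * opWᴴ = 1 := by
  rw [isReflection_opW.herm.eq, isReflection_opW.sq]

theorem isClifford_opW : IsClifford (op1 opW) := by
  refine isClifford_op1 opW_unitary fun v => ?_
  fin_cases v
  · exact ⟨0, Or.inl (by simp [pauli_zero])⟩
  · exact ⟨2, Or.inl opW_mul_X⟩
  · exact ⟨1, Or.inl opW_mul_Y⟩
  · exact ⟨3, Or.inr opW_mul_Z⟩

/-- The operator `(σ₂ - σ₁)/√2`. -/
def opW' : Matrix (Fin 2) (Fin 2) ℂ := Complex.I • (opW * pauli 3)

theorem opW'_unitary : opW' * opW'ᴴ = 1 := by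
  have h := isReflection_pauli (j := 3) (by decide)
  rw [opW', Matrix.conjTranspose_smul, Matrix.conjTranspose_mul, Matrix.smul_mul,
    Matrix.mul_smul, smul_smul, h.herm.eq, mul_assoc, ← mul_assoc (pauli 3), h.sq, one_mul,
    opW_unitary]
  simp

theorem isClifford_opW' : IsClifford (op1 opW') := by
  rw [opW', ← Matrix.mul_smul, ← op1_mul, op1_smul]
  exact isClifford_opW.mul_isPauli ((isPauli_op1 3).smul (by simp))

/-- Since `σ₂ = iσ₁σ₃` and `T` fixes `σ₃`, this follows from the image of `σ₁`. -/
theorem matT_mul_Y : matT * pauli 2 = opW' * matT := by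
  rw [pauli_two_eq, opW', Matrix.mul_smul, ← mul_assoc, matT_mul_X, mul_assoc, matT_mul_Z,
    Matrix.smul_mul, mul_assoc]

/-- Errors `I` and `σ₃` commute with `T` and leave a Pauli gate. Errors `σ₁` and `σ₂` leave a gate
that is Clifford but not Pauli, which is why `T` may need a second failure before Bell measurements
suffice. -/
theorem trialGate_T_single (e : Fin 1 → Fin 4) :
    IsPauli (trialGate Gate.T.op [e]) ∨ trialGate Gate.T.op [e] = op1 opW ∨
      trialGate Gate.T.op [e] = op1 opW' := by
  have hT : op1 matT * (op1 matT)ᴴ = 1 := by rw [op1_conjTranspose, op1_mul, matT_unitary, op1_one]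
  have h : trialGate Gate.T.op [e] = op1 matT * op1 (pauli (e 0)) * (op1 matT)ᴴ := by
    rw [← pauliString_one_qubit]
    rfl
  rw [h]
  generalize e 0 = v
  fin_cases v
  · refine Or.inl ?_
    rw [conj_eq_of_mul_eq hT (P := op1 (pauli 0)) (by simp [op1_mul, pauli_zero])]
    exact isPauli_op1 0
  · refine Or.inr (Or.inl (conj_eq_of_mul_eq hT ?_))
    rw [op1_mul, op1_mul]
    exact congrArg op1 matT_mul_X
  · refine Or.inr (Or.inr (conj_eq_of_mul_eq hT ?_))
    rw [op1_mul, op1_mul]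
    exact congrArg op1 matT_mul_Y
  · refine Or.inl ?_
    rw [conj_eq_of_mul_eq hT (P := op1 (pauli 3))]
    · exact isPauli_op1 3
    · rw [op1_mul, op1_mul]
      exact congrArg op1 matT_mul_Z

theorem isClifford_trialGate_T (e : Fin 1 → Fin 4) : IsClifford (trialGate Gate.T.op [e]) := by
  rcases trialGate_T_single e with h | h | h
  · exact h.isClifford
  · rw [h]
    exact isClifford_opW
  · rw [h]
    exact isClifford_opW'

theorem basisMeasuredBy_T : BasisMeasuredBy {p | p.1 ∈ universalSet} Gate.T.op := by
  refine basisMeasuredBy_op1 (u := matT) (A := opW) (B := pauli 3) (s := 0) (t := 0)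
    matT_unitary (by simp [matT_mul_X]) (by simp [matT_mul_Z]) ?_ ?_
  · exact show xor2 measX measW ∈ universalSet by simp [universalSet]
  · exact show xor2 measZ measZ ∈ universalSet by simp [universalSet]

theorem basisMeasuredBy_opW : BasisMeasuredBy {p | p.1 ∈ universalSet} (op1 opW) := by
  refine basisMeasuredBy_op1 (A := pauli 2) (B := pauli 3) (s := 0) (t := 1)
    opW_unitary (by simp [opW_mul_X]) (by simp [opW_mul_Z]) ?_ ?_
  · exact show xor2 measX measY ∈ universalSet by simp [universalSet]
  · exact show xor2 measZ measZ ∈ universalSet by simp [universalSet]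

/-- The image of `σ₁` is now `-σ₂`, so the pair of measurements is that of `opW`, with the outcomes
of `⊕[X, Y]` read in reverse. -/
theorem basisMeasuredBy_opW' : BasisMeasuredBy {p | p.1 ∈ universalSet} (op1 opW') := by
  refine basisMeasuredBy_op1 (A := pauli 2) (B := pauli 3) (s := 1) (t := 1)
    opW'_unitary ?_ ?_ ?_ ?_
  · rw [opW', Matrix.mul_smul, ← mul_assoc, ← opW_mul_X, Matrix.smul_mul, mul_assoc, mul_assoc,
      pauli_three_mul 1, smul_comm]
    simp [commZ]
  · rw [opW', Matrix.mul_smul, Matrix.smul_mul, ← mul_assoc, sgn_one, neg_one_smul,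
      ← smul_neg, ← neg_mul, opW_mul_Z]
    simp
  · exact show xor2 measX measY ∈ universalSet by simp [universalSet]
  · exact show xor2 measZ measZ ∈ universalSet by simp [universalSet]

/-! ### The C-NOT gate -/

theorem tensor_two_mul (A B C D : Matrix (Fin 2) (Fin 2) ℂ) :
    tensor ![A, B] * tensor ![C, D] = tensor ![A * C, B * D] := by
  rw [tensor_mul]
  congr 1
  funext k
  fin_cases k <;> rfl

/-- The projection to `|0⟩`. -/
def ket0 : Matrix (Fin 2) (Fin 2) ℂ := !![1, 0; 0, 0]
/-- The projection to `|1⟩`. -/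
def ket1 : Matrix (Fin 2) (Fin 2) ℂ := !![0, 0; 0, 1]

/-- The C-NOT operator. -/
def opCNOT : QOp 2 := tensor ![ket0, 1] + tensor ![ket1, pauli 1]

theorem CNOT_op : Gate.CNOT.op = opCNOT := by
  ext x y
  have h : ∀ z : Bits 2, ∃ a b, z = ![a, b] := fun z => ⟨z 0, z 1, by
    funext k
    fin_cases k <;> rfl⟩
  obtain ⟨a, b, rfl⟩ := h x
  obtain ⟨c, d, rfl⟩ := h y
  rw [opCNOT, Matrix.add_apply, tensor_apply, tensor_apply, Fin.prod_univ_two,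
    Fin.prod_univ_two]
  change (if ![a, b] 0 = ![c, d] 0 ∧ ![a, b] 1 = ![c, d] 0 + ![c, d] 1 then (1 : ℂ) else 0) = _
  fin_cases a <;> fin_cases b <;> fin_cases c <;> fin_cases d <;> simp [ket0, ket1, pauli]

theorem ket0_mul_Z : ket0 * pauli 3 = ket0 := by
  ext a b; fin_cases a <;> fin_cases b <;> simp [ket0, pauli]
theorem Z_mul_ket0 : pauli 3 * ket0 = ket0 := by
  ext a b; fin_cases a <;> fin_cases b <;> simp [ket0, pauli]
theorem ket1_mul_Z : ket1 * pauli 3 = -ket1 := by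
  ext a b; fin_cases a <;> fin_cases b <;> simp [ket1, pauli]
theorem Z_mul_ket1 : pauli 3 * ket1 = -ket1 := by
  ext a b; fin_cases a <;> fin_cases b <;> simp [ket1, pauli]
theorem ket0_mul_X : ket0 * pauli 1 = pauli 1 * ket1 := by
  ext a b; fin_cases a <;> fin_cases b <;> simp [ket0, ket1, pauli]
theorem ket1_mul_X : ket1 * pauli 1 = pauli 1 * ket0 := by
  ext a b; fin_cases a <;> fin_cases b <;> simp [ket0, ket1, pauli]
theorem X_mul_X : pauli 1 * pauli 1 = 1 := (isReflection_pauli (by decide)).sq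
theorem Z_mul_Z : pauli 3 * pauli 3 = 1 := (isReflection_pauli (by decide)).sq
theorem Z_mul_X : pauli 3 * pauli 1 = -(pauli 1 * pauli 3) := by
  rw [pauli_three_mul]
  simp [commZ]

theorem tensor_neg_neg (A B : Matrix (Fin 2) (Fin 2) ℂ) :
    tensor ![-A, -B] = tensor ![A, B] := by
  ext x y
  simp [tensor_apply, Fin.prod_univ_two]

/-- Flipping the control exchanges the two branches, which differ by a flip of the target. Together
with the reference qubit this gives `⊕[X, X, X]`. -/
theorem CNOT_mul_XI :
    opCNOT * tensor ![pauli 1, 1] = tensor ![pauli 1, pauli 1] * opCNOT := by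
  rw [opCNOT, add_mul, mul_add]
  simp only [tensor_two_mul, mul_one, ket0_mul_X, ket1_mul_X, X_mul_X]
  exact add_comm _ _

theorem CNOT_mul_IX :
    opCNOT * tensor ![1, pauli 1] = tensor ![1, pauli 1] * opCNOT := by
  rw [opCNOT, add_mul, mul_add]
  simp only [tensor_two_mul, one_mul, mul_one]

theorem CNOT_mul_ZI :
    opCNOT * tensor ![pauli 3, 1] = tensor ![pauli 3, 1] * opCNOT := by
  rw [opCNOT, add_mul, mul_add]
  simp only [tensor_two_mul, one_mul, mul_one, ket0_mul_Z, ket1_mul_Z, Z_mul_ket0, Z_mul_ket1]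

/-- Phase kickback: `σ₃` anticommutes with the flip of the target in the branch `|1⟩` only, and that
sign is a `σ₃` on the control. With the reference qubit this gives `⊕[Z, Z, Z]`. -/
theorem CNOT_mul_IZ :
    opCNOT * tensor ![1, pauli 3] = tensor ![pauli 3, pauli 3] * opCNOT := by
  rw [opCNOT, add_mul, mul_add]
  simp only [tensor_two_mul, one_mul, mul_one, Z_mul_ket0, Z_mul_ket1, Z_mul_X, tensor_neg_neg]

theorem CNOT_mul_self : opCNOT * opCNOT = 1 := by
  have h₀ : ket0 * ket0 = ket0 := by ext a b; fin_cases a <;> fin_cases b <;> simp [ket0]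
  have h₁ : ket1 * ket1 = ket1 := by ext a b; fin_cases a <;> fin_cases b <;> simp [ket1]
  have h₂ : ket0 * ket1 = 0 := by ext a b; fin_cases a <;> fin_cases b <;> simp [ket0, ket1]
  have h₃ : ket1 * ket0 = 0 := by ext a b; fin_cases a <;> fin_cases b <;> simp [ket0, ket1]
  have hz : ∀ B, tensor ![0, B] = 0 := fun B => by
    ext x y
    simp [tensor_apply, Fin.prod_univ_two]
  have hs : tensor ![ket0, 1] + tensor ![ket1, 1] = 1 := by
    have h : (1 : Matrix (Fin 2) (Fin 2) ℂ) = ket0 + ket1 := by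
      ext a b; fin_cases a <;> fin_cases b <;> simp [ket0, ket1]
    rw [← tensor_one]
    ext x y
    simp only [Matrix.add_apply, tensor_apply, Fin.prod_univ_two, Matrix.cons_val_zero,
      Matrix.cons_val_one, ← add_mul]
    rw [← Matrix.add_apply, ← h]
  rw [← hs, opCNOT]
  simp only [add_mul, mul_add, tensor_two_mul, one_mul, mul_one, h₀, h₁, h₂, h₃, hz, X_mul_X,
    add_zero, zero_add]

theorem CNOT_conjTranspose : opCNOTᴴ = opCNOT := by
  have h₀ : ket0ᴴ = ket0 := by ext a b; fin_cases a <;> fin_cases b <;> simp [ket0]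
  have h₁ : ket1ᴴ = ket1 := by ext a b; fin_cases a <;> fin_cases b <;> simp [ket1]
  have h₂ : (pauli 1)ᴴ = pauli 1 := (isReflection_pauli (by decide)).herm.eq
  have h : ∀ A B : Matrix (Fin 2) (Fin 2) ℂ, (tensor ![A, B])ᴴ = tensor ![Aᴴ, Bᴴ] := by
    intro A B
    rw [tensor_conjTranspose]
    congr 1
    funext k
    fin_cases k <;> rfl
  rw [opCNOT]
  rw [Matrix.conjTranspose_add, h, h, h₀, h₁, h₂, Matrix.conjTranspose_one]

theorem CNOT_unitary : opCNOT * opCNOTᴴ = 1 := by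
  rw [CNOT_conjTranspose, CNOT_mul_self]

theorem isPauli_tensor_two (a b : Fin 4) : IsPauli (tensor ![pauli a, pauli b]) := by
  have : tensor ![pauli a, pauli b] = pauliString ![a, b] := by
    rw [pauliString]
    congr 1
    funext k
    fin_cases k <;> rfl
  rw [this]
  exact isPauli_pauliString _

theorem pauliString_two (e : Fin 2 → Fin 4) :
    pauliString e = tensor ![pauli (e 0), 1] * tensor ![1, pauli (e 1)] := by
  rw [tensor_two_mul, mul_one, one_mul, pauliString]
  congr 1
  funext k
  fin_cases k <;> rfl

theorem isClifford_CNOT : IsClifford opCNOT := by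
  -- The operators that C-NOT carries to Pauli operators are closed under products and phases, so
  -- the four generators suffice; `σ₂` is `iσ₁σ₃`.
  let Passes (P : QOp 2) : Prop := ∃ Q, IsPauli Q ∧ opCNOT * P = Q * opCNOT
  have mul : ∀ {P R : QOp 2}, Passes P → Passes R → Passes (P * R) := by
    rintro P R ⟨Q, hQ, h⟩ ⟨S, hS, h'⟩
    exact ⟨Q * S, hQ.mul hS, by rw [← mul_assoc, h, mul_assoc, h', mul_assoc]⟩
  have smul : ∀ {P : QOp 2}, Passes P → Passes (Complex.I • P) := by
    rintro P ⟨Q, hQ, h⟩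
    exact ⟨Complex.I • Q, hQ.smul (by simp), by rw [Matrix.mul_smul, h, Matrix.smul_mul]⟩
  have one : Passes (tensor ![1, 1]) := by
    refine ⟨_, isPauli_tensor_two 0 0, ?_⟩
    have : tensor ![1, 1] = (1 : QOp 2) := by
      rw [← tensor_one]
      congr 1
      funext k
      fin_cases k <;> rfl
    rw [pauli_zero, this, mul_one, one_mul]
  have hYI : tensor ![pauli 2, 1] =
      Complex.I • (tensor ![pauli 1, 1] * tensor ![pauli 3, 1]) := by
    rw [tensor_two_mul, pauli_two_eq, one_mul]
    ext x y
    simp [tensor_apply, Fin.prod_univ_two, mul_assoc]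
  have hIY : tensor ![1, pauli 2] =
      Complex.I • (tensor ![1, pauli 1] * tensor ![1, pauli 3]) := by
    rw [tensor_two_mul, pauli_two_eq, one_mul]
    ext x y
    simp [tensor_apply, Fin.prod_univ_two, mul_left_comm]
  have hXI : Passes (tensor ![pauli 1, 1]) := ⟨_, isPauli_tensor_two 1 1, CNOT_mul_XI⟩
  have hZI : Passes (tensor ![pauli 3, 1]) := ⟨_, isPauli_tensor_two 3 0, CNOT_mul_ZI⟩
  have hIX : Passes (tensor ![1, pauli 1]) := ⟨_, isPauli_tensor_two 0 1, CNOT_mul_IX⟩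
  have hIZ : Passes (tensor ![1, pauli 3]) := ⟨_, isPauli_tensor_two 3 3, CNOT_mul_IZ⟩
  have left : ∀ v, Passes (tensor ![pauli v, 1]) := by
    intro v
    fin_cases v
    · exact one
    · exact hXI
    · exact hYI ▸ smul (mul hXI hZI)
    · exact hZI
  have right : ∀ v, Passes (tensor ![1, pauli v]) := by
    intro v
    fin_cases v
    · exact one
    · exact hIX
    · exact hIY ▸ smul (mul hIX hIZ)
    · exact hIZ
  refine ⟨CNOT_unitary, fun e => ?_⟩
  obtain ⟨Q, hQ, h⟩ := mul (left (e 0)) (right (e 1))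
  rw [pauliString_two, conj_eq_of_mul_eq CNOT_unitary h]
  exact hQ

theorem pauliString_gen_two (k : Fin (2 + 2)) :
    pauliString (gen k) = ![tensor ![pauli 1, 1], tensor ![1, pauli 1], tensor ![pauli 3, 1],
      tensor ![1, pauli 3]] k := by
  fin_cases k
  all_goals
    refine congrArg tensor (funext fun l => ?_)
    fin_cases l <;> rfl

theorem basisMeasuredBy_CNOT : BasisMeasuredBy {p | p.1 ∈ universalSet} opCNOT := by
  -- Qubits 0 and 1 are the reference halves of control and target; 2 and 3 carry the gate. `X` on
  -- the control spreads to both gate qubits, and so does `Z` on the target.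
  let eX : Fin 3 ↪ Fin (2 + 2) := ⟨![0, 2, 3], by decide⟩
  let eZ : Fin 3 ↪ Fin (2 + 2) := ⟨![1, 2, 3], by decide⟩
  have hX : Function.extend eX ![pauli 1, pauli 1, pauli 1] (fun _ => 1) =
      Fin.append ![pauli 1, 1] ![pauli 1, pauli 1] := by
    refine extend_eq _ (fun i => ?_) fun k hk => ?_
    · fin_cases i <;> rfl
    · fin_cases k
      · exact absurd rfl (hk 0)
      · rfl
      · exact absurd rfl (hk 1)
      · exact absurd rfl (hk 2)
  have hZ : Function.extend eZ ![pauli 3, pauli 3, pauli 3] (fun _ => 1) =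
      Fin.append ![1, pauli 3] ![pauli 3, pauli 3] := by
    refine extend_eq _ (fun i => ?_) fun k hk => ?_
    · fin_cases i <;> rfl
    · fin_cases k
      · rfl
      · exact absurd rfl (hk 0)
      · exact absurd rfl (hk 1)
      · exact absurd rfl (hk 2)
  have hup₀ : ∀ A : Matrix (Fin 2) (Fin 2) ℂ, Function.update (fun _ => 1) (0 : Fin 2) A =
      ![A, 1] := fun A => by
    funext k
    fin_cases k <;> rfl
  have hup₁ : ∀ A : Matrix (Fin 2) (Fin 2) ℂ, Function.update (fun _ => 1) (1 : Fin 2) A =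
      ![1, A] := fun A => by
    funext k
    fin_cases k <;> rfl
  refine basisMeasuredBy_of_generators CNOT_unitary
    ![⟨xor3 measX measX measX, eX⟩, ⟨xor2 measX measX, pairPlacement 2 1⟩,
      ⟨xor2 measZ measZ, pairPlacement 2 0⟩, ⟨xor3 measZ measZ measZ, eZ⟩] (fun k => ?_)
    ![tensor ![pauli 1, pauli 1], tensor ![1, pauli 1], tensor ![pauli 3, 1],
      tensor ![pauli 3, pauli 3]] (fun _ => 0) (fun k => ?_) (fun k => ?_)
  · fin_cases k
    · exact show xor3 measX measX measX ∈ universalSet by simp [universalSet]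
    · exact show xor2 measX measX ∈ universalSet by simp [universalSet]
    · exact show xor2 measZ measZ ∈ universalSet by simp [universalSet]
    · exact show xor3 measZ measZ measZ ∈ universalSet by simp [universalSet]
  · rw [pauliString_gen_two, sgn_zero, one_smul]
    fin_cases k
    · exact CNOT_mul_XI.symm
    · exact CNOT_mul_IX.symm
    · exact CNOT_mul_ZI.symm
    · exact CNOT_mul_IZ.symm
  · rw [pauliString_gen_two]
    fin_cases k
    · refine (proj_xor3 _ _ _ eX).trans ?_
      rw [hX, ← embed_castAdd_mul_embed_natAdd]
      rfl
    · refine (proj_xor2 _ _ _).trans ?_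
      rw [extend_pairPlacement, hup₁, ← embed_castAdd_mul_embed_natAdd]
      rfl
    · refine (proj_xor2 _ _ _).trans ?_
      rw [extend_pairPlacement, hup₀, ← embed_castAdd_mul_embed_natAdd]
      rfl
    · refine (proj_xor3 _ _ _ eZ).trans ?_
      rw [hZ, ← embed_castAdd_mul_embed_natAdd]
      rfl

/-! ### The gates called for after failed trials -/

theorem isPauli_trialGate (g : Gate) (errors : List (Fin g.arity → Fin 4))
    (h : g.nonBellTrials ≤ errors.length) : IsPauli (trialGate g.op errors) := by
  match g, errors, h with
  | .H, e :: l, _ => exact isClifford_H.isPauli_trialGate e l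
  | .T, e :: e' :: l, _ =>
    exact (isClifford_trialGate_T e).isPauli_trialGate e' l
  | .CNOT, e :: l, _ =>
    rw [CNOT_op]
    exact isClifford_CNOT.isPauli_trialGate e l

theorem basisMeasuredBy_trialGate (g : Gate) (errors : List (Fin g.arity → Fin 4)) :
    BasisMeasuredBy {p | p.1 ∈ universalSet} (trialGate g.op errors) := by
  by_cases h : g.nonBellTrials ≤ errors.length
  · exact (isPauli_trialGate g errors h).basisMeasuredBy.mono (bellMeas_subset _)
  match g, errors, h with
  | .H, [], _ => exact basisMeasuredBy_H
  | .T, [], _ => exact basisMeasuredBy_T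
  | .T, [e], _ =>
    rcases trialGate_T_single e with h | h | h
    · exact h.basisMeasuredBy.mono (bellMeas_subset _)
    · rw [h]
      exact basisMeasuredBy_opW
    · rw [h]
      exact basisMeasuredBy_opW'
  | .CNOT, [], _ =>
    rw [CNOT_op]
    exact basisMeasuredBy_CNOT
  | .H, _ :: _, h => simp [Gate.nonBellTrials] at h
  | .T, _ :: _ :: _, h => simp [Gate.nonBellTrials] at h
  | .CNOT, _ :: _, h => simp [Gate.nonBellTrials] at h

theorem gate_unitary (g : Gate) : g.op * g.opᴴ = 1 := by
  match g with
  | .H => exact isClifford_H.1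
  | .T =>
    change op1 matT * (op1 matT)ᴴ = 1
    rw [op1_conjTranspose, op1_mul, matT_unitary, op1_one]
  | .CNOT =>
    rw [CNOT_op]
    exact CNOT_unitary

theorem trialGate_unitary {n : ℕ} {U : QOp n} (hU : U * Uᴴ = 1)
    (errors : List (Fin n → Fin 4)) : trialGate U errors * (trialGate U errors)ᴴ = 1 := by
  induction errors generalizing U with
  | nil => exact hU
  | cons e l ih =>
    refine ih ?_
    have hU' : Uᴴ * U = 1 := mul_eq_one_comm.mp hU
    rw [Matrix.conjTranspose_mul, Matrix.conjTranspose_mul, Matrix.conjTranspose_conjTranspose,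
      pauliString_conjTranspose]
    calc U * pauliString e * Uᴴ * (U * (pauliString e * Uᴴ))
        = U * pauliString e * (Uᴴ * U) * (pauliString e * Uᴴ) := by simp only [mul_assoc]
      _ = U * (pauliString e * pauliString e) * Uᴴ := by
          rw [hU', mul_one]
          simp only [mul_assoc]
      _ = 1 := by rw [pauliString_mul_self, mul_one, hU]

/-! ### Sequences of operations of a protocol -/

/-- Prepare `k` qubits. -/
def prepareMany {S : Set QMeas} {n N : ℕ} : (k : ℕ) → Protocol S n (N + k) → Protocol S n N
  | 0, p => p
  | k + 1, p => prepareMany k (.prepare p)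

/-- The state `φ ⊗ |0⟩^{⊗ k}`. -/
def adjoinZeros {N : ℕ} (k : ℕ) (φ : QState N) : QState (N + k) := fun x =>
  if (fun i => x (Fin.natAdd N i)) = 0 then φ (fun i => x (Fin.castAdd k i)) else 0

theorem adjoinZeros_zero {N : ℕ} (φ : QState N) : adjoinZeros 0 φ = φ := by
  funext x
  rw [adjoinZeros, if_pos (Subsingleton.elim _ _)]
  rfl

theorem adjoinZero_adjoinZeros {N : ℕ} (k : ℕ) (φ : QState N) :
    adjoinZero (adjoinZeros k φ) = adjoinZeros (k + 1) φ := by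
  funext x
  have h : (fun i => x (Fin.natAdd N i)) = (0 : Bits (k + 1)) ↔
      x (Fin.last (N + k)) = 0 ∧ (fun i : Fin k => x (Fin.natAdd N i).castSucc) = 0 := by
    simp only [funext_iff, Fin.forall_fin_succ']
    exact and_comm
  simp only [adjoinZero, adjoinZeros, h, ite_and]
  rfl

theorem prepareMany_steps {S : Set QMeas} {n N : ℕ} (k : ℕ) (p : Protocol S n (N + k)) :
    (prepareMany k p).steps = p.steps + k := by
  induction k with
  | zero => rfl
  | succ k ih =>
    rw [prepareMany, ih, Protocol.steps]
    ring

theorem prepareMany_failureProb {S : Set QMeas} {n N : ℕ} (k : ℕ) (p : Protocol S n (N + k))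
    (φ : QState N) : (prepareMany k p).failureProb φ = p.failureProb (adjoinZeros k φ) := by
  induction k with
  | zero => rw [adjoinZeros_zero]; rfl
  | succ k ih => rw [prepareMany, ih, Protocol.failureProb, adjoinZero_adjoinZeros]

theorem prepareMany_outputs {S : Set QMeas} {n N : ℕ} (k : ℕ) (p : Protocol S n (N + k))
    (θ : QState n) (φ : QState N) :
    (prepareMany k p).Outputs θ φ ↔ p.Outputs θ (adjoinZeros k φ) := by
  induction k with
  | zero => rw [adjoinZeros_zero]; rfl
  | succ k ih => rw [prepareMany, ih, Protocol.Outputs, adjoinZero_adjoinZeros]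

theorem exists_measureMany {S : Set QMeas} {n N k s : ℕ} (L : Fin k → PlacedMeas N)
    (hL : ∀ i, (L i).1 ∈ S) (f : Bits k → Protocol S n N) (hf : ∀ b, (f b).steps ≤ s) :
    ∃ p : Protocol S n N, p.steps ≤ k + s ∧
      (∀ φ, p.failureProb φ = ∑ b, (f b).failureProb
        ((List.ofFn fun i => (L i).proj (b i)).prod *ᵥ φ)) ∧
      ∀ θ φ, (∀ b, (f b).Outputs θ ((List.ofFn fun i => (L i).proj (b i)).prod *ᵥ φ)) →
        p.Outputs θ φ := by
  induction k generalizing s with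
  | zero =>
    refine ⟨f 0, by simpa using hf 0, fun φ => ?_, fun θ φ h => ?_⟩
    · rw [Fintype.sum_eq_single 0 fun b hb => absurd (Subsingleton.elim b 0) hb]
      simp
    · simpa using h 0
  | succ k ih =>
    -- The leftmost factor of the product acts last, so the measurement `L 0` is put into the
    -- continuations.
    obtain ⟨p, hs, hp, ho⟩ := ih (s := s + 1) (fun i => L i.succ) (fun i => hL i.succ)
      (fun b => .measure (L 0).1 (hL 0) (L 0).2 fun c => f (Fin.cons c b))
      (fun b => by
        rw [Protocol.steps]
        exact Nat.succ_le_succ (max_le (hf _) (hf _)))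
    refine ⟨p, by omega, fun φ => ?_, fun θ φ h => ho θ φ fun b c => ?_⟩
    · rw [hp, ← (Fin.consEquiv fun _ => Fin 2).sum_comp, Fintype.sum_prod_type_right]
      refine Finset.sum_congr rfl fun b _ => Finset.sum_congr rfl fun c _ => ?_
      simp only [List.ofFn_succ, List.prod_cons, ← Matrix.mulVec_mulVec, Fin.consEquiv_apply,
        Fin.cons_zero, Fin.cons_succ]
      rfl
    · have := h (Fin.cons c b)
      simp only [List.ofFn_succ, List.prod_cons, ← Matrix.mulVec_mulVec,
        Fin.cons_zero, Fin.cons_succ] at this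
      exact this

theorem exists_measureBasis {S : Set QMeas} {n N a s : ℕ} {U : QOp a}
    (hU : BasisMeasuredBy {p | p.1 ∈ S} U) (e : Fin (a + a) ↪ Fin N)
    (f : (Fin a → Fin 4) → Protocol S n N) (hf : ∀ j, (f j).steps ≤ s) :
    ∃ p : Protocol S n N, p.steps ≤ (a + a) + s ∧
      (∀ φ, p.failureProb φ = ∑ j, (f j).failureProb
        (embed e (Matrix.vecMulVec (basisState U j) (star (basisState U j))) *ᵥ φ)) ∧
      ∀ θ φ, (∀ j, (f j).Outputs θ
        (embed e (Matrix.vecMulVec (basisState U j) (star (basisState U j))) *ᵥ φ)) →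
        p.Outputs θ φ := by
  obtain ⟨L, hL, -, r, hr⟩ := hU
  have key : ∀ b : Bits (a + a), (List.ofFn fun i =>
      PlacedMeas.proj ⟨(L i).1, (L i).2.trans e⟩ (b i)).prod =
      embed e (Matrix.vecMulVec (basisState U (r b)) (star (basisState U (r b)))) := by
    intro b
    rw [← hr, embed_list_prod, List.map_ofFn]
    congr 2
    funext i
    exact embed_trans _ _ _
  obtain ⟨p, hs, hp, ho⟩ := exists_measureMany (S := S) (fun i => ⟨(L i).1, (L i).2.trans e⟩) hL
    (fun b => f (r b)) fun b => hf _
  refine ⟨p, hs, fun φ => ?_, fun θ φ h => ho θ φ fun b => ?_⟩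
  · rw [hp, ← r.sum_comp]
    simp only [key]
  · rw [key]
    exact h _

/-! ### A trial of Nielsen's scheme -/

/-- The logical qubits `e` and the first half of the new qubits. -/
def bellPlacement {a N : ℕ} (e : Fin a ↪ Fin N) : Fin (a + a) ↪ Fin (N + (a + a)) where
  toFun := Fin.append (fun i => Fin.castAdd (a + a) (e i))
    (fun i => Fin.natAdd N (Fin.castAdd a i))
  inj' := by
    intro x y
    refine Fin.addCases (fun i => ?_) (fun i => ?_) x <;>
      refine Fin.addCases (fun l => ?_) (fun l => ?_) y <;>
      intro h <;> simp only [Fin.append_left, Fin.append_right] at h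
    · rw [e.injective (Fin.castAdd_injective _ _ h)]
    · simp [Fin.ext_iff] at h
      omega
    · simp [Fin.ext_iff] at h
      omega
    · rw [Fin.castAdd_injective _ _ (Fin.natAdd_injective _ _ h)]

theorem bellPlacement_apply {a N : ℕ} (e : Fin a ↪ Fin N) (i : Fin (a + a)) :
    bellPlacement e i = Fin.append (fun i => Fin.castAdd (a + a) (e i))
      (fun i => Fin.natAdd N (Fin.castAdd a i)) i := rfl

@[simp] theorem bellPlacement_left {a N : ℕ} (e : Fin a ↪ Fin N) (i : Fin a) :
    bellPlacement e (Fin.castAdd a i) = Fin.castAdd (a + a) (e i) := by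
  rw [bellPlacement_apply, Fin.append_left]

@[simp] theorem bellPlacement_right {a N : ℕ} (e : Fin a ↪ Fin N) (i : Fin a) :
    bellPlacement e (Fin.natAdd a i) = Fin.natAdd N (Fin.castAdd a i) := by
  rw [bellPlacement_apply, Fin.append_right]

/-- The logical register after a trial: the qubits `q` have been moved to the second half of the
new qubits. -/
def moved {a n N : ℕ} (q : Fin a ↪ Fin n) (out : Fin n ↪ Fin N) :
    Fin n ↪ Fin (N + (a + a)) where
  toFun := Function.extend q (fun i => Fin.natAdd N (Fin.natAdd a i))
    (fun i => Fin.castAdd (a + a) (out i))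
  inj' := by
    intro x y
    by_cases hx : ∃ i, q i = x <;> by_cases hy : ∃ i, q i = y
    · obtain ⟨i, rfl⟩ := hx
      obtain ⟨l, rfl⟩ := hy
      simp only [q.injective.extend_apply]
      intro h
      rw [Fin.natAdd_injective _ _ (Fin.natAdd_injective _ _ h)]
    · obtain ⟨i, rfl⟩ := hx
      simp only [q.injective.extend_apply, Function.extend_apply' _ _ _ hy]
      intro h
      simp [Fin.ext_iff] at h
      omega
    · obtain ⟨i, rfl⟩ := hy
      simp only [q.injective.extend_apply, Function.extend_apply' _ _ _ hx]
      intro h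
      simp [Fin.ext_iff] at h
      omega
    · simp only [Function.extend_apply' _ _ _ hx, Function.extend_apply' _ _ _ hy]
      intro h
      exact out.injective (Fin.castAdd_injective _ _ h)

theorem moved_def {a n N : ℕ} (q : Fin a ↪ Fin n) (out : Fin n ↪ Fin N) (k : Fin n) :
    moved q out k = Function.extend q (fun i => Fin.natAdd N (Fin.natAdd a i))
      (fun i => Fin.castAdd (a + a) (out i)) k := rfl

theorem moved_apply {a n N : ℕ} (q : Fin a ↪ Fin n) (out : Fin n ↪ Fin N) (i : Fin a) :
    moved q out (q i) = Fin.natAdd N (Fin.natAdd a i) := by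
  rw [moved_def, q.injective.extend_apply]

theorem moved_apply' {a n N : ℕ} (q : Fin a ↪ Fin n) (out : Fin n ↪ Fin N) {k : Fin n}
    (hk : ¬∃ i, q i = k) : moved q out k = Fin.castAdd (a + a) (out k) := by
  rw [moved_def, Function.extend_apply' _ _ _ hk]

/-- The basis state with the contents of the second half of the new qubits moved to `e`. -/
def pullBack {a N : ℕ} (e : Fin a ↪ Fin N) (x : Bits (N + (a + a))) : Bits N :=
  Function.extend e (fun i => x (Fin.natAdd N (Fin.natAdd a i)))
    (fun i => x (Fin.castAdd (a + a) i))

/-- The (unnormalized) state after a trial for `U` with outcomes `j` of the measurement in the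
basis `|U_j⟩` and `k` of the Bell measurement. -/
def branch {a N : ℕ} (e : Fin a ↪ Fin N) (U : QOp a) (j k : Fin a → Fin 4) (φ : QState N) :
    QState (N + (a + a)) :=
  embed (bellPlacement e)
    (Matrix.vecMulVec (basisState (1 : QOp a) k) (star (basisState (1 : QOp a) k))) *ᵥ
    (embed (Fin.natAddEmb N) (Matrix.vecMulVec (basisState U j) (star (basisState U j))) *ᵥ
      adjoinZeros (a + a) φ)

/-- The fresh qubits hold `|0…0⟩`: projecting them onto `u` contributes the amplitude `⟨u|0…0⟩` and
leaves the old qubits alone. In this way a measurement prepares the entangled state for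
teleportation. -/
theorem embed_vecMulVec_adjoinZeros {N m : ℕ} (u : QState m) (φ : QState N)
    (x : Bits (N + m)) :
    (embed (Fin.natAddEmb N) (Matrix.vecMulVec u (star u)) *ᵥ adjoinZeros m φ) x =
      star (u 0) * u (fun i => x (Fin.natAdd N i)) * φ (fun i => x (Fin.castAdd m i)) := by
  rw [embed_mulVec, Finset.sum_eq_single 0]
  · simp only [extend_natAdd, adjoinZeros, Fin.append_left, Fin.append_right]
    rw [if_pos trivial, Matrix.vecMulVec_apply, Pi.star_apply, mul_comm (u _)]
    rfl
  · intro s _ hs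
    simp only [extend_natAdd, adjoinZeros, Fin.append_left, Fin.append_right]
    rw [if_neg hs, mul_zero]
  · simp

theorem extend_bellPlacement_castAdd {a N : ℕ} (e : Fin a ↪ Fin N) (s₁ s₂ : Bits a)
    (x : Bits (N + (a + a))) :
    (fun i => Function.extend (bellPlacement e) (Fin.append s₁ s₂) x (Fin.castAdd (a + a) i)) =
      Function.extend e s₁ (fun i => x (Fin.castAdd (a + a) i)) := by
  funext i
  by_cases hi : ∃ l, e l = i
  · obtain ⟨l, rfl⟩ := hi
    rw [e.injective.extend_apply, ← bellPlacement_left,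
      (bellPlacement e).injective.extend_apply, Fin.append_left]
  · rw [Function.extend_apply' _ _ _ hi, Function.extend_apply']
    rintro ⟨l, hl⟩
    revert hl
    refine Fin.addCases (fun l hl => ?_) (fun l hl => ?_) l
    · rw [bellPlacement_left] at hl
      exact hi ⟨l, Fin.castAdd_injective _ _ hl⟩
    · rw [bellPlacement_right] at hl
      simp [Fin.ext_iff] at hl
      omega

theorem extend_bellPlacement_natAdd {a N : ℕ} (e : Fin a ↪ Fin N) (s₁ s₂ : Bits a)
    (x : Bits (N + (a + a))) :
    (fun i => Function.extend (bellPlacement e) (Fin.append s₁ s₂) x (Fin.natAdd N i)) =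
      Fin.append s₂ (fun i => x (Fin.natAdd N (Fin.natAdd a i))) := by
  funext i
  refine Fin.addCases (fun l => ?_) (fun l => ?_) i
  · rw [Fin.append_left, ← bellPlacement_right e, (bellPlacement e).injective.extend_apply,
      Fin.append_right]
  · rw [Fin.append_right, Function.extend_apply']
    rintro ⟨l', hl⟩
    revert hl
    refine Fin.addCases (fun l' hl => ?_) (fun l' hl => ?_) l'
    · rw [bellPlacement_left] at hl
      simp [Fin.ext_iff] at hl
      omega
    · rw [bellPlacement_right] at hl
      simp [Fin.ext_iff] at hl
      omega

/-- Teleportation through the state `|U_j⟩` with the outcome `k` of the Bell measurement. -/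
theorem branch_apply {a N : ℕ} (e : Fin a ↪ Fin N) (U : QOp a) (j k : Fin a → Fin 4)
    (φ : QState N) (x : Bits (N + (a + a))) :
    branch e U j k φ x = basisState (1 : QOp a) k (fun i => x (bellPlacement e i)) *
      (star (basisState U j 0) * (1 / 2) ^ a) *
      (embed e (U * (pauliString j * (pauliString k)ᵀ)) *ᵥ φ) (pullBack e x) := by
  have hk : ∀ s t : Bits a, star (pauliString k s t) = (pauliString k)ᵀ s t := by
    intro s t
    rw [Matrix.transpose_apply, ← Matrix.conjTranspose_apply, pauliString_conjTranspose]
  -- The sum over the Bell-measured qubits splits into `s₁`, the input of the logical qubits, and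
  -- `s₂`, the first half of `|U_j⟩`. The index `s₂` is the one contracted in the product of `Uσ_j`
  -- with `σ_kᵀ`; the two normalizations give `(1/2)^a`.
  rw [branch, embed_mulVec, ← (Fin.appendEquiv a a).sum_comp, Fintype.sum_prod_type,
    embed_mulVec, Finset.mul_sum]
  refine Finset.sum_congr rfl fun s₁ _ => ?_
  have h : Function.extend e s₁ (pullBack e x) =
      Function.extend e s₁ (fun i => x (Fin.castAdd (a + a) i)) := extend_extend _ _ _ _
  rw [h, ← mul_assoc U, Matrix.mul_apply, Finset.sum_mul, Finset.mul_sum]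
  refine Finset.sum_congr rfl fun s₂ _ => ?_
  rw [embed_vecMulVec_adjoinZeros]
  simp only [Fin.appendEquiv, Equiv.coe_fn_mk, extend_bellPlacement_castAdd,
    extend_bellPlacement_natAdd, Matrix.vecMulVec_apply, Pi.star_apply]
  rw [basisState_eq 1 k, one_mul, vecOf_apply _ (Fin.append s₁ s₂), basisState_eq U j,
    vecOf_apply _ (Fin.append s₂ _)]
  simp only [Fin.append_left, Fin.append_right, star_mul', hk, ← inv_sqrt_two_pow_sq,
    RCLike.star_def, Complex.conj_ofReal, pullBack, e.injective.extend_apply]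
  ring

/-! ### The state of the logical register -/

/-- The qubits `out` are in the state `θ`, in a product with the other qubits. -/
def IsProd {n N : ℕ} (out : Fin n ↪ Fin N) (θ : QState n) (φ : QState N) : Prop :=
  ∃ χ : QState N, (∀ x y, (∀ k ∉ Set.range out, x k = y k) → χ x = χ y) ∧
    ∀ x, φ x = θ (fun i => x (out i)) * χ x

theorem isProd_refl {n : ℕ} (ψ : QState n) : IsProd (Function.Embedding.refl _) ψ ψ :=
  ⟨1, fun _ _ _ => rfl, fun _ => (mul_one _).symm⟩

theorem IsProd.outputs {S : Set QMeas} {n N : ℕ} {out : Fin n ↪ Fin N} {θ : QState n}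
    {φ : QState N} (h : IsProd out θ φ) : (Protocol.output out : Protocol S n N).Outputs θ φ := by
  classical
  obtain ⟨χ, hχ, hφ⟩ := h
  refine ⟨fun r => χ fun k => if hk : k ∉ Set.range out then r ⟨k, hk⟩ else 0, fun x => ?_⟩
  rw [hφ]
  congr 1
  refine hχ _ _ fun k hk => ?_
  rw [dif_pos hk]

/-- The scalar is absorbed by the other qubits, so phases of the logical state can be dropped. -/
theorem IsProd.of_smul {n N : ℕ} {out : Fin n ↪ Fin N} {θ : QState n} {φ : QState N} {z : ℂ}
    (h : IsProd out (z • θ) φ) : IsProd out θ φ := by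
  obtain ⟨χ, hχ, hφ⟩ := h
  refine ⟨z • χ, fun x y hxy => ?_, fun x => ?_⟩
  · rw [Pi.smul_apply, Pi.smul_apply, hχ x y hxy]
  · rw [hφ, Pi.smul_apply, Pi.smul_apply, smul_eq_mul, smul_eq_mul]
    ring

theorem IsProd.embed {n N : ℕ} {out : Fin n ↪ Fin N} {θ : QState n} {φ : QState N}
    (h : IsProd out θ φ) (B : QOp n) : IsProd out (B *ᵥ θ) (embed out B *ᵥ φ) := by
  obtain ⟨χ, hχ, hφ⟩ := h
  refine ⟨χ, hχ, fun x => ?_⟩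
  rw [embed_mulVec, Matrix.mulVec, dotProduct, Finset.sum_mul]
  refine Finset.sum_congr rfl fun s _ => ?_
  rw [hφ, hχ (Function.extend out s x) x fun k hk =>
    Function.extend_apply' _ _ _ (by simpa using hk)]
  simp only [out.injective.extend_apply]
  ring

theorem IsProd.branch {a n N : ℕ} {q : Fin a ↪ Fin n} {out : Fin n ↪ Fin N} {θ : QState n}
    {φ : QState N} (h : IsProd out θ φ) (U : QOp a) (j k : Fin a → Fin 4) :
    IsProd (moved q out) (MeasQC.embed q (U * (pauliString j * (pauliString k)ᵀ)) *ᵥ θ)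
      (branch (q.trans out) U j k φ) := by
  obtain ⟨χ, hχ, hφ⟩ := h.embed (MeasQC.embed q (U * (pauliString j * (pauliString k)ᵀ)))
  -- By `branch_apply`, the other qubits now comprise the consumed ones, in the Bell state `k`, and
  -- the former environment, with the amplitude of the outcomes as a factor.
  refine ⟨fun x => basisState (1 : QOp a) k (fun i => x (bellPlacement (q.trans out) i)) *
    (star (basisState U j 0) * (1 / 2) ^ a) * χ (pullBack (q.trans out) x),
    fun x y hxy => ?_, fun x => ?_⟩
  · have hb : (fun i => x (bellPlacement (q.trans out) i)) =
        fun i => y (bellPlacement (q.trans out) i) := by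
      funext i
      refine hxy _ ?_
      rintro ⟨l, hl⟩
      by_cases hq : ∃ i, q i = l
      · obtain ⟨l, rfl⟩ := hq
        rw [moved_apply] at hl
        revert hl
        refine Fin.addCases (fun i hl => ?_) (fun i hl => ?_) i
        · rw [bellPlacement_left] at hl
          simp [Fin.ext_iff] at hl
          omega
        · rw [bellPlacement_right] at hl
          simp [Fin.ext_iff] at hl
          omega
      · rw [moved_apply' _ _ hq] at hl
        revert hl
        refine Fin.addCases (fun i hl => ?_) (fun i hl => ?_) i
        · rw [bellPlacement_left] at hl
          exact hq ⟨i, (out.injective (Fin.castAdd_injective _ _ hl)).symm⟩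
        · rw [bellPlacement_right] at hl
          simp [Fin.ext_iff] at hl
          omega
    simp only [hb]
    congr 1
    refine hχ _ _ fun k hk => ?_
    have hk' : ¬∃ i, (q.trans out) i = k := by
      rintro ⟨i, hi⟩
      exact hk ⟨q i, hi⟩
    rw [pullBack, pullBack, Function.extend_apply' _ _ _ hk', Function.extend_apply' _ _ _ hk']
    refine hxy _ ?_
    rintro ⟨l, hl⟩
    by_cases hq : ∃ i, q i = l
    · obtain ⟨l, rfl⟩ := hq
      rw [moved_apply] at hl
      simp [Fin.ext_iff] at hl
      omega
    · rw [moved_apply' _ _ hq] at hl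
      exact hk ⟨l, Fin.castAdd_injective _ _ hl⟩
  · have hx : (fun i => pullBack (q.trans out) x (out i)) = fun i => x (moved q out i) := by
      funext i
      by_cases hq : ∃ l, q l = i
      · obtain ⟨l, rfl⟩ := hq
        rw [moved_apply]
        exact (q.trans out).injective.extend_apply _ _ l
      · rw [moved_apply' _ _ hq, pullBack, Function.extend_apply']
        rintro ⟨l, hl⟩
        exact hq ⟨l, out.injective hl⟩
    rw [branch_apply, embed_trans, hφ, hx]
    ring

theorem normSq_vecOf_pauliString {a : ℕ} (k : Fin a → Fin 4) :
    normSq (vecOf (pauliString k)) = 1 := by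
  have h : (normSq (vecOf (pauliString k)) : ℂ) = 1 := by
    have ht : ((pauliString k)ᴴ * pauliString k).trace = 2 ^ a := by
      rw [pauliString_conjTranspose, pauliString_mul_self, Matrix.trace_one]
      simp
    rw [normSq_eq_dotProduct, dotProduct, ← (Fin.appendEquiv a a).sum_comp,
      Fintype.sum_prod_type]
    simp only [Fin.appendEquiv, Equiv.coe_fn_mk, Pi.star_apply, vecOf_apply, Fin.append_left,
      Fin.append_right, star_mul', RCLike.star_def, Complex.conj_ofReal]
    have h2 : ((2 : ℂ) ^ a) * (1 / 2) ^ a = 1 := by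
      rw [← mul_pow]
      norm_num
    rw [← h2, ← ht, Matrix.trace, Finset.sum_mul]
    refine Finset.sum_congr rfl fun s _ => ?_
    rw [Matrix.diag_apply, Matrix.mul_apply, Finset.sum_mul]
    refine Finset.sum_congr rfl fun t _ => ?_
    rw [Matrix.conjTranspose_apply, ← inv_sqrt_two_pow_sq, RCLike.star_def]
    ring
  exact_mod_cast h

/-- Each qubit is either consumed by the Bell measurement or part of the pulled-back register, so
sums over the large register factor. -/
theorem bijective_bell_pullBack {a N : ℕ} (e : Fin a ↪ Fin N) :
    Function.Bijective fun x : Bits (N + (a + a)) =>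
      ((fun i => x (bellPlacement e i), pullBack e x) : Bits (a + a) × Bits N) := by
  rw [Fintype.bijective_iff_injective_and_card]
  constructor
  · intro x y h
    have h₁ := fun i => congrFun (congrArg Prod.fst h) i
    have h₂ := fun i => congrFun (congrArg Prod.snd h) i
    simp only [pullBack] at h₁ h₂
    funext k
    refine Fin.addCases (fun i => ?_) (fun i => Fin.addCases (fun i => ?_) (fun i => ?_) i) k
    · by_cases hi : ∃ l, e l = i
      · obtain ⟨l, rfl⟩ := hi
        simpa only [bellPlacement_left] using h₁ (Fin.castAdd a l)
      · simpa only [Function.extend_apply' _ _ _ hi] using h₂ i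
    · simpa only [bellPlacement_right] using h₁ (Fin.natAdd a i)
    · simpa only [e.injective.extend_apply] using h₂ (e i)
  · simp only [Fintype.card_prod, Fintype.card_fun, Fintype.card_fin]
    ring

/-- The operator applied by teleportation is unitary, so the weight of a branch depends on `φ` only
through its norm: `j` occurs with probability `|⟨U_j|0⟩|²`, and `k` is uniform among `4^a` outcomes.
-/
theorem normSq_branch {a N : ℕ} (e : Fin a ↪ Fin N) {U : QOp a} (hU : U * Uᴴ = 1)
    (j k : Fin a → Fin 4) (φ : QState N) :
    normSq (branch e U j k φ) = ‖basisState U j 0‖ ^ 2 * (1 / 4) ^ a * normSq φ := by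
  have hM : (embed e (U * (pauliString j * (pauliString k)ᵀ)))ᴴ *
      embed e (U * (pauliString j * (pauliString k)ᵀ)) = 1 := by
    have h₁ : Uᴴ * U = 1 := mul_eq_one_comm.mp hU
    have h₂ : ((pauliString k)ᵀ)ᴴ * (pauliString k)ᵀ = 1 := by
      have hh : (pauliString k).IsHermitian := pauliString_conjTranspose k
      rw [hh.transpose.eq, ← Matrix.transpose_mul, pauliString_mul_self, Matrix.transpose_one]
    rw [← embed_conjTranspose, ← embed_mul, ← embed_one e]
    congr 1
    rw [Matrix.conjTranspose_mul, Matrix.conjTranspose_mul, pauliString_conjTranspose]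
    calc ((pauliString k)ᵀ)ᴴ * pauliString j * Uᴴ * (U * (pauliString j * (pauliString k)ᵀ))
        = ((pauliString k)ᵀ)ᴴ * pauliString j * (Uᴴ * U) *
          (pauliString j * (pauliString k)ᵀ) := by simp only [mul_assoc]
      _ = ((pauliString k)ᵀ)ᴴ * (pauliString j * pauliString j) * (pauliString k)ᵀ := by
          rw [h₁, mul_one]
          simp only [mul_assoc]
      _ = 1 := by rw [pauliString_mul_self, mul_one, h₂]
  have hb : normSq (basisState (1 : QOp a) k) = 1 := by
    rw [basisState_eq, one_mul, normSq_vecOf_pauliString]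
  rw [← normSq_mulVec hM φ]
  refine Eq.trans ?_ (one_mul _)
  nth_rw 1 [← hb]
  simp only [normSq, branch_apply]
  rw [mul_left_comm, Finset.sum_mul_sum, Finset.mul_sum]
  simp only [Finset.mul_sum]
  rw [← Fintype.sum_prod_type', ← (bijective_bell_pullBack e).sum_comp]
  refine Finset.sum_congr rfl fun x _ => ?_
  have h4 : ((1 / 4 : ℝ)) ^ a = ((1 / 2) ^ a) ^ 2 := by
    rw [← pow_mul, mul_comm, pow_mul]
    norm_num
  have h2 : ‖(1 / 2 : ℂ)‖ = 1 / 2 := by norm_num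
  simp only [norm_mul, norm_star, norm_pow, h4, h2]
  ring

theorem sum_norm_sq_basisState {a : ℕ} {U : QOp a} (hU : U * Uᴴ = 1) :
    ∑ j, ‖basisState U j 0‖ ^ 2 = 1 := by
  have h := congrFun (congrFun (sum_vecMulVec_basisState hU) 0) 0
  rw [Matrix.sum_apply, Matrix.one_apply_eq] at h
  simp only [Matrix.vecMulVec_apply, Pi.star_apply, RCLike.star_def, Complex.mul_conj'] at h
  exact_mod_cast h

/-- Transposition only changes the sign of `σ₂`, so the error of a trial is `σ_jσ_k` up to a scalar,
and `j = k` means success. -/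
theorem exists_pauli_transpose {a : ℕ} (j k : Fin a → Fin 4) :
    ∃ (e : Fin a → Fin 4) (z : ℂ), pauliString j * (pauliString k)ᵀ = z • pauliString e ∧
      (j = k → pauliString e = 1) := by
  have ht : ∀ v : Fin 4, ∃ z : ℂ, ‖z‖ = 1 ∧ (pauli v)ᵀ = z • pauli v := by
    intro v
    refine ⟨![1, 1, -1, 1] v, ?_, ?_⟩
    · fin_cases v <;> simp
    · ext r s
      fin_cases v <;> fin_cases r <;> fin_cases s <;> simp [pauli]
  choose z hz h using ht
  have hk : (pauliString k)ᵀ = (∏ i, z (k i)) • pauliString k := by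
    rw [pauliString, tensor_transpose, ← tensor_smul]
    congr 1
    funext i
    exact h _
  rw [hk, Matrix.mul_smul]
  by_cases hjk : j = k
  · subst hjk
    refine ⟨fun _ => 0, ∏ i, z (j i), ?_, fun _ => ?_⟩
    · rw [pauliString_mul_self]
      congr 1
      exact tensor_one.symm
    · exact tensor_one
  · obtain ⟨e, c, -, he⟩ := (isPauli_pauliString j).mul (isPauli_pauliString k)
    exact ⟨e, (∏ i, z (k i)) * c, by rw [he, smul_smul], fun h => absurd h hjk⟩

/-- The `6a` operations are `2a` preparations, `2a` measurements for the basis `|U_j⟩` and `2a` Bell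
measurements. -/
theorem exists_trial {n a N s : ℕ} {U : QOp a}
    (hU : BasisMeasuredBy {p | p.1 ∈ universalSet} U) (e : Fin a ↪ Fin N)
    (K : (Fin a → Fin 4) → (Fin a → Fin 4) → Protocol universalSet n (N + (a + a)))
    (hK : ∀ j k, (K j k).steps ≤ s) :
    ∃ p : Protocol universalSet n N, p.steps ≤ 6 * a + s ∧
      (∀ φ, p.failureProb φ = ∑ j, ∑ k, (K j k).failureProb (branch e U j k φ)) ∧
      ∀ θ φ, (∀ j k, (K j k).Outputs θ (branch e U j k φ)) → p.Outputs θ φ := by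
  choose p hs hp ho using fun j => exists_measureBasis (isPauli_one.basisMeasuredBy.mono
    (bellMeas_subset a)) (bellPlacement e) (K j) (hK j)
  obtain ⟨p', hs', hp', ho'⟩ := exists_measureBasis hU (Fin.natAddEmb N) p hs
  refine ⟨prepareMany (a + a) p', ?_, fun φ => ?_, fun θ φ h => ?_⟩
  · rw [prepareMany_steps]
    omega
  · rw [prepareMany_failureProb, hp']
    simp only [hp]
    rfl
  · rw [prepareMany_outputs]
    exact ho' _ _ fun j => ho j _ _ fun k => h j k

/-! ### Simulation of circuits -/

/-- The operator `W` is simulated, with at most `s` operations, on any part of any register. -/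
def Realizes {n : ℕ} (s : ℕ) (δ : ℝ) (W : QOp n) : Prop :=
  ∀ (N : ℕ) (out : Fin n ↪ Fin N), ∃ p : Protocol universalSet n N, p.steps ≤ s ∧
    ∀ θ φ, IsProd out θ φ → p.Outputs (W *ᵥ θ) φ ∧ p.failureProb φ ≤ δ * normSq φ

theorem realizes_one {n : ℕ} : Realizes 0 0 (1 : QOp n) := fun N out =>
  ⟨.output out, le_rfl, fun θ φ h => by
    rw [Matrix.one_mulVec, zero_mul]
    exact ⟨h.outputs, le_rfl⟩⟩

/-- Induction on the number of trials left, for all error histories at once because a failure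
changes the gate to be simulated. Each trial succeeds with probability `4^(-a)` whatever the state;
`δ` bounds the failures in the rest of the circuit, reached after a success. -/
theorem Realizes.gate {n s : ℕ} {δ : ℝ} {W : QOp n} (hδ : 0 ≤ δ) (hW : Realizes s δ W) (g : Gate)
    (q : Fin g.arity ↪ Fin n) (t : ℕ) (errors : List (Fin g.arity → Fin 4)) :
    Realizes (6 * g.arity * t + s) ((1 - (1 / 4) ^ g.arity) ^ t + δ)
      (W * embed q (trialGate g.op errors)) := by
  induction t generalizing errors with
  | zero =>
    -- With no trial left, failure is certain, and the claimed bound is `1 + δ`.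
    refine fun N out => ⟨.failure, Nat.zero_le _, fun θ φ _ => ⟨trivial, ?_⟩⟩
    rw [Protocol.failureProb]
    nlinarith [normSq_nonneg φ]
  | succ t ih =>
    intro N out
    have hu := trialGate_unitary (gate_unitary g) errors
    set V := trialGate g.op errors with hV
    have hnext : ∀ e, trialGate g.op (errors ++ [e]) = V * pauliString e * Vᴴ := fun e => by
      simp [hV, trialGate, List.foldl_append]
    choose e z he heq using fun j k => exists_pauli_transpose (a := g.arity) j k
    obtain ⟨p₀, hs₀, h₀⟩ := hW _ (moved q out)
    choose p₁ hs₁ h₁ using fun l => ih (errors ++ [l]) _ (moved q out)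
    obtain ⟨p, hs, hp, ho⟩ := exists_trial (basisMeasuredBy_trialGate g errors) (q.trans out)
      (fun j k => if j = k then p₀ else p₁ (e j k)) (s := 6 * g.arity * t + s) (fun j k => by
        split_ifs
        · omega
        · exact hs₁ _)
    have hbr : ∀ θ φ, IsProd out θ φ → ∀ j k,
        IsProd (moved q out) (embed q (V * pauliString (e j k)) *ᵥ θ)
          (branch (q.trans out) V j k φ) := fun θ φ h j k => by
      have := h.branch (q := q) V j k
      rw [he, Matrix.mul_smul, embed_smul, Matrix.smul_mulVec] at this
      exact this.of_smul
    refine ⟨p, by rw [mul_add, mul_one]; omega, fun θ φ h => ⟨ho _ _ fun j k => ?_, ?_⟩⟩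
    · have hb := hbr θ φ h j k
      by_cases hjk : j = k
      · rw [if_pos hjk]
        rw [heq j k hjk, mul_one] at hb
        rw [← Matrix.mulVec_mulVec]
        exact (h₀ _ _ hb).1
      · rw [if_neg hjk]
        have := (h₁ (e j k) _ _ hb).1
        rw [hnext, Matrix.mulVec_mulVec, mul_assoc, ← embed_mul] at this
        -- The next gate `Vσ_eV†`, applied to what the failed trial left, gives `V`.
        have hVV : V * pauliString (e j k) * Vᴴ * (V * pauliString (e j k)) = V := by
          calc _ = V * pauliString (e j k) * (Vᴴ * V) * pauliString (e j k) := by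
                simp only [mul_assoc]
            _ = V := by
                rw [mul_eq_one_comm.mp hu, mul_one, mul_assoc, pauliString_mul_self, mul_one]
        rwa [hVV] at this
    · rw [hp]
      set D : ℝ := 1 - (1 / 4) ^ g.arity with hD
      -- A success costs only `δ` and a failure `D^t + δ`. The successes carry total weight `1 - D`,
      -- so the sum is `D^(t+1) + δ` times the norm.
      have hbound : ∀ j k, (if j = k then p₀ else p₁ (e j k)).failureProb
          (branch (q.trans out) V j k φ) ≤ (D ^ t + δ - if j = k then D ^ t else 0) *
            (‖basisState V j 0‖ ^ 2 * (1 / 4) ^ g.arity * normSq φ) := by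
        intro j k
        have hb := hbr θ φ h j k
        rw [← normSq_branch (q.trans out) hu j k]
        split_ifs
        · rw [add_sub_cancel_left]
          exact (h₀ _ _ hb).2
        · rw [sub_zero]
          exact (h₁ _ _ _ hb).2
      refine (Finset.sum_le_sum fun j _ => Finset.sum_le_sum fun k _ => hbound j k).trans
        (le_of_eq ?_)
      simp only [← Finset.sum_mul, Finset.sum_sub_distrib, Finset.sum_ite_eq, Finset.mem_univ,
        if_true, Finset.sum_const, Finset.card_univ, Fintype.card_fun, Fintype.card_fin]
      rw [← Finset.mul_sum, ← Finset.sum_mul, ← Finset.sum_mul, sum_norm_sq_basisState hu]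
      have h4 : (4 : ℝ) ^ g.arity * (1 / 4) ^ g.arity = 1 := by
        rw [← mul_pow]
        norm_num
      rw [pow_succ, nsmul_eq_mul]
      push_cast
      linear_combination (D ^ t + δ) * normSq φ * h4 - D ^ t * normSq φ * hD

theorem realizes_circuitOp {n : ℕ} (c : List (PlacedGate n)) (t : ℕ) :
    Realizes (c.map fun g => 6 * g.1.arity * t).sum
      (c.map fun g => (1 - (1 / 4 : ℝ) ^ g.1.arity) ^ t).sum (circuitOp c) := by
  induction c with
  | nil => exact realizes_one
  | cons g c ih =>
    have hδ : 0 ≤ (c.map fun g => (1 - (1 / 4 : ℝ) ^ g.1.arity) ^ t).sum := by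
      refine List.sum_nonneg fun x hx => ?_
      obtain ⟨g, -, rfl⟩ := List.mem_map.mp hx
      exact pow_nonneg (sub_nonneg.mpr (pow_le_one₀ (by norm_num) (by norm_num))) t
    exact ih.gate hδ g.1 g.2 t []

theorem exists_protocol_circuitOp {n : ℕ} (c : List (PlacedGate n)) (t : ℕ) :
    ∃ p : Protocol universalSet n n,
      p.steps ≤ (c.map fun g => 6 * g.1.arity * t).sum ∧
      p.Simulates (circuitOp c) (c.map fun g => (1 - (1 / 4 : ℝ) ^ g.1.arity) ^ t).sum := by
  obtain ⟨p, hs, h⟩ := realizes_circuitOp c t n (Function.Embedding.refl _)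
  refine ⟨p, hs, fun ψ hψ => ?_⟩
  have := h ψ ψ (isProd_refl ψ)
  rwa [hψ, mul_one] at this

/-! ### One-parameter groups in closed monoids of unitary operators -/

section CStar

variable {A : Type*} [CStarAlgebra A]

open NormedSpace (exp)

/-- The unitary operator `exp(i t a)`. -/
def expI (t : ℝ) (a : A) : A := exp (t • (Complex.I • a))

theorem expI_zero (a : A) : expI 0 a = 1 := by
  let _ : NormedAlgebra ℚ A := NormedAlgebra.restrictScalars ℚ ℂ A
  rw [expI, zero_smul, NormedSpace.exp_zero]

theorem expI_add (s t : ℝ) (a : A) : expI (s + t) a = expI s a * expI t a := by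
  let _ : NormedAlgebra ℚ A := NormedAlgebra.restrictScalars ℚ ℂ A
  rw [expI, add_smul, NormedSpace.exp_add_of_commute]
  · rfl
  · exact ((Commute.refl _).smul_left s).smul_right t

theorem expI_smul (t r : ℝ) (a : A) : expI t (r • a) = expI (t * r) a := by
  rw [expI, expI, smul_comm Complex.I r a, smul_smul]

theorem expI_nsmul (m : ℕ) (t : ℝ) (a : A) : expI (m * t) a = expI t a ^ m := by
  induction m with
  | zero => simp [expI_zero]
  | succ m ih => rw [Nat.cast_succ, add_mul, one_mul, expI_add, ih, pow_succ]

theorem expI_mem_unitary {a : A} (ha : IsSelfAdjoint a) (t : ℝ) : expI t a ∈ unitary A := by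
  let _ : NormedAlgebra ℚ A := NormedAlgebra.restrictScalars ℚ ℂ A
  refine NormedSpace.exp_mem_unitary_of_mem_skewAdjoint ?_
  have h : IsSelfAdjoint (t • a) := (IsSelfAdjoint.all t).smul ha
  rw [smul_comm]
  exact h.smul_mem_skewAdjoint Complex.conj_I

theorem norm_expI_le {a : A} (ha : IsSelfAdjoint a) (t : ℝ) : ‖expI t a‖ ≤ 1 := by
  nontriviality A
  exact (CStarRing.norm_of_mem_unitary (expI_mem_unitary ha t)).le

theorem continuous_expI (a : A) : Continuous fun t => expI t a := by
  let _ : NormedAlgebra ℚ A := NormedAlgebra.restrictScalars ℚ ℂ A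
  exact NormedSpace.exp_continuous.comp (continuous_id.smul continuous_const)

theorem hasDerivAt_expI (a : A) : HasDerivAt (fun t => expI t a) (Complex.I • a) 0 := by
  let _ : NormedAlgebra ℚ A := NormedAlgebra.restrictScalars ℚ ℂ A
  have := hasDerivAt_exp_smul_const (𝕂 := ℝ) (Complex.I • a) (0 : ℝ)
  rw [zero_smul, NormedSpace.exp_zero, one_mul] at this
  exact this

/-- Telescoping: for contractions, errors of the factors add up without growth. -/
theorem norm_pow_sub_pow_le {x y : A} (hx : ‖x‖ ≤ 1) (hy : ‖y‖ ≤ 1) (m : ℕ) :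
    ‖x ^ m - y ^ m‖ ≤ m * ‖x - y‖ := by
  induction m with
  | zero => simp
  | succ m ih =>
    nontriviality A
    have h : x ^ (m + 1) - y ^ (m + 1) = (x ^ m - y ^ m) * x + y ^ m * (x - y) := by
      rw [pow_succ, pow_succ]
      noncomm_ring
    rw [h]
    refine (norm_add_le _ _).trans ?_
    have h₁ : ‖(x ^ m - y ^ m) * x‖ ≤ m * ‖x - y‖ :=
      (norm_mul_le _ _).trans ((mul_le_of_le_one_right (norm_nonneg _) hx).trans ih)
    have h₂ : ‖y ^ m * (x - y)‖ ≤ ‖x - y‖ :=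
      (norm_mul_le _ _).trans (mul_le_of_le_one_left (norm_nonneg _)
        ((norm_pow_le _ _).trans (pow_le_one₀ (norm_nonneg _) hy)))
    push_cast
    linarith

/-- The Lie product formula. -/
theorem tendsto_expI_mul_expI_pow {a b : A} (ha : IsSelfAdjoint a) (hb : IsSelfAdjoint b) :
    Filter.Tendsto
      (fun m : ℕ => (expI (1 / ((m : ℝ) + 1)) a * expI (1 / ((m : ℝ) + 1)) b) ^ (m + 1))
      Filter.atTop (nhds (expI 1 (a + b))) := by
  -- The product of exponentials and the exponential of the sum agree to first order at 0. At `t =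
  -- 1/(m+1)` they differ by `o(1/m)`, which the power `m + 1` multiplies by at most `m + 1`.
  have hd : HasDerivAt (fun t => expI t a * expI t b - expI t (a + b)) 0 0 := by
    have h := ((hasDerivAt_expI a).mul (hasDerivAt_expI b)).sub (hasDerivAt_expI (a + b))
    rw [expI_zero, expI_zero, one_mul, mul_one, smul_add, sub_self] at h
    exact h
  have ht : Filter.Tendsto (fun m : ℕ => 1 / ((m : ℝ) + 1)) Filter.atTop
      (nhdsWithin 0 {0}ᶜ) :=
    tendsto_nhdsWithin_of_tendsto_nhds_of_eventually_within _
      tendsto_one_div_add_atTop_nhds_zero_nat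
      (Filter.Eventually.of_forall fun m => by
        have : (0 : ℝ) < 1 / ((m : ℝ) + 1) := by positivity
        exact this.ne')
  have h := ((hasDerivAt_iff_tendsto_slope_zero.mp hd).comp ht).norm
  rw [norm_zero] at h
  rw [tendsto_iff_norm_sub_tendsto_zero]
  refine squeeze_zero (fun _ => norm_nonneg _) (fun m => ?_) h
  have hpow : expI 1 (a + b) = expI (1 / ((m : ℝ) + 1)) (a + b) ^ (m + 1) := by
    rw [← expI_nsmul]
    congr 1
    push_cast
    field_simp
  have hx : ‖expI (1 / ((m : ℝ) + 1)) a * expI (1 / ((m : ℝ) + 1)) b‖ ≤ 1 :=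
    (norm_mul_le _ _).trans (mul_le_one₀ (norm_expI_le ha _) (norm_nonneg _) (norm_expI_le hb _))
  rw [hpow]
  refine (norm_pow_sub_pow_le hx (norm_expI_le (ha.add hb) _) (m + 1)).trans (le_of_eq ?_)
  simp only [Function.comp_apply, zero_add, expI_zero, one_mul, sub_self, sub_zero, norm_smul]
  rw [one_div, inv_inv, Real.norm_of_nonneg (by positivity)]
  push_cast
  rfl

/-- The selfadjoint elements that generate one-parameter groups in a closed monoid. -/
def generators (G : Submonoid A) (hG : IsClosed (G : Set A)) : Submodule ℝ A where
  carrier := {a | IsSelfAdjoint a ∧ ∀ t, expI t a ∈ G}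
  zero_mem' := ⟨IsSelfAdjoint.zero A, fun t => by
    have : expI t (0 : A) = 1 := by
      rw [← zero_smul ℝ (0 : A), expI_smul, mul_zero, expI_zero]
    rw [this]
    exact G.one_mem⟩
  -- Every approximant in the Lie product formula lies in `G`, and `G` is closed.
  add_mem' := by
    rintro a b ⟨ha, ha'⟩ ⟨hb, hb'⟩
    refine ⟨ha.add hb, fun t => ?_⟩
    have hta : IsSelfAdjoint (t • a) := (IsSelfAdjoint.all t).smul ha
    have htb : IsSelfAdjoint (t • b) := (IsSelfAdjoint.all t).smul hb
    rw [← one_mul t, ← expI_smul, smul_add]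
    refine hG.mem_of_tendsto (tendsto_expI_mul_expI_pow hta htb)
      (Filter.Eventually.of_forall fun m => ?_)
    rw [expI_smul, expI_smul]
    exact G.pow_mem (G.mul_mem (ha' _) (hb' _)) _
  smul_mem' := by
    rintro r a ⟨ha, ha'⟩
    refine ⟨(IsSelfAdjoint.all r).smul ha, fun t => ?_⟩
    rw [expI_smul]
    exact ha' _

theorem expI_conj {u : A} (hu : u ∈ unitary A) (t : ℝ) (a : A) :
    expI t (u * a * star u) = u * expI t a * star u := by
  let _ : NormedAlgebra ℚ A := NormedAlgebra.restrictScalars ℚ ℂ A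
  let y : Aˣ := ⟨u, star u, (Unitary.mem_iff.mp hu).2, (Unitary.mem_iff.mp hu).1⟩
  have h := NormedSpace.exp_units_conj y (t • (Complex.I • a))
  rw [expI, expI]
  refine Eq.trans ?_ h
  congr 1
  simp [y]

theorem conj_mem_generators {G : Submonoid A} {hG : IsClosed (G : Set A)} {a u : A}
    (hu : u ∈ unitary A) (hu' : u ∈ G) (hus : star u ∈ G) (ha : a ∈ generators G hG) :
    u * a * star u ∈ generators G hG := by
  refine ⟨ha.1.conjugate u, fun t => ?_⟩
  rw [expI_conj hu]
  exact G.mul_mem (G.mul_mem hu' (ha.2 t)) hus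

/-- The times `t` with `expI t a ∈ G` form a closed set containing the additive group generated by
`α` and the period `β`, which is dense since their ratio is irrational. Both signs of `α` are
required because `G` is only a monoid. -/
theorem mem_generators_of_irrational {G : Submonoid A} {hG : IsClosed (G : Set A)} {a : A}
    (ha : IsSelfAdjoint a) {α β : ℝ} (hα : expI α a ∈ G) (hα' : expI (-α) a ∈ G)
    (hβ : expI β a = 1) (h : Irrational (α / β)) : a ∈ generators G hG := by
  have hβ' : expI (-β) a = 1 := by
    have := expI_add (-β) β a
    rwa [neg_add_cancel, expI_zero, hβ, mul_one, eq_comm] at this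
  have hsub : ∀ t ∈ AddSubgroup.closure {α, β}, expI t a ∈ G ∧ expI (-t) a ∈ G := by
    intro t ht
    induction ht using AddSubgroup.closure_induction with
    | mem x hx =>
      rcases hx with rfl | rfl
      · exact ⟨hα, hα'⟩
      · rw [hβ, hβ']
        exact ⟨G.one_mem, G.one_mem⟩
    | zero =>
      rw [neg_zero, expI_zero]
      exact ⟨G.one_mem, G.one_mem⟩
    | add x y _ _ hx hy =>
      rw [neg_add, expI_add, expI_add]
      exact ⟨G.mul_mem hx.1 hy.1, G.mul_mem hx.2 hy.2⟩
    | neg x _ hx =>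
      rw [neg_neg]
      exact hx.symm
  refine ⟨ha, fun t => ?_⟩
  have hclosed : IsClosed ((fun t => expI t a) ⁻¹' (G : Set A)) := hG.preimage (continuous_expI a)
  exact hclosed.closure_subset_iff.mpr (fun s hs => (hsub s hs).1)
    ((dense_addSubgroupClosure_pair_iff.mpr h) t)

/-- Euler's formula by functional calculus: the spectrum lies in `{1, -1}`, where `exp(itz) = cos t
+ iz sin t`. -/
theorem expI_of_mul_self {a : A} (ha : IsSelfAdjoint a) (h : a * a = 1) (t : ℝ) :
    expI t a = (Real.cos t : ℂ) • (1 : A) + (Complex.I * Real.sin t) • a := by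
  nontriviality A
  have hn : IsStarNormal a := ha.isStarNormal
  have hI : t • (Complex.I • a) = ((t : ℂ) * Complex.I) • a := by
    rw [← Complex.coe_smul t, smul_smul]
  rw [expI, hI, ← CFC.exp_eq_normedSpace_exp (𝕜 := ℂ), ← cfc_comp_smul _ _ a
    (by exact NormedSpace.exp_continuous.continuousOn)]
  have hlin : cfc (fun z : ℂ => (Real.cos t : ℂ) + (Complex.I * Real.sin t) * z) a =
      (Real.cos t : ℂ) • (1 : A) + (Complex.I * Real.sin t) • a := by
    rw [cfc_const_add _ _ a, cfc_const_mul_id _ a, Algebra.algebraMap_eq_smul_one]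
  rw [← hlin]
  refine cfc_congr fun z hz => ?_
  have hz2 : z ^ 2 = 1 := by
    have := spectrum.pow_mem_pow a 2 hz
    rw [pow_two a, h, spectrum.one_eq] at this
    simpa using this
  simp only [smul_eq_mul, ← Complex.exp_eq_exp_ℂ]
  rcases _root_.sq_eq_one_iff.mp hz2 with rfl | rfl
  · rw [mul_one, Complex.exp_mul_I, Complex.ofReal_cos, Complex.ofReal_sin]
    ring
  · rw [mul_neg_one, ← neg_mul, Complex.exp_mul_I, Complex.cos_neg, Complex.sin_neg,
      Complex.ofReal_cos, Complex.ofReal_sin]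
    ring

/-- `a` is the argument of `u`. Finiteness of the spectrum makes the discontinuous function `arg`
admissible in the continuous functional calculus. -/
theorem exists_expI_eq {u : A} (hu : u ∈ unitary A) (hs : (spectrum ℂ u).Finite) :
    ∃ a : A, IsSelfAdjoint a ∧ expI 1 a = u := by
  refine ⟨cfc (fun z => (Complex.arg z : ℂ)) u, IsSelfAdjoint.cfc_arg u, ?_⟩
  have hn : IsStarNormal u := ⟨by
    rw [Commute, SemiconjBy, (Unitary.mem_iff.mp hu).1, (Unitary.mem_iff.mp hu).2]⟩
  have hc : ∀ f : ℂ → ℂ, ContinuousOn f (spectrum ℂ u) := fun f => hs.continuousOn f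
  rw [expI, one_smul, ← CFC.exp_eq_normedSpace_exp (𝕜 := ℂ),
    ← cfc_comp_smul Complex.I _ _ (by exact NormedSpace.exp_continuous.continuousOn),
    ← cfc_comp' _ _ _ (by
      exact (NormedSpace.exp_continuous.comp (continuous_const_smul _)).continuousOn) (hc _)]
  conv_rhs => rw [← cfc_id' ℂ u]
  refine cfc_congr fun y hy => ?_
  have hy₁ : ‖y‖ = 1 := spectrum.norm_eq_one_of_unitary hu hy
  have hlog : Complex.I * y.arg = Complex.log y :=
    Complex.ext (by simp [Complex.log_re, hy₁]) (by simp [Complex.log_im])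
  have hy0 : y ≠ 0 := by
    rintro rfl
    simp at hy₁
  simpa [← Complex.exp_eq_exp_ℂ, hlog] using Complex.exp_log hy0

end CStar

/-! ### Operators that are approximated by circuits -/

section Universality

open scoped Matrix.Norms.L2Operator

theorem circuitOp_append {n : ℕ} (c d : List (PlacedGate n)) :
    circuitOp (c ++ d) = circuitOp d * circuitOp c := by
  induction c with
  | nil => simp [circuitOp]
  | cons g c ih => rw [List.cons_append, circuitOp, ih, circuitOp, mul_assoc]

/-- The operators of circuits, up to phases. -/
def circuitMonoid (n : ℕ) : Submonoid (QOp n) where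
  carrier := {A | ∃ (z : ℂ) (c : List (PlacedGate n)), ‖z‖ = 1 ∧ A = z • circuitOp c}
  one_mem' := ⟨1, [], by simp, by simp [circuitOp]⟩
  mul_mem' := by
    rintro A B ⟨z, c, hz, rfl⟩ ⟨w, d, hw, rfl⟩
    exact ⟨z * w, d ++ c, by rw [norm_mul, hz, hw, one_mul],
      by rw [circuitOp_append, Matrix.smul_mul, Matrix.mul_smul, smul_smul]⟩

theorem smul_mem_circuitMonoid {n : ℕ} {A : QOp n} (hA : A ∈ circuitMonoid n) {z : ℂ}
    (hz : ‖z‖ = 1) : z • A ∈ circuitMonoid n := by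
  obtain ⟨w, c, hw, rfl⟩ := hA
  exact ⟨z * w, c, by rw [norm_mul, hz, hw, one_mul], by rw [smul_smul]⟩

theorem of_smul_mem_circuitMonoid {n : ℕ} {A : QOp n} {z : ℂ} (hA : z • A ∈ circuitMonoid n)
    (hz : ‖z‖ = 1) : A ∈ circuitMonoid n := by
  have h := smul_mem_circuitMonoid hA (z := z⁻¹) (by rw [norm_inv, hz, inv_one])
  rwa [smul_smul, inv_mul_cancel₀ (norm_ne_zero_iff.mp (by rw [hz]; exact one_ne_zero)),
    one_smul] at h

theorem embed_gate_mem {n : ℕ} (g : Gate) (q : Fin g.arity ↪ Fin n) :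
    embed q g.op ∈ circuitMonoid n :=
  ⟨1, [⟨g, q⟩], by simp, by simp [circuitOp]⟩

theorem embed_pow {n N : ℕ} (e : Fin n ↪ Fin N) (A : QOp n) (m : ℕ) :
    embed e (A ^ m) = embed e A ^ m := by
  induction m with
  | zero => simp [embed_one]
  | succ m ih => rw [pow_succ, pow_succ, embed_mul, ih]

theorem op1_pow (u : Matrix (Fin 2) (Fin 2) ℂ) (m : ℕ) : op1 u ^ m = op1 (u ^ m) := by
  induction m with
  | zero => rw [pow_zero, pow_zero, op1_one]
  | succ m ih => rw [pow_succ, pow_succ, ih, op1_mul]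

/-- The phase of the `π/8` gate. -/
def phaseT : ℂ := Complex.exp (-(Complex.I * Real.pi / 8))

theorem norm_phaseT : ‖phaseT‖ = 1 := by
  have : -(Complex.I * Real.pi / 8) = ((-(Real.pi / 8) : ℝ) : ℂ) * Complex.I := by
    push_cast
    ring
  rw [phaseT, this, Complex.norm_exp_ofReal_mul_I]

theorem phaseT_pow_sixteen : phaseT ^ 16 = 1 := by
  rw [phaseT, ← Complex.exp_nat_mul, Complex.exp_eq_one_iff]
  exact ⟨-1, by push_cast; ring⟩

/-- The phase gate. -/
def matS : Matrix (Fin 2) (Fin 2) ℂ := !![1, 0; 0, Complex.I]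

theorem matT_mul_self : matT * matT = phaseT ^ 2 • matS := by
  have h := inv_sqrt_two_mul_self
  rw [matT_eq, ← phaseT]
  ext a b
  fin_cases a <;> fin_cases b <;> simp [matS] at h ⊢
  · ring
  · linear_combination (phaseT ^ 2 * (1 + Complex.I) ^ 2) * h +
      (phaseT ^ 2 / 2) * Complex.I_mul_I

theorem matS_mul_self : matS * matS = pauli 3 := by
  ext a b
  fin_cases a <;> fin_cases b <;> simp [matS, pauli]

theorem matT_pow_sixteen : matT ^ 16 = 1 := by
  have h : matT ^ 16 = ((matT * matT) * (matT * matT)) ^ 4 := by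
    rw [← pow_two, ← pow_two, ← pow_mul, ← pow_mul]
  have h4 : phaseT ^ 2 * phaseT ^ 2 = phaseT ^ 4 := by ring
  rw [h, matT_mul_self, Matrix.smul_mul, Matrix.mul_smul, smul_smul, matS_mul_self, smul_pow,
    h4, ← pow_mul, phaseT_pow_sixteen, one_smul, pow_succ, pow_succ, pow_two, Z_mul_Z, one_mul,
    Z_mul_Z]

/-- The gates have finite order, so their inverses are again circuits although circuits are defined
as a monoid. -/
theorem exists_gate_conjTranspose (g : Gate) : ∃ m : ℕ, g.opᴴ = g.op ^ m := by
  match g with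
  | .H =>
    refine ⟨1, ?_⟩
    have : (op1 hadamard)ᴴ = op1 hadamard ^ 1 := by
      rw [op1_conjTranspose, hadamard_conjTranspose, pow_one]
    exact this
  | .T =>
    refine ⟨15, ?_⟩
    have h : matT ^ 15 * (matT * matTᴴ) = matTᴴ := by
      rw [← mul_assoc, ← pow_succ, matT_pow_sixteen, one_mul]
    have : (op1 matT)ᴴ = op1 matT ^ 15 := by
      rw [op1_conjTranspose, op1_pow, ← h, matT_unitary, mul_one]
    exact this
  | .CNOT =>
    refine ⟨1, ?_⟩
    have : opCNOTᴴ = opCNOT ^ 1 := by rw [pow_one, CNOT_conjTranspose]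
    rw [CNOT_op]
    exact this

theorem star_mem_circuitMonoid {n : ℕ} {A : QOp n} (hA : A ∈ circuitMonoid n) :
    star A ∈ circuitMonoid n := by
  obtain ⟨z, c, hz, rfl⟩ := hA
  rw [star_smul]
  refine smul_mem_circuitMonoid ?_ (by rw [norm_star, hz])
  induction c with
  | nil =>
    rw [circuitOp, star_one]
    exact one_mem _
  | cons g c ih =>
    obtain ⟨m, hm⟩ := exists_gate_conjTranspose g.1
    rw [circuitOp, star_mul, Matrix.star_eq_conjTranspose (embed _ _), ← embed_conjTranspose, hm,
      embed_pow]
    exact mul_mem (pow_mem (embed_gate_mem _ _) m) ih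

theorem circuitMonoid_unitary {n : ℕ} {A : QOp n} (hA : A ∈ circuitMonoid n) :
    A ∈ unitary (QOp n) := by
  obtain ⟨z, c, hz, rfl⟩ := hA
  have hc : circuitOp c * (circuitOp c)ᴴ = 1 := by
    induction c with
    | nil => simp [circuitOp]
    | cons g c ih =>
      rw [circuitOp, Matrix.conjTranspose_mul, mul_assoc, ← mul_assoc (embed _ _),
        ← embed_conjTranspose, ← embed_mul, gate_unitary, embed_one, one_mul, ih]
  have h : z • circuitOp c * star (z • circuitOp c) = 1 := by
    rw [star_smul, Matrix.smul_mul, Matrix.mul_smul, smul_smul, RCLike.star_def,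
      Complex.mul_conj', hz, Matrix.star_eq_conjTranspose, hc]
    simp
  exact Unitary.mem_iff.mpr ⟨mul_eq_one_comm.mp h, h⟩

/-- The operators that are approximated by circuits, up to phases. -/
def circuitClosure (n : ℕ) : Submonoid (QOp n) := (circuitMonoid n).topologicalClosure

theorem mem_circuitClosure {n : ℕ} {A : QOp n} (hA : A ∈ circuitMonoid n) :
    A ∈ circuitClosure n :=
  (circuitMonoid n).le_topologicalClosure hA

/-- The Hermitian operators whose one-parameter groups are approximated by circuits. -/
def circuitGenerators (n : ℕ) : Submodule ℝ (QOp n) :=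
  generators (circuitClosure n) (circuitMonoid n).isClosed_topologicalClosure

theorem conj_mem_circuitGenerators {n : ℕ} {A V B : QOp n} (hV : V ∈ circuitMonoid n)
    (hA : A ∈ circuitGenerators n) (h : V * A = B * V) : B ∈ circuitGenerators n := by
  have hu := circuitMonoid_unitary hV
  have := conj_mem_generators hu (mem_circuitClosure hV)
    (mem_circuitClosure (star_mem_circuitMonoid hV)) hA
  rwa [h, mul_assoc, (Unitary.mem_iff.mp hu).2, mul_one] at this

/-! ### Single-qubit operators in a register -/

/-- The operator `u` on the qubit `k`. -/
def loc {n : ℕ} (k : Fin n) (u : Matrix (Fin 2) (Fin 2) ℂ) : QOp n :=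
  embed ⟨fun _ : Fin 1 => k, fun _ _ _ => Subsingleton.elim _ _⟩ (op1 u)

theorem loc_eq {n : ℕ} (k : Fin n) (u : Matrix (Fin 2) (Fin 2) ℂ) :
    loc k u = tensor (Function.update (fun _ => 1) k u) := by
  rw [loc, op1, embed_tensor, extend_eq]
  · intro i
    exact Function.update_self _ _ _
  · intro l hl
    rw [Function.update_of_ne]
    exact fun h => hl 0 h.symm

theorem loc_mul {n : ℕ} (k : Fin n) (u v : Matrix (Fin 2) (Fin 2) ℂ) :
    loc k (u * v) = loc k u * loc k v := by
  rw [loc, ← op1_mul, embed_mul]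
  rfl

theorem loc_one {n : ℕ} (k : Fin n) : loc k 1 = 1 := by
  rw [loc, op1_one, embed_one]

theorem loc_smul {n : ℕ} (k : Fin n) (z : ℂ) (u : Matrix (Fin 2) (Fin 2) ℂ) :
    loc k (z • u) = z • loc k u := by
  rw [loc, op1_smul, embed_smul]
  rfl

theorem loc_add {n : ℕ} (k : Fin n) (u v : Matrix (Fin 2) (Fin 2) ℂ) :
    loc k (u + v) = loc k u + loc k v := by
  have : op1 (u + v) = op1 u + op1 v := by
    ext x y
    simp [op1, tensor_apply]
  rw [loc, this, embed_add]
  rfl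

theorem loc_conjTranspose {n : ℕ} (k : Fin n) (u : Matrix (Fin 2) (Fin 2) ℂ) :
    (loc k u)ᴴ = loc k uᴴ := by
  rw [loc, ← embed_conjTranspose, op1_conjTranspose]
  rfl

theorem loc_hadamard_mem {n : ℕ} (k : Fin n) : loc k hadamard ∈ circuitMonoid n :=
  embed_gate_mem Gate.H _

theorem loc_matT_mem {n : ℕ} (k : Fin n) : loc k matT ∈ circuitMonoid n :=
  embed_gate_mem Gate.T _

theorem loc_matS_mem {n : ℕ} (k : Fin n) : loc k matS ∈ circuitMonoid n := by
  have h := mul_mem (loc_matT_mem k) (loc_matT_mem k)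
  rw [← loc_mul, matT_mul_self, loc_smul] at h
  exact of_smul_mem_circuitMonoid h (by rw [norm_pow, norm_phaseT, one_pow])

theorem loc_Z_mem {n : ℕ} (k : Fin n) : loc k (pauli 3) ∈ circuitMonoid n := by
  rw [← matS_mul_self, loc_mul]
  exact mul_mem (loc_matS_mem k) (loc_matS_mem k)

theorem matS_mul_X : matS * pauli 1 = pauli 2 * matS := by
  ext a b
  fin_cases a <;> fin_cases b <;> simp [matS, pauli]

theorem matS_mul_Y : matS * pauli 2 = -pauli 1 * matS := by
  ext a b
  fin_cases a <;> fin_cases b <;> simp [matS, pauli]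

/-! ### An irrational rotation -/

/-- The angle of the rotation `T H T H`. -/
def angleTHTH : ℝ := Real.arccos (Real.cos (Real.pi / 8) ^ 2)

theorem cos_angleTHTH : Real.cos angleTHTH = Real.cos (Real.pi / 8) ^ 2 :=
  Real.cos_arccos (by nlinarith [sq_nonneg (Real.cos (Real.pi / 8))]) (Real.cos_sq_le_one _)

theorem cos_angleTHTH_eq : 2 * Real.cos angleTHTH = 1 + √2 / 2 := by
  rw [cos_angleTHTH, Real.cos_sq, ← Real.cos_pi_div_four]
  ring_nf

theorem sin_angleTHTH_sq :
    Real.sin angleTHTH ^ 2 = 1 - Real.cos (Real.pi / 8) ^ 4 := by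
  rw [Real.sin_sq, cos_angleTHTH]
  ring

theorem sin_pi_eighth_pos : 0 < Real.sin (Real.pi / 8) :=
  Real.sin_pos_of_pos_of_lt_pi (by positivity) (by linarith [Real.pi_pos])

theorem cos_pi_eighth_pos : 0 < Real.cos (Real.pi / 8) :=
  Real.cos_pos_of_mem_Ioo ⟨by linarith [Real.pi_pos], by linarith [Real.pi_pos]⟩

theorem sin_angleTHTH_ne_zero : Real.sin angleTHTH ≠ 0 := by
  intro h
  have h₁ := sin_angleTHTH_sq
  rw [h] at h₁
  have h₂ := Real.sin_sq_add_cos_sq (Real.pi / 8)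
  nlinarith [sin_pi_eighth_pos, sq_nonneg (Real.cos (Real.pi / 8)),
    mul_pos sin_pi_eighth_pos sin_pi_eighth_pos]

theorem not_isIntegral_half : ¬IsIntegral ℤ (1 / 2 : ℂ) := by
  intro h
  have h' : IsIntegral ℤ (1 / 2 : ℚ) := by
    have h2 : (1 / 2 : ℂ) = algebraMap ℚ ℂ (1 / 2) := by simp
    rw [h2] at h
    exact (isIntegral_algebraMap_iff (algebraMap ℚ ℂ).injective).mp h
  obtain ⟨y, hy⟩ := IsIntegrallyClosed.isIntegral_iff.mp h'
  have h3 : (2 * y : ℚ) = 1 := by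
    rw [show (y : ℚ) = 1 / 2 from hy]
    norm_num
  have h4 : 2 * y = 1 := by exact_mod_cast h3
  omega

/-- Otherwise `e^{iα}` and `e^{-iα}` would be roots of unity and their sum `2cos α = 1 + √2/2` an
algebraic integer; then so would be `(√2/2)² = 1/2`. -/
theorem irrational_angleTHTH : Irrational (angleTHTH / (2 * Real.pi)) := by
  rintro ⟨r, hr⟩
  have hα : angleTHTH = r * (2 * Real.pi) := by
    rw [hr]
    field_simp
  have hint : ∀ t : ℝ, t = angleTHTH ∨ t = -angleTHTH →
      IsIntegral ℤ (Complex.exp (t * Complex.I)) := by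
    intro t ht
    refine IsIntegral.of_pow (n := r.den) r.den_pos ?_
    have : Complex.exp (t * Complex.I) ^ r.den = 1 := by
      have hq : (r.den : ℂ) * r = r.num := by
        exact_mod_cast Rat.den_mul_eq_num r
      rw [← Complex.exp_nat_mul, Complex.exp_eq_one_iff]
      rcases ht with rfl | rfl
      · refine ⟨r.num, ?_⟩
        rw [hα, ← hq]
        push_cast
        ring
      · refine ⟨-r.num, ?_⟩
        rw [hα]
        push_cast
        rw [← hq]
        ring
    rw [this]
    exact isIntegral_one
  have hsum := (hint _ (Or.inl rfl)).add (hint _ (Or.inr rfl))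
  have h1 : Complex.exp (angleTHTH * Complex.I) + Complex.exp ((-angleTHTH : ℝ) * Complex.I) =
      1 + (√2 / 2 : ℝ) := by
    have := cos_angleTHTH_eq
    rw [Complex.ofReal_neg, ← Complex.two_cos, ← Complex.ofReal_cos]
    exact_mod_cast this
  rw [h1] at hsum
  have h2 := (hsum.sub isIntegral_one).pow 2
  have h3 : (1 + ((√2 / 2 : ℝ) : ℂ) - 1) ^ 2 = 1 / 2 := by
    rw [add_sub_cancel_left, ← Complex.ofReal_pow, div_pow, Real.sq_sqrt (by norm_num)]
    norm_num
  rw [h3] at h2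
  exact not_isIntegral_half h2

/-- The direction of the axis of the rotation `T H T H`. -/
def axisTHTH : Matrix (Fin 2) (Fin 2) ℂ :=
  (Real.cos (Real.pi / 8) : ℂ) • pauli 1 + (Real.sin (Real.pi / 8) : ℂ) • pauli 2 +
    (Real.cos (Real.pi / 8) : ℂ) • pauli 3

theorem matT_eq_rotation : matT = (Real.cos (Real.pi / 8) : ℂ) • 1 -
    (Complex.I * Real.sin (Real.pi / 8)) • pauli 3 := by
  have h₁ : Complex.I * Real.pi / 8 = ((Real.pi / 8 : ℝ) : ℂ) * Complex.I := by
    push_cast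
    ring
  rw [matT, h₁, ← neg_mul, Complex.exp_mul_I, Complex.exp_mul_I, Complex.cos_neg,
    Complex.sin_neg, ← Complex.ofReal_cos, ← Complex.ofReal_sin]
  ext a b
  fin_cases a <;> fin_cases b <;> simp [pauli] <;> ring

theorem hadamard_matT_hadamard : hadamard * matT * hadamard =
    (Real.cos (Real.pi / 8) : ℂ) • 1 - (Complex.I * Real.sin (Real.pi / 8)) • pauli 1 := by
  rw [matT_eq_rotation, mul_sub, Matrix.mul_smul, Matrix.mul_smul, hadamard_mul_Z, mul_one,
    sub_mul, Matrix.smul_mul, Matrix.smul_mul, mul_assoc, hadamard_mul_self, mul_one]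

theorem rotation_mul_rotation (c s : ℂ) :
    (c • 1 - (Complex.I * s) • pauli 3) * (c • 1 - (Complex.I * s) • pauli 1) =
      c ^ 2 • 1 - (Complex.I * s) • (c • pauli 1 + s • pauli 2 + c • pauli 3) := by
  ext a b
  fin_cases a <;> fin_cases b <;> simp [pauli, Matrix.mul_apply] <;> ring

theorem axis_mul_axis (c s : ℂ) :
    (c • pauli 1 + s • pauli 2 + c • pauli 3) * (c • pauli 1 + s • pauli 2 + c • pauli 3) =
      (2 * c ^ 2 + s ^ 2) • 1 := by
  have hI := Complex.I_mul_I
  ext a b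
  fin_cases a <;> fin_cases b <;> simp [pauli] <;>
    first
      | ring1
      | linear_combination (-s ^ 2) * hI

/-- A product of rotations about the third and first axes. The scalar part is the cosine of the new
half-angle, and `σ₃σ₁ = iσ₂` supplies the second component of the axis. -/
theorem matT_mul_hadamard_matT_hadamard : matT * (hadamard * matT * hadamard) =
    (Real.cos angleTHTH : ℂ) • 1 -
      (Complex.I * Real.sin (Real.pi / 8)) • axisTHTH := by
  rw [hadamard_matT_hadamard, matT_eq_rotation, rotation_mul_rotation, axisTHTH, cos_angleTHTH]
  push_cast
  rfl

theorem axisTHTH_mul_self : axisTHTH * axisTHTH =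
    ((1 + Real.cos (Real.pi / 8) ^ 2 : ℝ) : ℂ) • 1 := by
  rw [axisTHTH, axis_mul_axis]
  congr 1
  have h := Real.sin_sq_add_cos_sq (Real.pi / 8)
  have h' : 2 * Real.cos (Real.pi / 8) ^ 2 + Real.sin (Real.pi / 8) ^ 2 =
      1 + Real.cos (Real.pi / 8) ^ 2 := by linarith
  exact_mod_cast h'

theorem axisTHTH_herm : axisTHTHᴴ = axisTHTH := by
  have h := fun v hv => (isReflection_pauli (j := v) hv).herm.eq
  rw [axisTHTH]
  simp [h 1 (by decide), h 2 (by decide), h 3 (by decide)]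

end Universality

section Universality

open scoped Matrix.Norms.L2Operator

/-! ### Generators of one-parameter groups -/

/-- The normalized axis of the rotation `T H T H`. -/
def unitAxis : Matrix (Fin 2) (Fin 2) ℂ :=
  ((Real.sin (Real.pi / 8) / Real.sin angleTHTH : ℝ) : ℂ) • axisTHTH

theorem unitAxis_herm : unitAxisᴴ = unitAxis := by
  rw [unitAxis, Matrix.conjTranspose_smul, axisTHTH_herm, RCLike.star_def, Complex.conj_ofReal]

theorem unitAxis_mul_self : unitAxis * unitAxis = 1 := by
  rw [unitAxis, Matrix.smul_mul, Matrix.mul_smul, axisTHTH_mul_self, smul_smul, smul_smul,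
    ← Complex.ofReal_mul, ← Complex.ofReal_mul]
  -- This is `sin²(1 + cos²) = 1 - cos⁴` at `π/8`, which equals the squared sine of `angleTHTH`.
  have h : Real.sin (Real.pi / 8) / Real.sin angleTHTH *
      (Real.sin (Real.pi / 8) / Real.sin angleTHTH) * (1 + Real.cos (Real.pi / 8) ^ 2) = 1 := by
    have h₁ := sin_angleTHTH_ne_zero
    have h₂ := sin_angleTHTH_sq
    have h₃ := Real.sin_sq (Real.pi / 8)
    field_simp
    rw [h₂, h₃]
    ring
  rw [h, Complex.ofReal_one, one_smul]

theorem matT_mul_hadamard_matT_hadamard' : matT * (hadamard * matT * hadamard) =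
    (Real.cos angleTHTH : ℂ) • 1 - (Complex.I * Real.sin angleTHTH) • unitAxis := by
  rw [matT_mul_hadamard_matT_hadamard, unitAxis, smul_smul, mul_assoc, ← Complex.ofReal_mul,
    mul_div_cancel₀ _ sin_angleTHTH_ne_zero]

theorem loc_sub {n : ℕ} (k : Fin n) (u v : Matrix (Fin 2) (Fin 2) ℂ) :
    loc k (u - v) = loc k u - loc k v := by
  rw [sub_eq_add_neg, ← neg_one_smul ℂ v, loc_add, loc_smul, neg_one_smul, sub_eq_add_neg]

theorem loc_unitAxis_mem {n : ℕ} (k : Fin n) : loc k unitAxis ∈ circuitGenerators n := by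
  have hsa : IsSelfAdjoint (loc k unitAxis) := by
    rw [IsSelfAdjoint, Matrix.star_eq_conjTranspose, loc_conjTranspose, unitAxis_herm]
  have hsq : loc k unitAxis * loc k unitAxis = 1 := by
    rw [← loc_mul, unitAxis_mul_self, loc_one]
  have hR : expI (-angleTHTH) (loc k unitAxis) ∈ circuitMonoid n := by
    have h := mul_mem (loc_matT_mem k)
      (mul_mem (mul_mem (loc_hadamard_mem k) (loc_matT_mem k)) (loc_hadamard_mem k))
    rw [← loc_mul, ← loc_mul, ← loc_mul, matT_mul_hadamard_matT_hadamard', loc_sub, loc_smul,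
      loc_smul, loc_one] at h
    rw [expI_of_mul_self hsa hsq, Real.cos_neg, Real.sin_neg, Complex.ofReal_neg, mul_neg,
      neg_smul, ← sub_eq_add_neg]
    exact h
  have hR' : expI angleTHTH (loc k unitAxis) ∈ circuitMonoid n := by
    have h := star_mem_circuitMonoid hR
    have hu := expI_mem_unitary hsa (-angleTHTH)
    have hinv : expI angleTHTH (loc k unitAxis) * expI (-angleTHTH) (loc k unitAxis) = 1 := by
      rw [← expI_add, add_neg_cancel, expI_zero]
    rwa [← left_inv_eq_right_inv hinv (Unitary.mem_iff.mp hu).2] at h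
  refine mem_generators_of_irrational hsa (mem_circuitClosure hR') (mem_circuitClosure hR)
    (β := 2 * Real.pi) ?_ irrational_angleTHTH
  rw [expI_of_mul_self hsa hsq, Real.cos_two_pi, Real.sin_two_pi]
  simp

theorem loc_real_smul {n : ℕ} (k : Fin n) (r : ℝ) (u : Matrix (Fin 2) (Fin 2) ℂ) :
    loc k ((r : ℂ) • u) = r • loc k u := by
  rw [loc_smul, Complex.coe_smul]

/-- Adding to the axis its conjugate by `σ₃` cancels the components along `σ₁` and `σ₂` and leaves a
nonzero multiple of `σ₃`. -/
theorem loc_Z_mem_circuitGenerators {n : ℕ} (k : Fin n) :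
    loc k (pauli 3) ∈ circuitGenerators n := by
  set r : ℝ := Real.sin (Real.pi / 8) / Real.sin angleTHTH with hr
  set c : ℝ := Real.cos (Real.pi / 8) with hc
  have h₁ := loc_unitAxis_mem k
  have h₂ : loc k (pauli 3 * unitAxis * pauli 3) ∈ circuitGenerators n := by
    refine conj_mem_circuitGenerators (loc_Z_mem k) h₁ ?_
    rw [← loc_mul, ← loc_mul, mul_assoc, Z_mul_Z, mul_one]
  have h₃ : unitAxis + pauli 3 * unitAxis * pauli 3 = ((r * (2 * c) : ℝ) : ℂ) • pauli 3 := by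
    have hX : pauli 3 * pauli 1 * pauli 3 = -pauli 1 := by
      rw [Z_mul_X, neg_mul, mul_assoc, Z_mul_Z, mul_one]
    have hY : pauli 3 * pauli 2 * pauli 3 = -pauli 2 := by
      rw [pauli_three_mul 2, Matrix.smul_mul, mul_assoc, Z_mul_Z, mul_one]
      simp [commZ]
    have hZ : pauli 3 * pauli 3 * pauli 3 = pauli 3 := by rw [Z_mul_Z, one_mul]
    rw [unitAxis, axisTHTH, ← hr, ← hc]
    simp only [mul_add, add_mul, Matrix.mul_smul, Matrix.smul_mul, hX, hY, hZ]
    push_cast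
    module
  have h₄ := (circuitGenerators n).add_mem h₁ h₂
  rw [← loc_add, h₃, loc_real_smul] at h₄
  have h₅ : r * (2 * c) ≠ 0 :=
    mul_ne_zero (div_ne_zero sin_pi_eighth_pos.ne' sin_angleTHTH_ne_zero)
      (mul_ne_zero two_ne_zero cos_pi_eighth_pos.ne')
  exact ((circuitGenerators n).smul_mem_iff h₅).mp h₄

/-! ### Conjugation of Pauli strings by circuits. -/

theorem loc_mul_pauliString {n : ℕ} (k : Fin n) (u : Matrix (Fin 2) (Fin 2) ℂ)
    (j : Fin n → Fin 4) (w : Fin 4) (z : ℂ) (h : u * pauli (j k) = z • (pauli w * u)) :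
    loc k u * pauliString j = (z • pauliString (Function.update j k w)) * loc k u := by
  have hz : z = ∏ l, if l = k then z else 1 := by simp
  rw [Matrix.smul_mul, loc_eq, pauliString, pauliString, tensor_mul, tensor_mul, hz,
    ← tensor_smul]
  congr 1
  funext l
  by_cases hl : l = k
  · subst hl
    simp [h]
  · simp [hl]

theorem pauliString_update_mem {n : ℕ} {j : Fin n → Fin 4} {k : Fin n} {w : Fin 4}
    {u : Matrix (Fin 2) (Fin 2) ℂ} (hu : loc k u ∈ circuitMonoid n)
    (h : u * pauli (j k) = pauli w * u ∨ u * pauli (j k) = -pauli w * u)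
    (hj : pauliString j ∈ circuitGenerators n) :
    pauliString (Function.update j k w) ∈ circuitGenerators n := by
  rcases h with h | h
  · have := conj_mem_circuitGenerators hu hj
      (loc_mul_pauliString k u j w 1 (by rw [h, one_smul]))
    rwa [one_smul] at this
  · have := conj_mem_circuitGenerators hu hj
      (loc_mul_pauliString k u j w (-1) (by rw [h, neg_one_smul, neg_mul]))
    rw [neg_one_smul] at this
    simpa using (circuitGenerators n).neg_mem this

theorem pauliString_update_Z_mem {n : ℕ} {j : Fin n → Fin 4} {k : Fin n} (hk : j k ≠ 0)
    (hj : pauliString j ∈ circuitGenerators n) :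
    pauliString (Function.update j k 3) ∈ circuitGenerators n := by
  have h1 : ∀ {l : Fin n → Fin 4}, l k = 1 → pauliString l ∈ circuitGenerators n →
      pauliString (Function.update l k 3) ∈ circuitGenerators n := fun hl h =>
    pauliString_update_mem (loc_hadamard_mem k) (Or.inl (by rw [hl, hadamard_mul_X])) h
  have hcases : ∀ v : Fin 4, v ≠ 0 → v = 1 ∨ v = 2 ∨ v = 3 := by decide
  rcases hcases _ hk with h | h | h
  · exact h1 h hj
  · have := pauliString_update_mem (w := 1) (loc_matS_mem k) (Or.inr (by rw [h, matS_mul_Y])) hj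
    have := h1 (Function.update_self _ _ _) this
    rwa [Function.update_idem] at this
  · rwa [← h, Function.update_eq_self]

theorem pauliString_update_ne_zero_mem {n : ℕ} {j : Fin n → Fin 4} {k : Fin n} (hk : j k ≠ 0)
    {w : Fin 4} (hw : w ≠ 0) (hj : pauliString j ∈ circuitGenerators n) :
    pauliString (Function.update j k w) ∈ circuitGenerators n := by
  have hZ := pauliString_update_Z_mem hk hj
  have hX := pauliString_update_mem (w := 1) (loc_hadamard_mem k)
    (Or.inl (by rw [Function.update_self, hadamard_mul_Z])) hZ
  have hY := pauliString_update_mem (w := 2) (loc_matS_mem k)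
    (Or.inl (by rw [Function.update_self, matS_mul_X])) hX
  rw [Function.update_idem] at hX
  rw [Function.update_idem, Function.update_idem] at hY
  have hcases : ∀ v : Fin 4, v ≠ 0 → v = 1 ∨ v = 2 ∨ v = 3 := by decide
  rcases hcases _ hw with rfl | rfl | rfl
  · exact hX
  · exact hY
  · exact hZ

/-- A C-NOT with control `a` and target `b` spreads `σ₃` from `b` to `a`; this is how the support of
a string grows. -/
theorem pauliString_CNOT_mem {n : ℕ} {j : Fin n → Fin 4} {a b : Fin n} (hab : a ≠ b)
    (ha : j a = 0) (hb : j b = 3) (hj : pauliString j ∈ circuitGenerators n) :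
    pauliString (Function.update j a 3) ∈ circuitGenerators n := by
  let q : Fin 2 ↪ Fin n := ⟨![a, b], by
    intro x y h
    fin_cases x <;> fin_cases y <;> simp_all⟩
  have hC : embed q opCNOT ∈ circuitMonoid n := by
    rw [← CNOT_op]
    exact embed_gate_mem Gate.CNOT q
  refine conj_mem_circuitGenerators hC hj ?_
  have hE : ∀ A B : Matrix (Fin 2) (Fin 2) ℂ, embed q (tensor ![A, B]) =
      tensor (Function.update (Function.update (fun _ => 1) b B) a A) := by
    intro A B
    rw [embed_tensor, extend_eq]
    · intro i
      fin_cases i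
      · exact Function.update_self _ _ _
      · exact (Function.update_of_ne hab.symm _ _).trans (Function.update_self _ _ _)
    · intro k hk
      have hka : k ≠ a := fun h => hk 0 h.symm
      have hkb : k ≠ b := fun h => hk 1 h.symm
      rw [Function.update_of_ne hka, Function.update_of_ne hkb]
  rw [opCNOT, embed_add, hE, hE, add_mul, mul_add]
  congr 1
  · rw [pauliString, pauliString, tensor_mul, tensor_mul]
    congr 1
    funext k
    by_cases hka : k = a
    · subst hka
      simp [ha, pauli_zero, Z_mul_ket0]
    · by_cases hkb : k = b
      · subst hkb
        simp [hka, hb]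
      · simp [hka]
  -- In the branch `|1⟩` of the control, `σ₃` gives a sign at `a` and anticommutes with the flip at
  -- `b`; the two signs cancel.
  · have hs : ∏ k, (if k = a then (-1 : ℂ) else 1) * (if k = b then (-1 : ℂ) else 1) = 1 := by
      rw [Finset.prod_mul_distrib]
      simp
    rw [pauliString, pauliString, tensor_mul, tensor_mul, ← one_smul ℂ (tensor _), ← hs,
      ← tensor_smul]
    congr 1
    funext k
    by_cases hka : k = a
    · subst hka
      simp [ha, hab, pauli_zero, Z_mul_ket1]
    · by_cases hkb : k = b
      · subst hkb
        simp [hka, hb, Z_mul_X]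
      · simp [hka, hkb]

/-- Its one-parameter group consists of the global phases, which `circuitMonoid` contains. -/
theorem one_mem_circuitGenerators (n : ℕ) : (1 : QOp n) ∈ circuitGenerators n := by
  refine ⟨IsSelfAdjoint.one _, fun t => mem_circuitClosure ?_⟩
  rw [expI_of_mul_self (IsSelfAdjoint.one _) (mul_one 1), ← add_smul]
  refine smul_mem_circuitMonoid (one_mem _) ?_
  rw [mul_comm, Complex.ofReal_cos, Complex.ofReal_sin, ← Complex.exp_mul_I,
    Complex.norm_exp_ofReal_mul_I]

theorem pauliString_mem_circuitGenerators {n : ℕ} (j : Fin n → Fin 4) :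
    pauliString j ∈ circuitGenerators n := by
  by_cases hj : j = 0
  · subst hj
    rw [show pauliString (0 : Fin n → Fin 4) = 1 from tensor_one]
    exact one_mem_circuitGenerators n
  obtain ⟨b, hb⟩ := Function.ne_iff.mp hj
  -- The support is enlarged one qubit at a time. Qubit `b` keeps `σ₃` meanwhile, so that it can be
  -- the target of each C-NOT, and receives `j b` only at the end.
  have key : ∀ s : Finset (Fin n),
      pauliString (fun k => if k = b then 3 else if k ∈ s then j k else 0) ∈
        circuitGenerators n := by
    intro s
    induction s using Finset.induction_on with
    | empty =>
      have h := loc_Z_mem_circuitGenerators b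
      rw [loc_eq, ← pauliString_single] at h
      convert h using 2
      funext k
      simp [Pi.single_apply]
    | insert a s ha ih =>
      by_cases hja : a = b ∨ j a = 0
      · convert ih using 2
        funext k
        by_cases hk : k = a
        · subst hk
          rcases hja with rfl | h0
          · simp
          · simp [h0]
        · simp [hk]
      · push Not at hja
        have h₁ := pauliString_CNOT_mem hja.1 (by simp [hja.1, ha]) (by simp) ih
        have h₂ := pauliString_update_ne_zero_mem (k := a) (by simp) hja.2 h₁
        rw [Function.update_idem] at h₂
        convert h₂ using 2
        funext k
        by_cases hk : k = a
        · subst hk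
          simp [hja.1]
        · simp [hk]
  have h := pauliString_update_ne_zero_mem (k := b) (by simp) hb (key Finset.univ)
  convert h using 2
  funext k
  by_cases hk : k = b
  · subst hk
    simp
  · simp [hk]

/-! ### From Pauli strings to all unitary operators. -/

theorem exists_sum_pauliString {n : ℕ} (A : QOp n) :
    ∃ c : (Fin n → Fin 4) → ℂ, A = ∑ j, c j • pauliString j := by
  refine ⟨fun j => (1 / 2) ^ n * ∑ x, ∑ y, star (pauliString j x y) * A x y, ?_⟩
  ext a b
  simp only [Matrix.sum_apply, Matrix.smul_apply, smul_eq_mul, mul_assoc, Finset.sum_mul]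
  rw [← Finset.mul_sum, Finset.sum_comm]
  have h : ∀ x, ∑ j, ∑ y, star (pauliString j x y) * (A x y * pauliString j a b) =
      if a = x then 2 ^ n * A x b else 0 := by
    intro x
    rw [Finset.sum_comm]
    have h' : ∀ y, ∑ j, star (pauliString j x y) * (A x y * pauliString j a b) =
        (if a = x ∧ b = y then 2 ^ n else 0) * A x y := by
      intro y
      rw [← sum_pauliString_mul_star, Finset.sum_mul]
      exact Finset.sum_congr rfl fun j _ => by ring
    simp only [h']
    by_cases hx : a = x <;> simp [hx]
  simp only [h, Finset.sum_ite_eq, Finset.mem_univ, if_true]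
  rw [← mul_assoc, ← mul_pow]
  norm_num

theorem isSelfAdjoint_mem_circuitGenerators {n : ℕ} {A : QOp n} (hA : IsSelfAdjoint A) :
    A ∈ circuitGenerators n := by
  obtain ⟨c, hc⟩ := exists_sum_pauliString A
  have h : A = ∑ j, (c j).re • pauliString j := by
    -- Averaging with the adjoint replaces the coefficients by their real parts, as required in a
    -- real vector space of generators.
    have h₂ : A = (1 / 2 : ℂ) • (A + star A) := by
      rw [hA.star_eq, ← two_smul ℂ A, smul_smul]
      norm_num
    rw [h₂, hc, star_sum, ← Finset.sum_add_distrib, Finset.smul_sum]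
    refine Finset.sum_congr rfl fun j _ => ?_
    rw [star_smul, Matrix.star_eq_conjTranspose, pauliString_conjTranspose, ← add_smul, smul_smul,
      ← Complex.coe_smul, RCLike.star_def, Complex.add_conj]
    congr 1
    push_cast
    ring
  rw [h]
  exact Submodule.sum_mem _ fun j _ =>
    Submodule.smul_mem _ _ (pauliString_mem_circuitGenerators j)

theorem unitary_mem_circuitClosure {n : ℕ} {U : QOp n} (hU : U ∈ Matrix.unitaryGroup (Bits n) ℂ) :
    U ∈ circuitClosure n := by
  obtain ⟨a, ha, rfl⟩ := exists_expI_eq (A := QOp n) hU (Matrix.finite_spectrum U)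
  exact (isSelfAdjoint_mem_circuitGenerators ha).2 1

theorem exists_circuitOp_near {n : ℕ} {U : QOp n} (hU : U ∈ Matrix.unitaryGroup (Bits n) ℂ)
    {ε : ℝ} (hε : 0 < ε) : ∃ (z : ℂ) (c : List (PlacedGate n)), ‖z‖ = 1 ∧
      z • circuitOp c ∈ Matrix.unitaryGroup (Bits n) ℂ ∧
      ‖Matrix.toEuclideanCLM (𝕜 := ℂ) (z • circuitOp c - U)‖ ≤ ε := by
  obtain ⟨V, hV, hd⟩ := Metric.mem_closure_iff.mp (unitary_mem_circuitClosure hU) ε hε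
  have hVu := circuitMonoid_unitary hV
  obtain ⟨z, c, hz, rfl⟩ := hV
  refine ⟨z, c, hz, hVu, ?_⟩
  rw [dist_comm, dist_eq_norm] at hd
  exact hd.le

end Universality

theorem isUniversal_universalSet : IsUniversal universalSet := by
  intro n U hU ε hε
  obtain ⟨z, c, hz, hu, hd⟩ := exists_circuitOp_near hU hε
  have hz0 : z ≠ 0 := norm_ne_zero_iff.mp (by rw [hz]; exact one_ne_zero)
  have hlim : ∀ d : List (PlacedGate n), Filter.Tendsto
      (fun t : ℕ => (d.map fun g => (1 - (1 / 4 : ℝ) ^ g.1.arity) ^ t).sum) Filter.atTop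
      (nhds 0) := by
    intro d
    induction d with
    | nil => simp
    | cons g d ih =>
      have h₁ : (1 / 4 : ℝ) ^ g.1.arity ≤ 1 := pow_le_one₀ (by norm_num) (by norm_num)
      have h₂ : 0 < (1 / 4 : ℝ) ^ g.1.arity := by positivity
      have h := (tendsto_pow_atTop_nhds_zero_of_lt_one (sub_nonneg.mpr h₁)
        (by linarith : 1 - (1 / 4 : ℝ) ^ g.1.arity < 1)).add ih
      rw [add_zero] at h
      simpa using h
  obtain ⟨t, ht⟩ := ((hlim c).eventually (gt_mem_nhds hε)).exists
  obtain ⟨p, -, h⟩ := realizes_circuitOp c t n (Function.Embedding.refl _)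
  refine ⟨_, hu, hd, p, fun ψ hψ => ?_⟩
  -- The circuit approximates `U` only up to the phase `z`. Outputs are determined up to a scalar,
  -- so the input may be read as `z • ψ`.
  have hp : IsProd (Function.Embedding.refl _) (z • ψ) ψ := by
    refine IsProd.of_smul (z := z⁻¹) ?_
    rw [smul_smul, inv_mul_cancel₀ hz0, one_smul]
    exact isProd_refl ψ
  obtain ⟨h₁, h₂⟩ := h _ _ hp
  rw [hψ, mul_one] at h₂
  refine ⟨?_, h₂.trans ht.le⟩
  rwa [Matrix.mulVec_smul, ← Matrix.smul_mulVec] at h₁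

end MeasQC

end

theorem mainTheorem3 :
    -- a finite set of binary measurements that are parities of measurements from {X, Y, Z, W}
    MeasQC.universalSet.Finite ∧
    (∀ M ∈ MeasQC.universalSet,
      MeasQC.IsSeparateOver MeasQC.singleQubitMeas MeasQC.parity M.2) ∧
    -- all of them on two qubits, except two on three qubits
    (∀ M ∈ MeasQC.universalSet, M.1 = 2 ∨ M.1 = 3) ∧
    {M ∈ MeasQC.universalSet | M.1 = 3}.ncard = 2 ∧
    -- every measurement that Nielsen's scheme calls for when it simulates H, T or C-NOT is
    -- composed of measurements of the set, and only of Bell measurements after one failed trial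
    -- (H, C-NOT) or two failed trials (T)
    MeasQC.BasisMeasuredBy (MeasQC.bellMeas 1) (1 : MeasQC.QOp 1) ∧
    (∀ (g : MeasQC.Gate) (errors : List (Fin g.arity → Fin 4)),
      MeasQC.BasisMeasuredBy {p | p.1 ∈ MeasQC.universalSet} (MeasQC.trialGate g.op errors) ∧
      (g.nonBellTrials ≤ errors.length →
        (∃ (j : Fin g.arity → Fin 4) (c : ℂ), ‖c‖ = 1 ∧
          MeasQC.trialGate g.op errors = c • MeasQC.pauliString j) ∧
        MeasQC.BasisMeasuredBy (MeasQC.bellMeas g.arity) (MeasQC.trialGate g.op errors))) ∧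
    -- circuits over {H, T, C-NOT} are simulated exactly; with t trials for each gate, an
    -- a-qubit gate costs 6at operations and fails with probability (1 - 4^(-a))^t
    (∀ (n : ℕ) (c : List (MeasQC.PlacedGate n)) (t : ℕ),
      ∃ p : MeasQC.Protocol MeasQC.universalSet n n,
        p.steps ≤ (c.map fun g => 6 * g.1.arity * t).sum ∧
        p.Simulates (MeasQC.circuitOp c)
          (c.map fun g => (1 - (1 / 4 : ℝ) ^ g.1.arity) ^ t).sum) ∧
    -- arbitrary unitary operators on any number of qubits are simulated to any accuracy
    MeasQC.IsUniversal MeasQC.universalSet := by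
  refine ⟨MeasQC.universalSet_finite, fun M hM => MeasQC.isSeparateOver_of_mem_universalSet hM,
    fun M hM => MeasQC.qubits_of_mem_universalSet hM, MeasQC.ncard_universalSet_three, ?_,
    fun g errors => ⟨MeasQC.basisMeasuredBy_trialGate g errors, fun h => ?_⟩,
    fun n c t => MeasQC.exists_protocol_circuitOp c t, MeasQC.isUniversal_universalSet⟩
  · exact MeasQC.isPauli_one.basisMeasuredBy
  · exact ⟨MeasQC.isPauli_trialGate g errors h,
      (MeasQC.isPauli_trialGate g errors h).basisMeasuredBy⟩
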